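/- **Conventions.** Let $T$ be a complete first-order theory in a language $L$, and let $\mathbb{M}$ be a monster model of $T$: a $\kappa$-saturated and strongly $\kappa$-homogeneous model, where $\kappa>|T|$ is an uncountable strong limit cardinal. A set is *small* if it has fewer than $\kappa$ elements; all base sets below are small subsets of $\mathbb{M}$. A family of formulas $(\psi_i)_{i<\omega}$ is *$k$-inconsistent* if any $k$ of them, with distinct indices, are jointly inconsistent. * $T$ is *$\mathrm{NTP}_2$* if there are no formula $\phi(x,y)$ and array $(a_{s,i})_{s,i<\omega}$ such that $\{\phi(x,a_{s,i})\}_{i<\omega}$ is $2$-inconsistent for every $s<\omega$ and $\{\phi(x,a_{s,f(s)})\}_{s<\omega}$ is consistent for every $f:\omega\to\omega$. * A partial type $p(x)$ over $A$ is *simple* if there are no formula $\phi(x,y)\in L$, tree $(a_\eta)_{\eta\in\omega^{<\omega}}$ and $k<\omega$ such that $\{\phi(x,a_{\eta i})\}_{i<\omega}$ is $k$-inconsistent for every $\eta\in\omega^{<\omega}$ and $\{\phi(x,a_{\eta\restriction i})\}_{i<\omega}\cup p(x)$ is consistent for every $\eta\in\omega^{\omega}$. * A partial type $p$ over $A$ is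 *co-simple over $A$* if there are no formula $\phi(x,y)\in L(A)$, $k<\omega$ and tree $(a_\eta)_{\eta\in\omega^{<\omega}}$, each $a_\eta$ being a finite tuple of realizations of $p$, such that $\{\phi(x,a_{\eta i})\}_{i<\omega}$ is $k$-inconsistent for every $\eta\in\omega^{<\omega}$ and $\{\phi(x,a_{\eta\restriction i})\}_{i<\omega}$ is consistent for every $\eta\in\omega^{\omega}$. * $\phi(x,c)$ *divides* over $A$ if for some $k$ there is a sequence $(c_i)_{i<\omega}$ of realizations of $\operatorname{tp}(c/A)$ with $\{\phi(x,c_i)\}_{i<\omega}$ $k$-inconsistent; a formula *forks* over $A$ if it implies a finite disjunction of formulas each of which divides over $A$. Write $a\perp_A B$ if no formula in $\operatorname{tp}(a/AB)$ forks over $A$. * $A$ is an *extension base* if every complete type over $A$ has a global extension containing no formula that forks over $A$. **Theorem.** Let $T$ be $\mathrm{NTP}_2$, let $A$ be an arbitrary small set, and let $p(x)$ be a simple partial type over $A$. Then $p(x)$ is co-simple over $A$. Moreover, if $A$ is an extension base and $a\models p$, then: 1. (Symmetry) for every tuple $b$, $a\perp_A b$ if and only if $b\perp_A a$; 2. (Right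 transitivity) for every small $B\supseteq A$ and every set $C$, if $a\perp_A B$ and $a\perp_B C$, then $a\perp_A C$. -/

import Mathlib

open scoped FirstOrder Cardinal

universe u v w x y

namespace ModelTheory

/-- A formula with parameters `φ(x, c)`: an `L`-formula `φ(x, y)` with object variables
`x = (x_i)_{i ∈ α}` and a finite tuple `y` of parameter variables, together with a tuple `c`
from `M` that is substituted for `y`. -/
structure PFormula (L : FirstOrder.Language.{u, v}) (M : Type w) (α : Type x) where
  arity : ℕ
  formula : L.Formula (α ⊕ Fin arity)
  params : Fin arity → M

section Basic

variable {L : FirstOrder.Language.{u, v}} {M : Type w} [L.Structure M] {α : Type x} {β : Type y}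

/-- `M ⊨ φ(a, c)`. -/
def PFormula.Realize (θ : PFormula L M α) (a : α → M) : Prop :=
  θ.formula.Realize (Sum.elim a θ.params)

/-- `θ` is an `L(A)`-formula: all of its parameters lie in `A`. -/
def PFormula.Over {L : FirstOrder.Language.{u, v}} {M : Type w} {α : Type x}
    (θ : PFormula L M α) (A : Set M) : Prop :=
  ∀ i, θ.params i ∈ A

/-- The negation of a formula with parameters. -/
def PFormula.neg {L : FirstOrder.Language.{u, v}} {M : Type w} {α : Type x}
    (θ : PFormula L M α) : PFormula L M α :=
  ⟨θ.arity, θ.formula.not, θ.params⟩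

/-- The set `θ(M)` of solutions of `θ`. -/
def PFormula.solutions (θ : PFormula L M α) : Set (α → M) :=
  {a | θ.Realize a}

/-- `p` is a (partial) type over `A`, that is, a set of `L(A)`-formulas. -/
def IsOver {L : FirstOrder.Language.{u, v}} {M : Type w} {α : Type x}
    (p : Set (PFormula L M α)) (A : Set M) : Prop :=
  ∀ θ ∈ p, θ.Over A

/-- `a ⊨ p`. -/
def Realizes (a : α → M) (p : Set (PFormula L M α)) : Prop :=
  ∀ θ ∈ p, θ.Realize a

/-- Consistency of a set of formulas with parameters, given by their sets of solutions in `M`: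
every finite subset is satisfied in `M` (i.e. the set is consistent with the elementary diagram
of `M`). -/
def Consistent {X : Type y} (S : Set (Set X)) : Prop :=
  ∀ F ⊆ S, F.Finite → (⋂₀ F).Nonempty

/-- A sequence of formulas, given by their sets of solutions, is `k`-inconsistent if any `k` of
them (with distinct indices) have no common solution. -/
def KInconsistent {X : Type y} (k : ℕ) (s : ℕ → Set X) : Prop :=
  ∀ I : Finset ℕ, I.card = k → ¬ ∃ a, ∀ i ∈ I, a ∈ s i

/-- `p` is a complete type over `A`, an element of `S(A)`. For `A = M` it is a global type. -/
structure IsCompleteType (p : Set (PFormula L M α)) (A : Set M) : Prop where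
  isOver : IsOver p A
  consistent : Consistent (PFormula.solutions '' p)
  complete : ∀ θ : PFormula L M α, θ.Over A → θ ∈ p ∨ θ.neg ∈ p

variable (L) in
/-- `a ≡_A b`: the tuples `a` and `b` have the same type over `A`. -/
def SameType (A : Set M) (a b : α → M) : Prop :=
  ∀ θ : PFormula L M α, θ.Over A → (θ.Realize a ↔ θ.Realize b)

/-- `φ(x, c)` divides over `A`: for some `k` there is a sequence `(c_i)_{i < ω}` of realizations
of `tp(c/A)` such that `{φ(x, c_i) : i < ω}` is `k`-inconsistent. -/
def PFormula.Divides (θ : PFormula L M α) (A : Set M) : Prop :=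
  ∃ (k : ℕ) (c : ℕ → Fin θ.arity → M),
    (∀ i, SameType L A (c i) θ.params) ∧
      KInconsistent k fun i => {a : α → M | θ.formula.Realize (Sum.elim a (c i))}

/-- `θ` forks over `A`: it implies a finite disjunction of formulas (with parameters anywhere in
`M`), each of which divides over `A`. -/
def PFormula.Forks (θ : PFormula L M α) (A : Set M) : Prop :=
  ∃ (N : ℕ) (ψ : Fin N → PFormula L M α),
    (∀ j, (ψ j).Divides A) ∧ ∀ a, θ.Realize a → ∃ j, (ψ j).Realize a

variable (L) in
/-- `a ⫝_A B`: the type `tp(a/AB)` does not fork over `A`. -/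
def NonForking (a : α → M) (A B : Set M) : Prop :=
  ∀ θ : PFormula L M α, θ.Over (A ∪ B) → θ.Realize a → ¬ θ.Forks A

variable (L) in
/-- `A` is an extension base: every type over `A` has a global extension that does not fork
over `A`. -/
def IsExtensionBase (A : Set M) : Prop :=
  ∀ (n : ℕ) (p : Set (PFormula L M (Fin n))), IsCompleteType p A →
    ∃ q : Set (PFormula L M (Fin n)),
      IsCompleteType q Set.univ ∧ p ⊆ q ∧ ∀ θ ∈ q, ¬ θ.Forks A

/-- The restriction `f ↾ n ∈ ω^{<ω}` of a branch `f ∈ ω^ω`. -/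
def branch (f : ℕ → ℕ) (n : ℕ) : List ℕ :=
  (List.range n).map f

/-- The relation `φ(x, y)` has the tree property inside the type `p(x)`, witnessed by the tree
`(a_η)_{η ∈ ω^{<ω}}`: for some `k`, the set `{φ(x, a_{η i}) : i < ω}` is `k`-inconsistent for
every `η ∈ ω^{<ω}`, while `{φ(x, a_{f ↾ n}) : n < ω} ∪ p(x)` is consistent for every
`f ∈ ω^ω`. -/
def HasTree (φ : (α → M) → (β → M) → Prop) (a : List ℕ → β → M)
    (p : Set (PFormula L M α)) : Prop :=
  ∃ k : ℕ,
    (∀ η : List ℕ, KInconsistent k fun i => {b | φ b (a (η ++ [i]))}) ∧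
    ∀ f : ℕ → ℕ,
      Consistent ((Set.range fun n => {b | φ b (a (branch f n))}) ∪ PFormula.solutions '' p)

/-- The (partial) type `p(x)` is simple: no `L`-formula `φ(x, y)` has the tree property inside
`p(x)`. -/
def IsSimpleType (p : Set (PFormula L M α)) : Prop :=
  ¬ ∃ (m : ℕ) (φ : L.Formula (α ⊕ Fin m)) (a : List ℕ → Fin m → M),
      HasTree (fun b c => φ.Realize (Sum.elim b c)) a p

/-- The (partial) type `p` is co-simple over `A`: no `L(A)`-formula `φ(x, y)`, with
`x` a finite tuple of variables and `y = (y_1, …, y_r)` a finite tuple of variables of the sort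
of `p`, has the tree property witnessed by a tree `(a_η)` such that each `a_η` is a tuple
`(a_{η,1}, …, a_{η,r})` of realizations of `p`. -/
def IsCoSimpleType (p : Set (PFormula L M α)) (A : Set M) : Prop :=
  ¬ ∃ (n r : ℕ) (φ : PFormula L M (Fin n ⊕ (Fin r × α))) (a : List ℕ → Fin r × α → M),
      φ.Over A ∧
      (∀ η j, Realizes (fun i => a η (j, i)) p) ∧
      HasTree (fun b c => φ.Realize (Sum.elim b c)) a (∅ : Set (PFormula L M (Fin n)))

variable (L M) in
/-- The theory of `M` is `NTP₂`: there are no formula `φ(x, y)` and no array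
`(a_{s,i})_{s, i < ω}` such that `{φ(x, a_{s,i}) : i < ω}` is `2`-inconsistent for every `s`
and `{φ(x, a_{s,f(s)}) : s < ω}` is consistent for every `f : ω → ω`. -/
def IsNTP2 : Prop :=
  ¬ ∃ (n m : ℕ) (φ : L.Formula (Fin n ⊕ Fin m)) (a : ℕ → ℕ → Fin m → M),
      (∀ s, KInconsistent 2 fun i => {b : Fin n → M | φ.Realize (Sum.elim b (a s i))}) ∧
      ∀ f : ℕ → ℕ,
        Consistent (Set.range fun s => {b : Fin n → M | φ.Realize (Sum.elim b (a s (f s)))})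

/-- `M` is a monster model of the complete theory `T`, where "small" means "of cardinality
less than `κ`": `κ` is an uncountable strong limit cardinal greater than `|T|`, and `M` is a
`κ`-saturated and strongly `κ`-homogeneous model of `T`. -/
structure IsMonster (T : L.Theory) (M : Type w) [L.Structure M] (κ : Cardinal.{w}) : Prop where
  isComplete : T.IsComplete
  isModel : M ⊨ T
  aleph0_lt : ℵ₀ < κ
  isStrongLimit : κ.IsStrongLimit
  card_lt : Cardinal.lift.{w} L.card < Cardinal.lift.{max u v} κ
  saturated : ∀ (C : Set M) (p : Set (PFormula L M (Fin 1))), #C < κ → IsOver p C →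
    Consistent (PFormula.solutions '' p) → ∃ a : Fin 1 → M, Realizes a p
  homogeneous : ∀ (ι : Type w) (a b : ι → M), #ι < κ → SameType L ∅ a b →
    ∃ σ : M ≃[L] M, ∀ i, σ (a i) = b i

end Basic

end ModelTheory

namespace ModelTheory

open Set FirstOrder

/-! ### Definable sets, finite supports, and automorphisms fixing a base. -/

section Definability

variable {L : FirstOrder.Language.{u, v}} {M : Type w} [L.Structure M]

/-! The engine is `IsMonster.div_union`: if tp(B/Aa) does not divide over A and Φ(x,a) k-divides
over A, then Φ(x,a) still k-divides over AB. Hence a nonforking sequence of conjugates of c over Ab,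
read backwards, is a chain in which each term divides over the preceding ones. Automorphisms unfold
it into a tree of conjugates of c with branches consistent with tp(b/A) (`IsMonster.exists_tree`).
This yields two half-symmetries. If tp(c/Ab) does not fork over A, then tp(b/Ac) does not divide
over A, provided that b realizes a simple type (`IsMonster.ndset_of_simple`) or that c realizes a
co-simple one (`IsMonster.ndset_of_coSimple`).

Co-simplicity. A bad tree gives a sequence z of tuples of realizations of p with {Φ(x,z_j)}
consistent, each Φ(x,z_j) dividing uniformly over A and the earlier terms. Let 𝒰 be a nonprincipal
ultrafilter on z and c a realization of its average type over a set of tuples of realizations of p.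
Over these parameters tp(c) is a coheir, so the first half-symmetry and `IsMonster.div_union` keep
Φ(x,c) dividing over them. This produces inconsistent rows over all earlier rows, and NTP₂
(`IsMonster.cd_of_rows`) forces Morley sequences of 𝒰 to be inconsistent. But they are approximated
by the z_j, which are consistent: a contradiction.

Extension bases. Over them forking equals dividing in NTP₂ theories, by the method of Chernikov and
Kaplan. Over a model, a dividing formula has inconsistent Morley sequences for some coheir
(`IsMonster.exists_cd_ultrafilter`). The broom lemma `IsMonster.broom` then produces a strict
coheir, whose Morley sequences are inconsistent for all dividing formulas at once, and pigeonhole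
turns a forking formula into a dividing one. A model in nonforking position carries this to any
extension base (`IsMonster.div_of_forksSet`). Both half-symmetries thereby become symmetry of
nonforking, and right transitivity follows because `IsMonster.div_union` composes nondivision. -/

theorem definable_iff_formula_params {δ : Type*} {A : Set M} {D : Set (δ → M)} :
    A.Definable L D ↔ ∃ (r : ℕ) (e : Fin r → M) (φ : L.Formula (δ ⊕ Fin r)),
      (∀ i, e i ∈ A) ∧ ∀ v, v ∈ D ↔ φ.Realize (Sum.elim v e) := by
  classical
  constructor
  · intro h
    obtain ⟨A₀, hA₀, h⟩ := Set.definable_iff_finitely_definable.1 h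
    obtain ⟨φ, rfl⟩ := Set.definable_iff_exists_formula_sum.1 h
    let g : (A₀ : Set M) ≃ Fin A₀.card := A₀.equivFin
    refine ⟨A₀.card, fun i => (g.symm i : M),
      φ.relabel (Sum.elim (fun a => Sum.inr (g a)) Sum.inl), fun i => hA₀ (g.symm i).2, ?_⟩
    intro v
    rw [Language.Formula.realize_relabel]
    have : (Sum.elim v fun i => ((g.symm i : (A₀ : Set M)) : M)) ∘
        (Sum.elim (fun a => Sum.inr (g a)) Sum.inl) =
        Sum.elim (fun a : (A₀ : Set M) => (a : M)) v := by
      funext i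
      rcases i with i | i <;> simp
    rw [this]
    rfl
  · rintro ⟨r, e, φ, he, hφ⟩
    rw [Set.definable_iff_exists_formula_sum]
    refine ⟨φ.relabel (Sum.elim Sum.inr fun i => Sum.inl ⟨e i, he i⟩), ?_⟩
    ext v
    rw [hφ]
    simp only [Set.mem_ofPred_eq, Language.Formula.realize_relabel]
    have : (Sum.elim (fun a : A => (a : M)) v) ∘
        (Sum.elim Sum.inr fun i => Sum.inl ⟨e i, he i⟩) = Sum.elim v e := by
      funext i
      rcases i with i | i <;> simp
    rw [this]

theorem definable_realize {δ : Type*} (φ : L.Formula δ) (A : Set M) :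
    A.Definable L {v : δ → M | φ.Realize v} :=
  (Set.empty_definable_iff.2 ⟨φ, rfl⟩).mono (Set.empty_subset A)

theorem definable_section {γ μ : Type*} {A B : Set M} {D : Set (μ ⊕ γ → M)}
    (hD : A.Definable L D) (hAB : A ⊆ B) {z : γ → M} (hz : ∀ i, z i ∈ B) :
    B.Definable L {w : μ → M | Sum.elim w z ∈ D} := by
  rw [Set.definable_iff_exists_formula_sum] at *
  obtain ⟨φ, rfl⟩ := hD
  refine ⟨φ.relabel (Sum.elim (fun a : A => Sum.inl ⟨a, hAB a.2⟩)
    (Sum.elim Sum.inr fun i => Sum.inl ⟨z i, hz i⟩)), ?_⟩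
  ext v
  simp only [Set.mem_ofPred_eq, Language.Formula.realize_relabel]
  have : (Sum.elim (fun a : B => (a : M)) v) ∘ (Sum.elim (fun a : A => Sum.inl ⟨a, hAB a.2⟩)
    (Sum.elim Sum.inr fun i => Sum.inl ⟨z i, hz i⟩)) = Sum.elim (fun a : A => (a : M))
      (Sum.elim v z) := by
    funext i
    rcases i with i | i | i <;> simp
  rw [this]

theorem definable_section_left {γ μ : Type*} {A B : Set M} {D : Set (γ ⊕ μ → M)}
    (hD : A.Definable L D) (hAB : A ⊆ B) {z : γ → M} (hz : ∀ i, z i ∈ B) :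
    B.Definable L {w : μ → M | Sum.elim z w ∈ D} := by
  have := definable_section (hD.preimage_comp (Sum.swap)) hAB hz
  convert! this using 1
  ext w
  simp only [Set.mem_ofPred_eq, Set.mem_preimage]
  have : Sum.elim w z ∘ Sum.swap = Sum.elim z w := by
    funext i
    rcases i with i | i <;> rfl
  rw [this]

/-- Parameters listed in `z` are read as variables. Having the family and not just one fibre allows
the formula to be re-evaluated at other tuples. -/
theorem exists_section_of_definable {γ μ : Type*} {A : Set M} {z : γ → M} {D : Set (μ → M)}
    (hD : (A ∪ Set.range z).Definable L D) :
    ∃ E : Set (γ ⊕ μ → M), A.Definable L E ∧ ∀ w, w ∈ D ↔ Sum.elim z w ∈ E := by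
  classical
  rw [Set.definable_iff_exists_formula_sum] at hD
  obtain ⟨φ, rfl⟩ := hD
  have key : ∀ a : (A ∪ Set.range z : Set M), ∃ t : A ⊕ γ, Sum.elim (fun a : A => (a : M)) z t = a := by
    rintro ⟨a, ha | ⟨i, rfl⟩⟩
    · exact ⟨Sum.inl ⟨a, ha⟩, rfl⟩
    · exact ⟨Sum.inr i, rfl⟩
  choose g hg using key
  let h : (A ∪ Set.range z : Set M) ⊕ μ → A ⊕ (γ ⊕ μ) :=
    Sum.elim (fun a => Sum.map id Sum.inl (g a)) (fun i => Sum.inr (Sum.inr i))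
  refine ⟨{v | (φ.relabel h).Realize (Sum.elim (fun a : A => (a : M)) v)},
    Set.definable_iff_exists_formula_sum.2 ⟨_, rfl⟩, ?_⟩
  intro w
  simp only [Set.mem_ofPred_eq, Language.Formula.realize_relabel]
  have : Sum.elim (fun a : A => (a : M)) (Sum.elim z w) ∘ h =
      Sum.elim (fun a : (A ∪ Set.range z : Set M) => (a : M)) w := by
    funext i
    rcases i with i | i
    · have := hg i
      simp only [Function.comp, h, Sum.elim_inl]
      rw [← this]
      rcases g i with t | t <;> simp
    · simp [h]
  rw [this]

/-- Sequences and trees of tuples are coded below as one infinite tuple. A formula mentions only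
finitely many of its entries, which makes projections and realizations tractable. -/
theorem exists_finite_support {β : Type*} {A : Set M} {D : Set (β → M)} (hD : A.Definable L D) :
    ∃ (V : Finset β) (E : Set (V → M)), A.Definable L E ∧
      ∀ v : β → M, v ∈ D ↔ (fun i : V => v i) ∈ E := by
  classical
  obtain ⟨φ, rfl⟩ := hD
  refine ⟨φ.freeVarFinset, {v | Language.BoundedFormula.Realize (φ.restrictFreeVar id) v default},
    ⟨_, rfl⟩, ?_⟩
  intro v
  exact (Language.BoundedFormula.realize_restrictFreeVar (φ := φ) (f := id) (xs := default) v
    (fun _ => rfl)).symm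

theorem definable_image_comp [Nonempty M] {α β : Type*} [Finite α] {A : Set M} {D : Set (β → M)}
    (hD : A.Definable L D) (f : α → β) :
    A.Definable L ((fun g : β → M => g ∘ f) '' D) := by
  classical
  obtain ⟨V, E, hE, hDE⟩ := exists_finite_support hD
  cases nonempty_fintype α
  let W : Finset β := V ∪ Finset.univ.image f
  have hV : ∀ i ∈ V, i ∈ W := fun i hi => Finset.mem_union_left _ hi
  have hf : ∀ i, f i ∈ W := fun i => Finset.mem_union_right _ (by simp)
  have := (hE.preimage_comp (fun i : V => (⟨i, hV i i.2⟩ : W))).image_comp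
    (fun i => (⟨f i, hf i⟩ : W))
  convert! this using 1
  ext a
  constructor
  · rintro ⟨g, hg, rfl⟩
    exact ⟨fun i => g i, (hDE g).1 hg, rfl⟩
  · rintro ⟨g, hg, rfl⟩
    -- Coordinates outside the support are irrelevant, so any element of `M` fills them.
    let g' : β → M := fun i => if h : i ∈ W then g ⟨i, h⟩ else Classical.arbitrary M
    refine ⟨g', (hDE g').2 ?_, ?_⟩
    · have : (fun i : V => g' i) = g ∘ fun i : V => (⟨i, hV i i.2⟩ : W) := by
        funext i
        simp [g', hV i i.2]
      rw [this]
      exact hg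
    · funext i
      simp [g', hf i]

theorem definable_forall_imp_finset {ι β : Type*} {A : Set M} (s : Finset ι) {D : ι → Set (β → M)}
    (hD : ∀ i, A.Definable L (D i)) : A.Definable L {v | ∀ i ∈ s, v ∈ D i} := by
  convert! Set.definable_biInter_finset hD s using 1
  ext v
  simp

theorem definable_sInter_of_finite {β : Type*} {A : Set M} {F : Set (Set (β → M))}
    (hF : F.Finite) (h : ∀ D ∈ F, A.Definable L D) : A.Definable L (⋂₀ F) := by
  induction F, hF using Set.Finite.induction_on with
  | empty => simp
  | insert _ _ ih =>
    rw [Set.sInter_insert]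
    exact (h _ (Set.mem_insert _ _)).inter (ih fun D hD => h D (Set.mem_insert_of_mem _ hD))

theorem definable_coordinate_eq {β : Type*} {A : Set M} {m : M} (hm : m ∈ A) (i : β) :
    A.Definable L {v : β → M | v i = m} := by
  have := (Set.Definable.singleton_of_mem L hm).preimage_comp (fun _ : Fin 1 => i)
  convert! this using 1

/-- An automorphism fixes the set `A` pointwise. -/
def Fixes (A : Set M) (σ : M ≃[L] M) : Prop := ∀ a ∈ A, σ a = a

theorem Fixes.mono {A B : Set M} {σ : M ≃[L] M} (h : Fixes B σ) (hAB : A ⊆ B) : Fixes A σ :=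
  fun a ha => h a (hAB ha)

theorem Fixes.refl (A : Set M) : Fixes A (Language.Equiv.refl L M) := fun _ _ => rfl

theorem Fixes.comp {A : Set M} {σ τ : M ≃[L] M} (hσ : Fixes A σ) (hτ : Fixes A τ) :
    Fixes A (σ.comp τ) := fun a ha => by
  rw [Language.Equiv.comp_apply, hτ a ha, hσ a ha]

theorem Fixes.symm {A : Set M} {σ : M ≃[L] M} (hσ : Fixes A σ) : Fixes A σ.symm := fun a ha => by
  conv_lhs => rw [← hσ a ha]
  exact σ.symm_apply_apply a

theorem Fixes.mem_iff {β : Type*} {A : Set M} {σ : M ≃[L] M} (hσ : Fixes A σ) {D : Set (β → M)}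
    (hD : A.Definable L D) (v : β → M) : σ ∘ v ∈ D ↔ v ∈ D := by
  rw [Set.definable_iff_exists_formula_sum] at hD
  obtain ⟨φ, rfl⟩ := hD
  simp only [Set.mem_ofPred_eq]
  rw [← Language.StrongHomClass.realize_formula σ φ (v := Sum.elim (fun a : A => (a : M)) v)]
  have : Sum.elim (fun a : A => (a : M)) (σ ∘ v) = σ ∘ Sum.elim (fun a : A => (a : M)) v := by
    funext i
    rcases i with i | i
    · exact (hσ i i.2).symm
    · rfl
  rw [this]

theorem definable_image_equiv {β : Type*} {A : Set M} (σ : M ≃[L] M) {D : Set (β → M)}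
    (hD : A.Definable L D) : (σ '' A).Definable L {v : β → M | σ.symm ∘ v ∈ D} := by
  rw [Set.definable_iff_exists_formula_sum] at *
  obtain ⟨φ, rfl⟩ := hD
  refine ⟨φ.relabel (Sum.map (fun a : A => ⟨σ a, a, a.2, rfl⟩) id), ?_⟩
  ext v
  simp only [Set.mem_ofPred_eq, Language.Formula.realize_relabel]
  rw [← Language.StrongHomClass.realize_formula σ φ]
  have : (σ ∘ Sum.elim (fun a : A => (a : M)) (σ.symm ∘ v)) =
      Sum.elim (fun a : (σ '' A : Set M) => (a : M)) v ∘ Sum.map (fun a : A => ⟨σ a, a, a.2, rfl⟩) id := by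
    funext i
    rcases i with i | i <;> simp
  rw [this]

variable (L) in
/-- `a` and `b` are conjugate by an automorphism fixing `A` pointwise. -/
def Conj {ι : Type*} (A : Set M) (a b : ι → M) : Prop :=
  ∃ σ : M ≃[L] M, Fixes A σ ∧ σ ∘ a = b

theorem Conj.symm {ι : Type*} {A : Set M} {a b : ι → M} (h : Conj L A a b) : Conj L A b a := by
  obtain ⟨σ, hσ, rfl⟩ := h
  exact ⟨σ.symm, hσ.symm, by funext i; simp⟩

theorem Conj.trans {ι : Type*} {A : Set M} {a b c : ι → M} (h : Conj L A a b)
    (h' : Conj L A b c) : Conj L A a c := by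
  obtain ⟨σ, hσ, rfl⟩ := h
  obtain ⟨τ, hτ, rfl⟩ := h'
  exact ⟨τ.comp σ, hτ.comp hσ, rfl⟩

theorem Conj.mono {ι : Type*} {A B : Set M} {a b : ι → M} (h : Conj L B a b) (hAB : A ⊆ B) :
    Conj L A a b := by
  obtain ⟨σ, hσ, rfl⟩ := h
  exact ⟨σ, hσ.mono hAB, rfl⟩

theorem Conj.comp {ι ι' : Type*} {A : Set M} {a b : ι → M} (h : Conj L A a b) (f : ι' → ι) :
    Conj L A (a ∘ f) (b ∘ f) := by
  obtain ⟨σ, hσ, rfl⟩ := h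
  exact ⟨σ, hσ, rfl⟩

theorem Conj.mem_iff {ι : Type*} {A : Set M} {a b : ι → M} (h : Conj L A a b) {D : Set (ι → M)}
    (hD : A.Definable L D) : a ∈ D ↔ b ∈ D := by
  obtain ⟨σ, hσ, rfl⟩ := h
  exact (hσ.mem_iff hD a).symm

end Definability

/-! ### Saturation, homogeneity, and small elementary submodels. -/

section Saturation

variable {L : FirstOrder.Language.{u, v}} {T : L.Theory} {M : Type w} [L.Structure M]
  {κ : Cardinal.{w}}

theorem exists_pformula {ι : Type*} {A : Set M} {D : Set (ι → M)} (hD : A.Definable L D) :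
    ∃ θ : PFormula L M ι, θ.Over A ∧ θ.solutions = D := by
  obtain ⟨r, e, φ, he, h⟩ := definable_iff_formula_params.1 hD
  exact ⟨⟨r, φ, e⟩, he, by ext v; exact (h v).symm⟩

theorem PFormula.Over.definable {ι : Type*} {A : Set M} {θ : PFormula L M ι} (h : θ.Over A) :
    A.Definable L θ.solutions :=
  definable_iff_formula_params.2 ⟨θ.arity, θ.params, θ.formula, h, fun _ => Iff.rfl⟩

theorem sameType_iff {ι : Type*} {A : Set M} {a b : ι → M} :
    SameType L A a b ↔ ∀ D : Set (ι → M), A.Definable L D → (a ∈ D ↔ b ∈ D) := by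
  constructor
  · intro h D hD
    obtain ⟨θ, hθ, rfl⟩ := exists_pformula hD
    exact h θ hθ
  · intro h θ hθ
    exact h _ hθ.definable

theorem IsMonster.union_lt (hM : IsMonster T M κ) {A B : Set M} (hA : #A < κ) (hB : #B < κ) :
    #(A ∪ B : Set M) < κ :=
  (Cardinal.mk_union_le A B).trans_lt (Cardinal.add_lt_of_lt hM.aleph0_lt.le hA hB)

theorem IsMonster.countable_lt (hM : IsMonster T M κ) {A : Set M} (hA : A.Countable) : #A < κ :=
  (Cardinal.mk_le_aleph0_iff.2 hA.to_subtype).trans_lt hM.aleph0_lt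

theorem IsMonster.range_lt (hM : IsMonster T M κ) {ι : Type*} [Countable ι] (a : ι → M) :
    #(Set.range a) < κ := hM.countable_lt (Set.countable_range a)

-- Saturation is given for one variable only. Partial assignments, as sets of pairs, that are
-- compatible with every finite part of `S` form a family of finite character, so a maximal one
-- exists. It is a function, and one-variable saturation over `C` and the values already taken makes
-- it total.
open Order in
theorem IsMonster.exists_realization (hM : IsMonster T M κ) {ι : Type x}
    (hι : Cardinal.lift.{w} #ι < Cardinal.lift.{x} κ) {C : Set M} (hC : #C < κ)
    {S : Set (Set (ι → M))} (hS : ∀ s ∈ S, C.Definable L s) (fip : Consistent S) :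
    (⋂₀ S).Nonempty := by
  classical
  let Good : Set (Set (ι × M)) := {G | ∀ F ⊆ S, F.Finite → ∀ G₀ ⊆ G, G₀.Finite →
    ∃ x ∈ ⋂₀ F, ∀ p ∈ G₀, x p.1 = p.2}
  have hfc : IsOfFiniteCharacter Good := by
    intro G
    constructor
    · intro hG G₁ hG₁ _ F hF hF' G₀ hG₀
      exact hG F hF hF' G₀ (hG₀.trans hG₁)
    · intro h F hF hF' G₀ hG₀ hfin
      exact h G₀ hG₀ hfin F hF hF' G₀ subset_rfl hfin
  have hempty : (∅ : Set (ι × M)) ∈ Good := by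
    intro F hF hF' G₀ hG₀ _
    obtain ⟨x, hx⟩ := fip F hF hF'
    exact ⟨x, hx, fun p hp => absurd (hG₀ hp) (Set.notMem_empty _)⟩
  obtain ⟨G, -, hG⟩ := hfc.exists_maximal hempty
  have hGgood : G ∈ Good := hG.prop
  have hfun : ∀ i m m', (i, m) ∈ G → (i, m') ∈ G → m = m' := by
    intro i m m' h h'
    obtain ⟨x, -, hx⟩ := hGgood ∅ (Set.empty_subset _) Set.finite_empty {(i, m), (i, m')}
      (by rintro p (rfl | rfl) <;> assumption) (by simp)
    exact (hx (i, m) (by simp)).symm.trans (hx (i, m') (by simp))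
  set C' : Set M := C ∪ Prod.snd '' G with hC'def
  have hC' : #C' < κ := by
    refine hM.union_lt hC ?_
    have hsub : Prod.snd '' G ⊆ Set.range (fun i : {i : ι // ∃ m, (i, m) ∈ G} => i.2.choose) := by
      rintro m ⟨⟨i, m⟩, h, rfl⟩
      have h' : ∃ m, (i, m) ∈ G := ⟨m, h⟩
      exact ⟨⟨i, h'⟩, hfun i _ _ h'.choose_spec h⟩
    refine (Cardinal.mk_le_mk_of_subset hsub).trans_lt ?_
    rw [← Cardinal.lift_lt.{w, x}]
    refine lt_of_le_of_lt Cardinal.mk_range_le_lift (lt_of_le_of_lt ?_ hι)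
    exact Cardinal.lift_le.2 (Cardinal.mk_subtype_le _)
  have htotal : ∀ i, ∃ m, (i, m) ∈ G := by
    intro i
    -- The values at `i` permitted by finitely many conditions. These sets generate the 1-type to be
    -- realized.
    let proj : Set (Set (ι → M)) → Set (ι × M) → Set (Fin 1 → M) := fun F G₀ =>
      (fun g : ι → M => g ∘ (fun _ : Fin 1 => i)) '' (⋂₀ F ∩ {x | ∀ p ∈ G₀, x p.1 = p.2})
    have hne : Nonempty M := by
      obtain ⟨x, -⟩ := fip ∅ (Set.empty_subset _) Set.finite_empty
      exact ⟨x i⟩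
    have hproj : ∀ F ⊆ S, F.Finite → ∀ G₀ ⊆ G, G₀.Finite → C'.Definable L (proj F G₀) := by
      intro F hF hF' G₀ hG₀ hfin
      refine definable_image_comp (Set.Definable.inter ?_ ?_) _
      · exact definable_sInter_of_finite hF' fun D hD =>
          (hS D (hF hD)).mono Set.subset_union_left
      · have : {x : ι → M | ∀ p ∈ G₀, x p.1 = p.2} =
            ⋂₀ ((fun p : ι × M => {x : ι → M | x p.1 = p.2}) '' G₀) := by
          ext x
          simp
        rw [this]
        refine definable_sInter_of_finite (hfin.image _) ?_
        rintro _ ⟨p, hp, rfl⟩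
        exact definable_coordinate_eq (Set.mem_union_right _ (Set.mem_image_of_mem _ (hG₀ hp))) _
    let q : Set (PFormula L M (Fin 1)) := {θ | θ.Over C' ∧
      ∃ F ⊆ S, F.Finite ∧ ∃ G₀ ⊆ G, G₀.Finite ∧ proj F G₀ ⊆ θ.solutions}
    have hq : Consistent (PFormula.solutions '' q) := by
      intro H hH hHfin
      have : ∃ F ⊆ S, F.Finite ∧ ∃ G₀ ⊆ G, G₀.Finite ∧ proj F G₀ ⊆ ⋂₀ H := by
        induction H, hHfin using Set.Finite.induction_on with
        | empty => exact ⟨∅, Set.empty_subset _, Set.finite_empty, ∅, Set.empty_subset _,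
            Set.finite_empty, by simp⟩
        | @insert s H _ _ ih =>
          obtain ⟨F, hF, hF', G₀, hG₀, hG₀', h⟩ := ih ((Set.subset_insert _ _).trans hH)
          obtain ⟨θ, ⟨-, F1, hF1, hF1', G1, hG1, hG1', h1⟩, rfl⟩ := hH (Set.mem_insert s H)
          refine ⟨F ∪ F1, Set.union_subset hF hF1, hF'.union hF1', G₀ ∪ G1,
            Set.union_subset hG₀ hG1, hG₀'.union hG1', ?_⟩
          rw [Set.sInter_insert]
          refine Set.subset_inter (subset_trans ?_ h1) (subset_trans ?_ h)
          · refine Set.image_mono (Set.inter_subset_inter ?_ ?_)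
            · exact Set.sInter_subset_sInter Set.subset_union_right
            · exact fun x hx p hp => hx p (Or.inr hp)
          · refine Set.image_mono (Set.inter_subset_inter ?_ ?_)
            · exact Set.sInter_subset_sInter Set.subset_union_left
            · exact fun x hx p hp => hx p (Or.inl hp)
      obtain ⟨F, hF, hF', G₀, hG₀, hG₀', h⟩ := this
      obtain ⟨x, hx, hx'⟩ := hGgood F hF hF' G₀ hG₀ hG₀'
      exact ⟨_, h ⟨x, ⟨hx, hx'⟩, rfl⟩⟩
    obtain ⟨a, ha⟩ := hM.saturated C' q hC' (fun θ hθ => hθ.1) hq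
    have hmem : ∀ F ⊆ S, F.Finite → ∀ G₀ ⊆ G, G₀.Finite → a ∈ proj F G₀ := by
      intro F hF hF' G₀ hG₀ hG₀'
      obtain ⟨θ, hθ, hθ'⟩ := exists_pformula (hproj F hF hF' G₀ hG₀ hG₀')
      have := ha θ ⟨hθ, F, hF, hF', G₀, hG₀, hG₀', hθ'.ge⟩
      rw [← hθ']
      exact this
    refine ⟨a 0, ?_⟩
    have hins : insert (i, a 0) G ∈ Good := by
      intro F hF hF' G₀ hG₀ hG₀'
      obtain ⟨x, ⟨hx, hx'⟩, hxa⟩ := hmem F hF hF' (G₀ \ {(i, a 0)}) (by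
        rintro p ⟨hp, hp'⟩
        exact (hG₀ hp).resolve_left hp') hG₀'.sdiff
      refine ⟨x, hx, fun p hp => ?_⟩
      by_cases hpi : p = (i, a 0)
      · subst hpi
        exact congrFun hxa 0
      · exact hx' p ⟨hp, hpi⟩
    exact hG.le_of_ge hins (Set.subset_insert _ _) (Set.mem_insert _ _)
  choose f hf using htotal
  refine ⟨f, fun s hs => ?_⟩
  -- Membership in `s` depends on the finite set `V`, and some point of `s` agrees with `f` there.
  obtain ⟨V, E, -, hE⟩ := exists_finite_support (hS s hs)
  obtain ⟨x, hx, hx'⟩ := hGgood {s} (by simpa using hs) (Set.finite_singleton s)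
    ((fun i => (i, f i)) '' (V : Set ι)) (by rintro _ ⟨i, -, rfl⟩; exact hf i)
    (V.finite_toSet.image _)
  have hxs : x ∈ s := hx s rfl
  rw [hE] at hxs ⊢
  convert! hxs using 1
  funext i
  exact (hx' (i, f i) ⟨i, i.2, rfl⟩).symm

theorem IsMonster.exists_realization_of_countable (hM : IsMonster T M κ) {ι : Type x} [Countable ι]
    {C : Set M} (hC : #C < κ)
    {S : Set (Set (ι → M))} (hS : ∀ s ∈ S, C.Definable L s) (fip : Consistent S) :
    (⋂₀ S).Nonempty := by
  refine hM.exists_realization ?_ hC hS fip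
  calc Cardinal.lift.{w} #ι ≤ ℵ₀ := by
        rw [Cardinal.lift_le_aleph0]; exact Cardinal.mk_le_aleph0_iff.2 inferInstance
    _ < Cardinal.lift.{x} κ := by rw [Cardinal.aleph0_lt_lift]; exact hM.aleph0_lt

/-- Two small tuples that lie in the same `A`-definable sets are conjugate over the small set `A`.
-/
theorem IsMonster.conj_of_forall (hM : IsMonster T M κ) {ι : Type x} {A : Set M} (hA : #A < κ)
    {a b : ι → M} (ha : #(Set.range a) < κ)
    (h : ∀ D : Set (ι → M), A.Definable L D → a ∈ D → b ∈ D) : Conj L A a b := by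
  classical
  have hiff : ∀ D : Set (ι → M), A.Definable L D → (a ∈ D ↔ b ∈ D) := fun D hD =>
    ⟨h D hD, fun hb => by_contra fun ha' => h _ hD.compl ha' hb⟩
  have hwell : ∀ i j, a i = a j → b i = b j := by
    intro i j hij
    have hd : A.Definable L {v : ι → M | v i = v j} := by
      have := ((Set.Definable.diagonal L A)).preimage_comp ![i, j]
      convert! this using 1
    exact h _ hd hij
  -- Homogeneity speaks of types over ∅ and of index types in the universe of `M`. So `A` is
  -- enumerated together with the tuple, and `a` is indexed by its range; `hwell` shows that no
  -- information is lost.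
  let J := A ⊕ Set.range a
  let f : J → A ⊕ ι := Sum.map id fun t => t.2.choose
  have hf : ∀ t : Set.range a, a t.2.choose = t := fun t => t.2.choose_spec
  obtain ⟨σ, hσ⟩ := hM.homogeneous J (Sum.elim (fun t : A => (t : M)) a ∘ f)
    (Sum.elim (fun t : A => (t : M)) b ∘ f)
    (by rw [Cardinal.mk_sum, Cardinal.lift_id, Cardinal.lift_id]
        exact Cardinal.add_lt_of_lt hM.aleph0_lt.le hA ha)
    (by
      rw [sameType_iff]
      intro D hD
      have h1 := hD.preimage_comp f
      have h2 := definable_section_left (B := A) h1 (Set.empty_subset A)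
        (z := fun t : A => (t : M)) (fun i => i.2)
      exact hiff _ h2)
  refine ⟨σ, fun t ht => hσ (Sum.inl ⟨t, ht⟩), ?_⟩
  funext i
  have := hσ (Sum.inr ⟨a i, i, rfl⟩)
  simp only [f, Function.comp, Sum.map_inr, Sum.elim_inr] at this
  rw [hf ⟨a i, i, rfl⟩] at this
  rw [Function.comp, this]
  exact hwell _ _ (hf ⟨a i, i, rfl⟩)

theorem IsMonster.sameType_iff_conj (hM : IsMonster T M κ) {ι : Type x} [Countable ι] {A : Set M}
    (hA : #A < κ) {a b : ι → M} : SameType L A a b ↔ Conj L A a b := by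
  rw [sameType_iff]
  exact ⟨fun h => hM.conj_of_forall hA (hM.range_lt a) fun D hD => (h D hD).1,
    fun h D hD => h.mem_iff hD⟩

variable (L) in
/-- The Tarski–Vaught property: `N` meets every nonempty `N`-definable set. -/
def TarskiVaught (N : Set M) : Prop :=
  ∀ (μ : Type) [Finite μ] (D : Set (μ → M)), N.Definable L D → D.Nonempty →
    ∃ d ∈ D, ∀ i, d i ∈ N

theorem IsMonster.exists_tarskiVaught (hM : IsMonster T M κ) {A : Set M} (hA : #A < κ) :
    ∃ N : Set M, A ⊆ N ∧ #N < κ ∧ TarskiVaught L N := by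
  obtain ⟨c, hc, hc'⟩ : ∃ c : Cardinal.{w}, c < κ ∧
      Cardinal.lift.{w} L.card = Cardinal.lift.{max u v} c := by
    obtain ⟨c, hc, hc'⟩ := Cardinal.lt_lift_iff.1 hM.card_lt
    exact ⟨c, hc, hc'.symm⟩
  set lam : Cardinal.{w} := max ℵ₀ (max #A c) with hlam
  have hlamκ : lam < κ := max_lt hM.aleph0_lt (max_lt hA hc)
  -- Downward Löwenheim–Skolem needs `lam ≤ #M`; in the other case `M` itself is small.
  rcases le_total lam #M with hle | hle
  · obtain ⟨S, hAS, hS⟩ := FirstOrder.Language.exists_elementarySubstructure_card_eq L (M := M) A lam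
      (le_max_left _ _) (Cardinal.lift_le.2 ((le_max_left _ _).trans (le_max_right _ _)))
      (by rw [hc']; exact Cardinal.lift_le.2 ((le_max_right _ _).trans (le_max_right _ _)))
      (Cardinal.lift_le.2 hle)
    refine ⟨S, hAS, ?_, ?_⟩
    · have := Cardinal.lift_injective hS
      exact this.trans_lt hlamκ
    · intro μ _ D hD hne
      obtain ⟨φ, rfl⟩ := Set.definable_iff_exists_formula_sum.1 hD
      have h1 : (φ.iExs μ).Realize (fun a : S => (a : M)) := by
        rw [Language.Formula.realize_iExs]
        exact hne
      have h2 : (φ.iExs μ).Realize (fun a : S => a) :=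
        (S.subtype.map_formula (φ.iExs μ) (fun a : S => a)).1 h1
      rw [Language.Formula.realize_iExs] at h2
      obtain ⟨d, hd⟩ := h2
      refine ⟨fun i => (d i : M), ?_, fun i => (d i).2⟩
      have h3 := (S.subtype.map_formula φ (Sum.elim (fun a : S => a) d)).2 hd
      simp only [Set.mem_ofPred_eq]
      convert! h3 using 1
      funext i
      rcases i with i | i <;> rfl
  · refine ⟨Set.univ, Set.subset_univ _, ?_, ?_⟩
    · rw [Cardinal.mk_univ]
      exact hle.trans_lt hlamκ
    · rintro μ _ D - ⟨d, hd⟩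
      exact ⟨d, hd, fun i => Set.mem_univ _⟩

end Saturation

/-! ### Dividing, and its preservation when the base grows. -/

section Dividing

variable {L : FirstOrder.Language.{u, v}} {T : L.Theory} {M : Type w} [L.Structure M]
  {κ : Cardinal.{w}}

/-- The family of fibres of `Φ` over the tuples `s i` is `k`-inconsistent. -/
def KInc {ι : Type*} {ξ μ : Type*} (k : ℕ) (Φ : Set (ξ ⊕ μ → M)) (s : ι → μ → M) : Prop :=
  ∀ I : Finset ι, I.card = k → ¬ ∃ x : ξ → M, ∀ i ∈ I, Sum.elim x (s i) ∈ Φ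

theorem KInc.comp {ι ι' : Type*} {ξ μ : Type*} {k : ℕ} {Φ : Set (ξ ⊕ μ → M)} {s : ι → μ → M}
    (h : KInc k Φ s) (f : ι' ↪ ι) : KInc k Φ (s ∘ f) := by
  rintro I hI ⟨x, hx⟩
  refine h (I.map f) (by rw [Finset.card_map, hI]) ⟨x, ?_⟩
  intro i hi
  obtain ⟨j, hj, rfl⟩ := Finset.mem_map.1 hi
  exact hx j hj

theorem KInc.map {ι : Type*} {ξ μ ξ' μ' : Type*} {k : ℕ} {Φ : Set (ξ ⊕ μ → M)}
    {Ψ : Set (ξ' ⊕ μ' → M)} {s : ι → μ → M} {s' : ι → μ' → M} (h : KInc k Φ s)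
    (g : (ξ' → M) → (ξ → M))
    (hg : ∀ x i, Sum.elim x (s' i) ∈ Ψ → Sum.elim (g x) (s i) ∈ Φ) : KInc k Ψ s' := by
  rintro I hI ⟨x, hx⟩
  exact h I hI ⟨g x, fun i hi => hg x i (hx i hi)⟩

theorem sum_elim_comp_equiv {ξ μ : Type*} (σ : M → M) (x : ξ → M) (c : μ → M) :
    σ ∘ Sum.elim x c = Sum.elim (σ ∘ x) (σ ∘ c) := by
  funext i
  rcases i with i | i <;> rfl

theorem KInc.equiv {ι : Type*} {ξ μ : Type*} {k : ℕ} {A : Set M} {Φ : Set (ξ ⊕ μ → M)}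
    (hΦ : A.Definable L Φ) {s : ι → μ → M} (h : KInc k Φ s) {σ : M ≃[L] M} (hσ : Fixes A σ) :
    KInc k Φ fun i => σ ∘ s i := by
  refine h.map (fun x => σ.symm ∘ x) fun x i hx => ?_
  rw [← hσ.mem_iff hΦ, sum_elim_comp_equiv]
  convert! hx using 2
  funext j
  simp

variable (L) in
/-- The fibre of `Φ` over `c` `k`-divides over `A`. -/
def Div {ξ μ : Type*} (Φ : Set (ξ ⊕ μ → M)) (c : μ → M) (k : ℕ) (A : Set M) : Prop :=
  ∃ s : ℕ → μ → M, (∀ i, Conj L A c (s i)) ∧ KInc k Φ s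

theorem Div.mono {ξ μ : Type*} {Φ : Set (ξ ⊕ μ → M)} {c : μ → M} {k : ℕ} {A B : Set M}
    (h : Div L Φ c k B) (hAB : A ⊆ B) : Div L Φ c k A := by
  obtain ⟨s, hs, hk⟩ := h
  exact ⟨s, fun i => (hs i).mono hAB, hk⟩

theorem Div.conj {ξ μ : Type*} {Φ : Set (ξ ⊕ μ → M)} {c c' : μ → M} {k : ℕ} {A : Set M}
    (h : Div L Φ c k A) (hc : Conj L A c c') : Div L Φ c' k A := by
  obtain ⟨s, hs, hk⟩ := h
  exact ⟨s, fun i => hc.symm.trans (hs i), hk⟩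

/-- Change of variables: `f` commutes with the relevant automorphisms, so conjugates go to
conjugates, while `g` pulls common solutions back. -/
theorem Div.map {ξ ξ' μ μ' : Type*} {Φ : Set (ξ ⊕ μ → M)} {Ψ : Set (ξ' ⊕ μ' → M)} {c : μ → M}
    {c' : μ' → M} {k : ℕ} {A : Set M} (h : Div L Φ c k A) (f : (μ → M) → (μ' → M)) (hfc : f c = c')
    (hf : ∀ (σ : M ≃[L] M), Fixes A σ → f (σ ∘ c) = σ ∘ f c)
    (g : (ξ' → M) → (ξ → M))
    (hg : ∀ x d, Conj L A c d → Sum.elim x (f d) ∈ Ψ → Sum.elim (g x) d ∈ Φ) : Div L Ψ c' k A := by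
  obtain ⟨s, hs, hk⟩ := h
  refine ⟨fun i => f (s i), fun i => ?_, hk.map g fun x i hx => hg x _ (hs i) hx⟩
  obtain ⟨σ, hσ, hσs⟩ := hs i
  exact ⟨σ, hσ, by
    change _ = f (s i)
    rw [← hσs, hf σ hσ, hfc]⟩

/-- Compactness arguments below use conditions of this shape or their complements. The map `g`
selects the entries of the large tuple `v` that form the i-th parameter. -/
theorem definable_consistent {ι ξ μ β : Type*} [Finite ξ] {A : Set M} {Φ : Set (ξ ⊕ μ → M)}
    (hΦ : A.Definable L Φ) {E : Set (ξ → M)} (hE : A.Definable L E) (I : Finset ι)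
    (g : ι → μ → β) :
    A.Definable L {v : β → M | ∃ x ∈ E, ∀ i ∈ I, Sum.elim x (fun j => v (g i j)) ∈ Φ} := by
  have h1 : A.Definable L {w : β ⊕ ξ → M | (w ∘ Sum.inr) ∈ E ∧
      ∀ i ∈ I, w ∘ (Sum.elim Sum.inr (fun j => Sum.inl (g i j))) ∈ Φ} :=
    (hE.preimage_comp Sum.inr).inter
      (definable_forall_imp_finset I fun i => hΦ.preimage_comp _)
  have h2 := h1.exists_of_finite
  convert! h2 using 1
  ext v
  refine exists_congr fun x => and_congr Iff.rfl (forall₂_congr fun i _ => ?_)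
  have : Sum.elim v x ∘ (Sum.elim Sum.inr (fun j => Sum.inl (g i j))) =
      Sum.elim x (fun j => v (g i j)) := by
    funext j
    rcases j with j | j <;> rfl
  rw [this]

theorem definable_forall {ι β : Type*} [Finite ι] {A : Set M} {D : ι → Set (β → M)}
    (hD : ∀ i, A.Definable L (D i)) : A.Definable L {v | ∀ i, v ∈ D i} := by
  rw [Set.ofPred_forall]
  exact Set.definable_iInter_of_finite hD

theorem definable_kInc {ι ξ μ β : Type*} [Finite ξ] [Finite ι] {A : Set M} {Φ : Set (ξ ⊕ μ → M)}
    (hΦ : A.Definable L Φ) (k : ℕ) (g : ι → μ → β) :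
    A.Definable L {v : β → M | KInc k Φ fun i j => v (g i j)} := by
  have h1 : ∀ I : Finset ι, A.Definable L {v : β → M | I.card = k →
      ¬ ∃ x, ∀ i ∈ I, Sum.elim x (fun j => v (g i j)) ∈ Φ} := by
    intro I
    by_cases hI : I.card = k
    · have := (definable_consistent hΦ Set.definable_univ I g).compl
      convert! this using 1
      ext v
      simp [hI]
    · simp [hI]
  have := Set.definable_iInter_of_finite h1
  convert! this using 1
  ext v
  simp [KInc]

/-- A family of `k`-inconsistent finite sequences of all lengths inside the members of a filter
base of definable sets yields an infinite such sequence. -/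
theorem IsMonster.exists_kInc_seq (hM : IsMonster T M κ) {ξ μ : Type} [Finite ξ] [Finite μ]
    {C : Set M} (hC : #C < κ) {𝒟 : Set (Set (μ → M))} (h𝒟 : ∀ D ∈ 𝒟, C.Definable L D)
    (huniv : Set.univ ∈ 𝒟) (hinter : ∀ D ∈ 𝒟, ∀ E ∈ 𝒟, D ∩ E ∈ 𝒟) {Φ : Set (ξ ⊕ μ → M)}
    (hΦ : C.Definable L Φ) {k : ℕ}
    (h : ∀ D ∈ 𝒟, ∀ n, ∃ s : Fin (n + 1) → μ → M, (∀ i, s i ∈ D) ∧ KInc k Φ s) :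
    ∃ s : ℕ → μ → M, (∀ i, ∀ D ∈ 𝒟, s i ∈ D) ∧ KInc k Φ s := by
  classical
  let S₁ : Set (Set (ℕ × μ → M)) :=
    {X | ∃ i : ℕ, ∃ D ∈ 𝒟, X = {v | (fun j => v (i, j)) ∈ D}}
  let S₂ : Set (Set (ℕ × μ → M)) :=
    {X | ∃ I : Finset ℕ, I.card = k ∧
      X = {v | ∃ x ∈ (Set.univ : Set (ξ → M)), ∀ i ∈ I, Sum.elim x (fun j => v (i, j)) ∈ Φ}ᶜ}
  obtain ⟨v, hv⟩ := hM.exists_realization_of_countable (ι := ℕ × μ) hC (S := S₁ ∪ S₂) (by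
    rintro X (⟨i, D, hD, rfl⟩ | ⟨I, -, rfl⟩)
    · exact (h𝒟 D hD).preimage_comp (fun j => (i, j))
    · exact (definable_consistent hΦ Set.definable_univ I _).compl) (by
    intro F hF hFfin
    -- Finitely many conditions involve finitely many indices and members of `𝒟`. Since `𝒟` is
    -- closed under intersection, one long enough finite sequence inside one `D` meets them all.
    have : ∃ n : ℕ, ∃ D ∈ 𝒟, ∀ v : ℕ × μ → M, (∀ i < n + 1, (fun j => v (i, j)) ∈ D) →
        (KInc k Φ fun (i : Fin (n + 1)) j => v (i, j)) → v ∈ ⋂₀ F := by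
      induction F, hFfin using Set.Finite.induction_on with
      | empty => exact ⟨0, Set.univ, huniv, fun v _ _ => by simp⟩
      | @insert X F _ _ ih =>
        obtain ⟨n, D, hD, hn⟩ := ih ((Set.subset_insert _ _).trans hF)
        have mono : ∀ m, n ≤ m → ∀ E ⊆ D, ∀ v : ℕ × μ → M,
            (∀ i < m + 1, (fun j => v (i, j)) ∈ E) →
            (KInc k Φ fun (i : Fin (m + 1)) j => v (i, j)) → v ∈ ⋂₀ F := fun m hm E hE v h1 h2 =>
          hn v (fun i hi => hE (h1 i (by omega)))
            (h2.comp (Fin.castLEEmb (by omega : n + 1 ≤ m + 1)))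
        rcases hF (Set.mem_insert X F) with ⟨i, E, hE, rfl⟩ | ⟨I, hI, rfl⟩
        · refine ⟨max n i, D ∩ E, hinter D hD E hE, fun v h1 h2 => ?_⟩
          rw [Set.sInter_insert]
          exact ⟨(h1 i (by omega)).2,
            mono _ (le_max_left _ _) _ Set.inter_subset_left v h1 h2⟩
        · refine ⟨max n (I.sup id), D, hD, fun v h1 h2 => ?_⟩
          rw [Set.sInter_insert]
          refine ⟨?_, mono _ (le_max_left _ _) _ subset_rfl v h1 h2⟩
          rintro ⟨x, -, hx⟩
          have hlt : ∀ m ∈ I, m < max n (I.sup id) + 1 := fun m hm =>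
            Nat.lt_succ_of_le ((Finset.le_sup (f := id) hm).trans (le_max_right _ _))
          refine h2 (I.attachFin hlt) (by rw [Finset.card_attachFin, hI]) ⟨x, fun i hi => ?_⟩
          exact hx _ (Finset.mem_attachFin hlt |>.1 hi)
    obtain ⟨n, D, hD, hn⟩ := this
    obtain ⟨s, hs, hk⟩ := h D hD n
    -- Indices beyond `n` are filled cyclically; `hn` never inspects them.
    refine ⟨fun p => s (Fin.ofNat (n + 1) p.1) p.2, hn _ (fun i hi => hs (Fin.ofNat (n + 1) i)) ?_⟩
    convert! hk using 3 with i
    exact congrFun (congrArg s (by simp)) _)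
  refine ⟨fun i j => v (i, j), fun i D hD => hv _ (Or.inl ⟨i, D, hD, rfl⟩), ?_⟩
  rintro I hI ⟨x, hx⟩
  exact hv _ (Or.inr ⟨I, hI, rfl⟩) ⟨x, Set.mem_univ _, hx⟩

/-- `tp(B / Aa)` does not divide over `A`. -/
def NDset (L : FirstOrder.Language.{u, v}) {M : Type w} [L.Structure M] {μ : Type*}
    (A B : Set M) (a : μ → M) : Prop :=
  ∀ (γ : Type) [Finite γ] (b : γ → M), (∀ i, b i ∈ B) → ∀ (ρ : Set (γ ⊕ μ → M)) (k : ℕ),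
    A.Definable L ρ → Div L ρ a k A → Sum.elim b a ∉ ρ

theorem exists_finite_section {μ : Type*} {A B : Set M} {D : Set (μ → M)}
    (hD : (A ∪ B).Definable L D) :
    ∃ (n : ℕ) (b : Fin n → M) (E : Set (Fin n ⊕ μ → M)), (∀ i, b i ∈ B) ∧ A.Definable L E ∧
      ∀ w, w ∈ D ↔ Sum.elim b w ∈ E := by
  classical
  obtain ⟨r, e, φ, he, h⟩ := definable_iff_formula_params.1 hD
  let g : {i : Fin r // e i ∈ B} ≃ Fin _ := Finite.equivFin _
  let b : Fin (Nat.card {i : Fin r // e i ∈ B}) → M := fun i => e (g.symm i)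
  have hD' : (A ∪ Set.range b).Definable L D := by
    refine definable_iff_formula_params.2 ⟨r, e, φ, fun i => ?_, h⟩
    rcases he i with hi | hi
    · exact Or.inl hi
    · exact Or.inr ⟨g ⟨i, hi⟩, by simp [b]⟩
  obtain ⟨E, hE, hDE⟩ := exists_section_of_definable hD'
  exact ⟨_, b, E, fun i => (g.symm i).2, hE, hDE⟩

/-- If `tp(B / Aa)` does not divide over `A` then `k`-dividing over `A` is preserved over `AB`. -/
theorem IsMonster.div_union (hM : IsMonster T M κ) {ξ μ : Type} [Finite ξ] [Finite μ]
    {A B : Set M} (hA : #A < κ) (hB : #B < κ) {a : μ → M} (hab : NDset L A B a)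
    {Φ : Set (ξ ⊕ μ → M)} (hΦ : A.Definable L Φ) {k : ℕ} (h : Div L Φ a k A) :
    Div L Φ a k (A ∪ B) := by
  have hAB := hM.union_lt hA hB
  obtain ⟨s, hs, hk⟩ := hM.exists_kInc_seq hAB (𝒟 := {D | (A ∪ B).Definable L D ∧ a ∈ D})
    (fun D hD => hD.1) ⟨Set.definable_univ, Set.mem_univ _⟩
    (fun D hD E hE => ⟨hD.1.inter hE.1, hD.2, hE.2⟩) (hΦ.mono Set.subset_union_left) (k := k) (by
      rintro D ⟨hD, haD⟩ n
      by_contra hcon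
      obtain ⟨r, b, E, hb, hE, hDE⟩ := exists_finite_section hD
      -- ρ(y,z) says that z lies in E(y,·) and that E(y,·) contains no k-inconsistent sequence of
      -- length n+1. By the assumption for contradiction, b satisfies ρ(y,a).
      let ρ : Set (Fin r ⊕ μ → M) := E ∩ {v | ∃ w : Fin (n + 1) × μ → M,
        Sum.elim v w ∈ {z : (Fin r ⊕ μ) ⊕ (Fin (n + 1) × μ) → M |
          (∀ i : Fin (n + 1), z ∘ (Sum.elim (Sum.inl ∘ Sum.inl) fun j => Sum.inr (i, j)) ∈ E) ∧
          KInc k Φ fun (i : Fin (n + 1)) j => z (Sum.inr (i, j))}}ᶜ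
      have hρ : A.Definable L ρ := by
        refine hE.inter (Set.Definable.compl (Set.Definable.exists_of_finite ?_))
        refine Set.Definable.inter ?_ (definable_kInc hΦ k _)
        exact definable_forall fun i => hE.preimage_comp _
      have hmem : ∀ (y : Fin r → M) (z : μ → M), Sum.elim y z ∈ ρ ↔ Sum.elim y z ∈ E ∧
          ¬ ∃ w : Fin (n + 1) × μ → M, (∀ i, Sum.elim y (fun j => w (i, j)) ∈ E) ∧
            KInc k Φ fun (i : Fin (n + 1)) j => w (i, j) := by
        intro y z
        refine and_congr Iff.rfl (not_congr (exists_congr fun w => and_congr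
          (forall_congr' fun i => ?_) Iff.rfl))
        have : Sum.elim (Sum.elim y z) w ∘ (Sum.elim (Sum.inl ∘ Sum.inl) fun j => Sum.inr (i, j)) =
            Sum.elim y (fun j => w (i, j)) := by
          funext j
          rcases j with j | j <;> rfl
        rw [this]
      obtain ⟨c, hc, hck⟩ := h
      -- ρ(y,a) divides with constant n+1: if y satisfied ρ(y,c_i) for n+1 indices, those very c_i
      -- would be a k-inconsistent sequence of length n+1 in E(y,·), which ρ excludes.
      refine hab (Fin r) b hb ρ (n + 1) hρ ⟨c, hc, ?_⟩ ?_
      · rintro I hI ⟨y, hy⟩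
        let e := I.orderEmbOfFin hI
        have he : ∀ i, e i ∈ I := fun i => I.orderEmbOfFin_mem hI i
        refine ((hmem y _).1 (hy _ (he 0))).2 ⟨fun p => c (e p.1) p.2, fun i => ?_, ?_⟩
        · exact ((hmem y _).1 (hy _ (he i))).1
        · exact hck.comp e.toEmbedding
      · rw [hmem]
        refine ⟨(hDE a).1 haD, ?_⟩
        rintro ⟨w, hw, hwk⟩
        exact hcon ⟨fun i j => w (i, j), fun i => (hDE _).2 (hw i), hwk⟩)
  exact ⟨s, fun i => hM.conj_of_forall hAB (hM.range_lt a) fun D hD haD => hs i D ⟨hD, haD⟩, hk⟩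

end Dividing

/-! ### The forking ideal and nonforking extensions. -/

section Forking

variable {L : FirstOrder.Language.{u, v}} {T : L.Theory} {M : Type w} [L.Structure M]
  {κ : Cardinal.{w}}

variable (L) in
/-- The set `X` is covered by finitely many formulas that divide over `A`. -/
def ForksSet {ι : Type*} (A : Set M) (X : Set (ι → M)) : Prop :=
  ∃ (J : Type) (_ : Finite J) (ψ : J → PFormula L M ι), (∀ j, (ψ j).Divides A) ∧
    ∀ a ∈ X, ∃ j, (ψ j).Realize a

theorem forks_iff {ι : Type*} {A : Set M} {θ : PFormula L M ι} :
    θ.Forks A ↔ ForksSet L A θ.solutions := by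
  constructor
  · rintro ⟨N, ψ, h, h'⟩
    exact ⟨Fin N, inferInstance, ψ, h, h'⟩
  · rintro ⟨J, _, ψ, h, h'⟩
    refine ⟨Nat.card J, ψ ∘ (Finite.equivFin J).symm, fun j => h _, fun a ha => ?_⟩
    obtain ⟨j, hj⟩ := h' a ha
    exact ⟨Finite.equivFin J j, by simpa using hj⟩

theorem ForksSet.mono {ι : Type*} {A : Set M} {X Y : Set (ι → M)} (h : ForksSet L A Y)
    (hXY : X ⊆ Y) : ForksSet L A X := by
  obtain ⟨J, hJ, ψ, h, h'⟩ := h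
  exact ⟨J, hJ, ψ, h, fun a ha => h' a (hXY ha)⟩

theorem forksSet_empty {ι : Type*} (A : Set M) : ForksSet L A (∅ : Set (ι → M)) :=
  ⟨Empty, inferInstance, Empty.elim, fun j => j.elim, fun _ ha => absurd ha (Set.notMem_empty _)⟩

theorem ForksSet.union {ι : Type*} {A : Set M} {X Y : Set (ι → M)} (hX : ForksSet L A X)
    (hY : ForksSet L A Y) : ForksSet L A (X ∪ Y) := by
  obtain ⟨J, _, ψ, h, h'⟩ := hX
  obtain ⟨J₁, _, ψ₁, h₁, h₁'⟩ := hY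
  refine ⟨J ⊕ J₁, inferInstance, Sum.elim ψ ψ₁, fun j => by rcases j with j | j <;> simp [h, h₁],
    ?_⟩
  rintro a (ha | ha)
  · obtain ⟨j, hj⟩ := h' a ha
    exact ⟨Sum.inl j, hj⟩
  · obtain ⟨j, hj⟩ := h₁' a ha
    exact ⟨Sum.inr j, hj⟩

theorem PFormula.Divides.forksSet {ι : Type*} {A : Set M} {θ : PFormula L M ι} (h : θ.Divides A) :
    ForksSet L A θ.solutions :=
  ⟨Unit, inferInstance, fun _ => θ, fun _ => h, fun _ ha => ⟨(), ha⟩⟩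

theorem Conj.sameType {ι : Type*} {A : Set M} {a b : ι → M} (h : Conj L A a b) :
    SameType L A a b := sameType_iff.2 fun _ hD => h.mem_iff hD

/-- The constants of `ρ` are appended to `d`. The automorphisms moving `d` fix `C`, hence both these
constants and `A`, so the conjugates remain of the required form. -/
theorem Div.exists_pformula {ι δ : Type*} [Finite δ] {A C : Set M} (hAC : A ⊆ C)
    {ρ : Set (ι ⊕ δ → M)} (hρ : C.Definable L ρ) {d : δ → M} {k : ℕ} (h : Div L ρ d k C) :
    ∃ θ : PFormula L M ι, θ.Divides A ∧ θ.solutions = {x | Sum.elim x d ∈ ρ} := by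
  obtain ⟨r, e, φ, he, hφ⟩ := definable_iff_formula_params.1 hρ
  let g := Finite.equivFin (δ ⊕ Fin r)
  let f : (ι ⊕ δ) ⊕ Fin r → ι ⊕ Fin (Nat.card (δ ⊕ Fin r)) :=
    Sum.elim (Sum.elim Sum.inl fun i => Sum.inr (g (Sum.inl i))) fun i => Sum.inr (g (Sum.inr i))
  have key : ∀ (x : ι → M) (c : δ → M),
      (φ.relabel f).Realize (Sum.elim x (Sum.elim c e ∘ g.symm)) ↔ Sum.elim x c ∈ ρ := by
    intro x c
    rw [Language.Formula.realize_relabel, hφ]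
    have : Sum.elim x (Sum.elim c e ∘ g.symm) ∘ f = Sum.elim (Sum.elim x c) e := by
      funext i
      rcases i with (i | i) | i <;> simp [f]
    rw [this]
  refine ⟨⟨_, φ.relabel f, Sum.elim d e ∘ g.symm⟩, ?_, ?_⟩
  · obtain ⟨s, hs, hk⟩ := h
    refine ⟨k, fun i => Sum.elim (s i) e ∘ g.symm, fun i => ?_, ?_⟩
    · obtain ⟨σ, hσ, hσs⟩ := hs i
      refine Conj.sameType (Conj.symm ⟨σ, hσ.mono hAC, ?_⟩)
      rw [← Function.comp_assoc, sum_elim_comp_equiv, hσs]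
      congr 2
      funext i
      exact hσ _ (he i)
    · rintro I hI ⟨x, hx⟩
      exact hk I hI ⟨x, fun i hi => (key x _).1 (hx i hi)⟩
  · ext x
    exact key x d

variable (L) in
/-- `tp(c / AB)` does not fork over `A`. -/
def NF {μ : Type*} (A : Set M) (c : μ → M) (B : Set M) : Prop :=
  ∀ X : Set (μ → M), (A ∪ B).Definable L X → c ∈ X → ¬ ForksSet L A X

theorem nonForking_iff {μ : Type*} {A B : Set M} {c : μ → M} :
    NonForking L c A B ↔ NF L A c B := by
  constructor
  · intro h X hX hc hf
    obtain ⟨θ, hθ, rfl⟩ := ModelTheory.exists_pformula hX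
    exact h θ hθ hc (forks_iff.2 hf)
  · intro h θ hθ hc hf
    exact h _ hθ.definable hc (forks_iff.1 hf)

theorem NF.mono {μ : Type*} {A B C : Set M} {c : μ → M} (h : NF L A c C) (hBC : A ∪ B ⊆ A ∪ C) :
    NF L A c B := fun X hX => h X (hX.mono hBC)

/-- A formula dividing over `A ∪ C` divides over `A` as well. If `c` satisfied it, the type of `c`
would contain a formula that forks over `A`. -/
theorem NF.ndset {μ δ : Type*} [Finite δ] {A C : Set M} {c : μ → M} {e : δ → M}
    (h : NF L A c (C ∪ Set.range e)) : NDset L (A ∪ C) (Set.range c) e := by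
  intro γ _ b hb ρ k hρ hdiv hmem
  choose g hg using hb
  have hb : c ∘ g = b := funext hg
  let ρ' : Set (μ ⊕ δ → M) := (fun v => v ∘ Sum.map g id) ⁻¹' ρ
  have hρ' : (A ∪ C).Definable L ρ' := hρ.preimage_comp _
  have hel : ∀ (x : μ → M) (d : δ → M), Sum.elim x d ∘ Sum.map g id = Sum.elim (x ∘ g) d := by
    intro x d
    funext i
    rcases i with i | i <;> rfl
  have hdiv' : Div L ρ' e k (A ∪ C) := by
    refine hdiv.map id rfl (fun _ _ => rfl) (fun x => x ∘ g) fun x d _ hx => ?_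
    change Sum.elim x d ∘ Sum.map g id ∈ ρ at hx
    rwa [hel] at hx
  obtain ⟨θ, hθ, hsol⟩ := hdiv'.exists_pformula Set.subset_union_left hρ'
  refine h θ.solutions ?_ ?_ hθ.forksSet
  · rw [hsol, ← Set.union_assoc]
    exact definable_section hρ' Set.subset_union_left fun i => Or.inr ⟨i, rfl⟩
  · rw [hsol]
    change Sum.elim c e ∘ Sum.map g id ∈ ρ
    rw [hel, hb]
    exact hmem

/-- Extension for nonforking. -/
theorem IsMonster.exists_conj_NF_of_small (hM : IsMonster T M κ) {μ : Type x}
    (hμ : Cardinal.lift.{w} #μ < Cardinal.lift.{x} κ) {A B D : Set M}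
    (hA : #A < κ) (hB : #B < κ) (hD : #D < κ) {c : μ → M} (h : NF L A c B) :
    ∃ c', Conj L (A ∪ B) c c' ∧ NF L A c' D := by
  have hAB := hM.union_lt hA hB
  let S₁ : Set (Set (μ → M)) := {X | (A ∪ B).Definable L X ∧ c ∈ X}
  let S₂ : Set (Set (μ → M)) := {X | (A ∪ D).Definable L X ∧ ForksSet L A Xᶜ}
  obtain ⟨c', hc'⟩ := hM.exists_realization hμ (hM.union_lt hAB hD) (S := S₁ ∪ S₂) (by
    rintro X (⟨h, -⟩ | ⟨h, -⟩)
    · exact h.mono Set.subset_union_left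
    · exact h.mono (Set.union_subset_union_left _ Set.subset_union_left)) (by
    intro F hF hFfin
    -- Forking sets are closed under finite unions, so finitely many conditions reduce to one member
    -- of tp(c/AB) minus one forking set. If that difference were empty, tp(c/AB) would fork.
    have : ∃ X ∈ S₁, ∃ Y, ForksSet L A Y ∧ X \ Y ⊆ ⋂₀ F := by
      induction F, hFfin using Set.Finite.induction_on with
      | empty => exact ⟨Set.univ, ⟨Set.definable_univ, Set.mem_univ _⟩, ∅, forksSet_empty A,
          by simp⟩
      | @insert X F _ _ ih =>
        obtain ⟨X₁, hX₁, Y, hY, hsub⟩ := ih ((Set.subset_insert _ _).trans hF)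
        rw [Set.sInter_insert]
        rcases hF (Set.mem_insert X F) with hX | hX
        · refine ⟨X ∩ X₁, ⟨hX.1.inter hX₁.1, hX.2, hX₁.2⟩, Y, hY, ?_⟩
          rintro a ⟨⟨h1, h2⟩, h3⟩
          exact ⟨h1, hsub ⟨h2, h3⟩⟩
        · refine ⟨X₁, hX₁, Xᶜ ∪ Y, hX.2.union hY, ?_⟩
          rintro a ⟨h2, h3⟩
          exact ⟨by_contra fun h => h3 (Or.inl h), hsub ⟨h2, fun h => h3 (Or.inr h)⟩⟩
    obtain ⟨X, hX, Y, hY, hsub⟩ := this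
    by_contra hne
    rw [Set.not_nonempty_iff_eq_empty] at hne
    rw [hne, Set.subset_empty_iff, Set.sdiff_eq_empty] at hsub
    exact h X hX.1 hX.2 (hY.mono hsub))
  have hc : #(Set.range c) < κ := by
    rw [← Cardinal.lift_lt.{w, x}]
    exact lt_of_le_of_lt Cardinal.mk_range_le_lift hμ
  refine ⟨c', hM.conj_of_forall hAB hc fun X hX hc => hc' _ (Or.inl ⟨hX, hc⟩), ?_⟩
  intro X hX hc hf
  exact hc' Xᶜ (Or.inr ⟨hX.compl, by rwa [compl_compl]⟩) hc

theorem IsMonster.exists_conj_NF (hM : IsMonster T M κ) {μ : Type} [Finite μ] {A B D : Set M}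
    (hA : #A < κ) (hB : #B < κ) (hD : #D < κ) {c : μ → M} (h : NF L A c B) :
    ∃ c', Conj L (A ∪ B) c c' ∧ NF L A c' D := by
  refine hM.exists_conj_NF_of_small ?_ hA hB hD h
  refine lt_of_le_of_lt (Cardinal.lift_le_aleph0.2 (Cardinal.mk_le_aleph0_iff.2 inferInstance)) ?_
  rw [Cardinal.aleph0_lt_lift]
  exact hM.aleph0_lt

/-- Dependent choice with access to the whole history; `Q` is what a choice may assume about the
earlier ones. -/
theorem exists_seq_of_forall_list {X : Type*} {Q : X → Prop} {P : List X → X → Prop}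
    (h : ∀ l : List X, (∀ y ∈ l, Q y) → ∃ x, Q x ∧ P l x) :
    ∃ u : ℕ → X, ∀ n, Q (u n) ∧ P ((List.range n).map u) (u n) := by
  classical
  have hne : Nonempty X := ⟨(h [] (by simp)).choose⟩
  let f : List X → X := fun l => if hl : ∀ y ∈ l, Q y then (h l hl).choose else Classical.arbitrary X
  have hf : ∀ l, (∀ y ∈ l, Q y) → Q (f l) ∧ P l (f l) := fun l hl => by
    simp only [f, dif_pos hl]
    exact (h l hl).choose_spec
  let L : ℕ → List X := fun n => Nat.rec [] (fun _ l => l ++ [f l]) n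
  let u : ℕ → X := fun n => f (L n)
  have hL : ∀ n, L n = (List.range n).map u := by
    intro n
    induction n with
    | zero => rfl
    | succ n ih =>
      rw [List.range_succ, List.map_append, ← ih]
      rfl
  have hQ : ∀ n, ∀ y ∈ L n, Q y := by
    intro n
    induction n with
    | zero => simp [L]
    | succ n ih =>
      intro y hy
      have : L (n + 1) = L n ++ [f (L n)] := rfl
      rw [this, List.mem_append, List.mem_singleton] at hy
      rcases hy with hy | rfl
      · exact ih y hy
      · exact (hf _ ih).1
  refine ⟨u, fun n => ?_⟩
  rw [← hL]
  exact hf _ (hQ n)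

end Forking

/-! ### From nonforking sequences to trees, and the two half-symmetries. -/

section Trees

variable {L : FirstOrder.Language.{u, v}} {T : L.Theory} {M : Type w} [L.Structure M]
  {κ : Cardinal.{w}}

theorem IsMonster.iUnion_range_lt (hM : IsMonster T M κ) {μ : Type*} [Countable μ] (u : ℕ → μ → M)
    (s : Set ℕ) : #(⋃ l ∈ s, Set.range (u l) : Set M) < κ :=
  hM.countable_lt ((Set.to_countable s).biUnion fun _ _ => Set.countable_range _)

/-- Conjugacy over `A` and `b` preserves the formula relating `b` to `c`; nonforking over the
earlier terms is what makes dividing persist over the later ones. -/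
theorem IsMonster.exists_nonforking_seq (hM : IsMonster T M κ) {ξ μ : Type} [Finite ξ] [Finite μ]
    {A : Set M} (hA : #A < κ) {b : ξ → M} {c : μ → M} (h : NF L A c (Set.range b)) :
    ∃ u : ℕ → μ → M, ∀ n, Conj L (A ∪ Set.range b) c (u n) ∧
      NF L A (u n) (Set.range b ∪ ⋃ l ∈ Set.Iio n, Set.range (u l)) := by
  obtain ⟨u, hu⟩ := exists_seq_of_forall_list
    (Q := fun x : μ → M => Conj L (A ∪ Set.range b) c x)
    (P := fun l x => NF L A x (Set.range b ∪ ⋃ y ∈ {y | y ∈ l}, Set.range y))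
    (fun l _ => by
      refine hM.exists_conj_NF hA (hM.range_lt b) (hM.union_lt (hM.range_lt b) ?_) h
      exact hM.countable_lt ((List.finite_toSet l).countable.biUnion fun _ _ => Set.countable_range _))
  refine ⟨u, fun n => ⟨(hu n).1, (hu n).2.mono ?_⟩⟩
  refine Set.union_subset_union_right _ (Set.union_subset_union_right _ ?_)
  refine Set.iUnion₂_subset fun l hl => ?_
  refine Set.subset_biUnion_of_mem (u := fun y : μ → M => Set.range y) ?_
  exact List.mem_map.2 ⟨l, List.mem_range.2 hl, rfl⟩

/-- Along a nonforking sequence, `k`-dividing over `A` is preserved over later members. -/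
theorem IsMonster.div_later (hM : IsMonster T M κ) {ξ μ : Type} [Finite ξ] [Finite μ]
    {A : Set M} (hA : #A < κ) {u : ℕ → μ → M}
    (hu : ∀ n, NF L A (u n) (⋃ l ∈ Set.Iio n, Set.range (u l))) {Φ : Set (ξ ⊕ μ → M)}
    (hΦ : A.Definable L Φ) {k i : ℕ} (hdiv : Div L Φ (u i) k A) (n : ℕ) (hin : i ≤ n) :
    Div L Φ (u i) k (A ∪ ⋃ l ∈ Set.Ioc i n, Set.range (u l)) := by
  induction n, hin using Nat.le_induction with
  | base => simpa using hdiv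
  | succ n hin ih =>
    set C := ⋃ l ∈ Set.Ioc i n, Set.range (u l) with hC
    have hAC : #(A ∪ C : Set M) < κ := hM.union_lt hA (hM.iUnion_range_lt u _)
    -- Since tp(u_{n+1}/A C u_i) does not fork over A, it does not divide over AC. The term u_{n+1}
    -- can therefore join the base without destroying the dividing at u_i.
    have hnf : NF L A (u (n + 1)) (C ∪ Set.range (u i)) := by
      refine (hu (n + 1)).mono (Set.union_subset_union_right _ (Set.union_subset ?_ ?_))
      · exact Set.biUnion_subset_biUnion_left fun l hl => Nat.lt_succ_of_le hl.2
      · exact Set.subset_biUnion_of_mem (u := fun l => Set.range (u l)) (Nat.lt_succ_of_le hin)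
    have := hM.div_union hAC (hM.range_lt (u (n + 1))) hnf.ndset
      (hΦ.mono Set.subset_union_left) ih
    refine this.mono ?_
    rw [Set.union_assoc]
    refine Set.union_subset_union_right _ (Set.iUnion₂_subset fun l hl => ?_)
    rcases Nat.lt_or_ge n l with h | h
    · have : l = n + 1 := le_antisymm hl.2 h
      subst this
      exact Set.subset_union_right
    · refine subset_trans ?_ Set.subset_union_left
      exact Set.subset_biUnion_of_mem (u := fun l => Set.range (u l)) (⟨hl.1, h⟩ : l ∈ Set.Ioc i n)

theorem branch_succ (f : ℕ → ℕ) (n : ℕ) : branch f (n + 1) = branch f n ++ [f n] := by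
  simp [branch, List.range_succ]

theorem length_branch (f : ℕ → ℕ) (n : ℕ) : (branch f n).length = n := by
  simp [branch]

/-- A dividing chain of length `N + 1` unfolds to a tree of height `N`. -/
theorem exists_finite_tree {ξ μ : Type*} {A : Set M} {Φ : Set (ξ ⊕ μ → M)}
    (hΦ : A.Definable L Φ) {k N : ℕ} {b : ξ → M} {d : ℕ → μ → M}
    (hdiv : ∀ j ≤ N, Div L Φ (d j) k (A ∪ ⋃ l ∈ Set.Iio j, Set.range (d l)))
    (hb : ∀ j ≤ N, Sum.elim b (d j) ∈ Φ) :
    ∃ t : List ℕ → μ → M, (∀ η, Conj L A (d η.length) (t η)) ∧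
      (∀ η : List ℕ, η.length < N → KInc k Φ fun i => t (η ++ [i])) ∧
      ∀ f : ℕ → ℕ, ∃ e, Conj L A b e ∧ ∀ i ≤ N, Sum.elim e (t (branch f i)) ∈ Φ := by
  have hσ : ∀ j, ∃ σ : ℕ → M ≃[L] M, (∀ i, Fixes (A ∪ ⋃ l ∈ Set.Iio j, Set.range (d l)) (σ i)) ∧
      (j ≤ N → KInc k Φ fun i => σ i ∘ d j) := by
    intro j
    by_cases hj : j ≤ N
    · obtain ⟨s, hs, hk⟩ := hdiv j hj
      choose σ hσ hσs using hs
      refine ⟨σ, hσ, fun _ => ?_⟩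
      simpa only [hσs] using hk
    · exact ⟨fun _ => Language.Equiv.refl L M, fun _ => Fixes.refl _, fun h => absurd h hj⟩
  choose σ hσ hσk using hσ
  -- Nodes are read from the tip: the move at the last level acts first, then the automorphism of
  -- the parent. Siblings are thus the image of one inconsistent row under one automorphism.
  let τ : List ℕ → M ≃[L] M := fun l =>
    List.rec (Language.Equiv.refl L M) (fun i r τr => τr.comp (σ (r.length + 1) i)) l
  have hτ : ∀ i r, τ (i :: r) = (τ r).comp (σ (r.length + 1) i) := fun _ _ => rfl
  have hτA : ∀ r, Fixes A (τ r) := by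
    intro r
    induction r with
    | nil => exact Fixes.refl A
    | cons i r ih =>
      rw [hτ]
      exact ih.comp ((hσ _ i).mono Set.subset_union_left)
  refine ⟨fun η => τ η.reverse ∘ d η.length, fun η => ⟨_, hτA _, rfl⟩, ?_, ?_⟩
  · intro η hη
    have := (hσk (η.length + 1) hη).equiv hΦ (hτA η.reverse)
    convert! this using 2 with i
    change τ (η ++ [i]).reverse ∘ _ = _
    rw [List.reverse_append, List.reverse_singleton, List.singleton_append, hτ]
    funext j
    simp
  · intro f
    -- Moves at levels above i fix d_i. So the automorphism attached to the end of a branch carries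
    -- every d_i to its node simultaneously, and carries b to a solution of the whole branch.
    have key : ∀ n i, i ≤ n → τ (branch f n).reverse ∘ d i = τ (branch f i).reverse ∘ d i := by
      intro n i hin
      induction n, hin using Nat.le_induction with
      | base => rfl
      | succ n hin ih =>
        rw [← ih, branch_succ, List.reverse_append, List.reverse_singleton, List.singleton_append,
          hτ]
        funext j
        simp only [Function.comp, Language.Equiv.comp_apply, List.length_reverse, length_branch]
        rw [hσ (n + 1) (f n) (d i j)]
        refine Set.mem_union_right _ ?_
        exact Set.mem_biUnion (x := i) (Nat.lt_succ_of_le hin) ⟨j, rfl⟩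
    refine ⟨τ (branch f N).reverse ∘ b, ⟨_, hτA _, rfl⟩, fun i hi => ?_⟩
    change Sum.elim _ (τ (branch f i).reverse ∘ d (branch f i).length) ∈ Φ
    rw [length_branch, ← key N i hi, ← sum_elim_comp_equiv, (hτA _).mem_iff hΦ]
    exact hb i hi

/-- If `tp(c / Ab)` does not fork over `A`, and some formula in `tp(b / Ac)` `k`-divides over `A`
by varying `c`, then that formula has the tree property, witnessed by conjugates of `c`, along
branches consistent with `tp(b / A)`. -/
theorem IsMonster.exists_tree (hM : IsMonster T M κ) {ξ μ : Type} [Finite ξ] [Finite μ]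
    {A : Set M} (hA : #A < κ) {b : ξ → M} {c : μ → M} (h : NF L A c (Set.range b))
    {Φ : Set (ξ ⊕ μ → M)} (hΦ : A.Definable L Φ) {k : ℕ} (hdiv : Div L Φ c k A)
    (hbc : Sum.elim b c ∈ Φ) :
    ∃ t : List ℕ → μ → M, (∀ η, Conj L A c (t η)) ∧
      (∀ η : List ℕ, KInc k Φ fun i => t (η ++ [i])) ∧
      ∀ (f : ℕ → ℕ) (n : ℕ) (E : Set (ξ → M)), A.Definable L E → b ∈ E →
        ∃ e ∈ E, ∀ i < n, Sum.elim e (t (branch f i)) ∈ Φ := by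
  classical
  obtain ⟨u, hu⟩ := hM.exists_nonforking_seq hA h
  have hfin : ∀ N, ∃ t : List ℕ → μ → M, (∀ η, Conj L A c (t η)) ∧
      (∀ η : List ℕ, η.length < N → KInc k Φ fun i => t (η ++ [i])) ∧
      ∀ f : ℕ → ℕ, ∃ e, Conj L A b e ∧ ∀ i ≤ N, Sum.elim e (t (branch f i)) ∈ Φ := by
    intro N
    -- Reversal: `u (N - j)` divides over `A` and the terms after it, which are those of smaller
    -- index in the reversed sequence.
    obtain ⟨t, ht, ht', ht''⟩ := exists_finite_tree (N := N) (b := b) (d := fun j => u (N - j)) hΦ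
      (fun j hj => by
        have h1 := hM.div_later hA (fun n => (hu n).2.mono
          (Set.union_subset_union_right _ Set.subset_union_right)) hΦ
          (hdiv.conj ((hu (N - j)).1.mono Set.subset_union_left)) N (Nat.sub_le N j)
        refine h1.mono (Set.union_subset_union_right _ (Set.iUnion₂_subset fun l hl => ?_))
        refine Set.subset_biUnion_of_mem (u := fun l => Set.range (u l)) ?_
        have : l < j := hl
        exact ⟨by omega, by omega⟩)
      (fun j hj => by
        obtain ⟨σ, hσ, hσu⟩ := (hu (N - j)).1
        have : σ ∘ b = b := funext fun i => hσ _ (Or.inr ⟨i, rfl⟩)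
        change Sum.elim b (u (N - j)) ∈ Φ
        rw [← hσu, ← this, ← sum_elim_comp_equiv,
          (hσ.mono Set.subset_union_left).mem_iff hΦ]
        exact hbc)
    exact ⟨t, fun η => ((hu _).1.mono Set.subset_union_left).trans (ht η), ht', ht''⟩
  -- Conditions for compactness: nodes realize tp(c/A) (`S₁`), rows are k-inconsistent (`S₂`), and
  -- branches are consistent with tp(b/A) (`S₃`).
  let S₁ : Set (Set (List ℕ × μ → M)) :=
    {X | ∃ η : List ℕ, ∃ D : Set (μ → M), A.Definable L D ∧ c ∈ D ∧ X = {v | (fun j => v (η, j)) ∈ D}}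
  let S₂ : Set (Set (List ℕ × μ → M)) :=
    {X | ∃ (η : List ℕ) (I : Finset ℕ), I.card = k ∧ X = {v | ∃ x ∈ (Set.univ : Set (ξ → M)),
      ∀ i ∈ I, Sum.elim x (fun j => v (η ++ [i], j)) ∈ Φ}ᶜ}
  let S₃ : Set (Set (List ℕ × μ → M)) :=
    {X | ∃ (f : ℕ → ℕ) (n : ℕ) (E : Set (ξ → M)), A.Definable L E ∧ b ∈ E ∧
      X = {v | ∃ x ∈ E, ∀ i ∈ Finset.range n, Sum.elim x (fun j => v (branch f i, j)) ∈ Φ}}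
  obtain ⟨v, hv⟩ := hM.exists_realization_of_countable (ι := List ℕ × μ) hA (S := S₁ ∪ S₂ ∪ S₃) (by
    rintro X ((⟨η, D, hD, -, rfl⟩ | ⟨η, I, -, rfl⟩) | ⟨f, n, E, hE, -, rfl⟩)
    · exact hD.preimage_comp (fun j => (η, j))
    · exact (definable_consistent hΦ Set.definable_univ I _).compl
    · exact definable_consistent hΦ hE _ _) (by
    intro F hF hFfin
    have : ∃ N, ∀ t : List ℕ → μ → M, (∀ η, Conj L A c (t η)) →
        (∀ η : List ℕ, η.length < N → KInc k Φ fun i => t (η ++ [i])) →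
        (∀ f : ℕ → ℕ, ∃ e, Conj L A b e ∧ ∀ i ≤ N, Sum.elim e (t (branch f i)) ∈ Φ) →
        (fun p => t p.1 p.2) ∈ ⋂₀ F := by
      induction F, hFfin using Set.Finite.induction_on with
      | empty => exact ⟨0, fun _ _ _ _ => by simp⟩
      | @insert X F _ _ ih =>
        obtain ⟨N, hN⟩ := ih ((Set.subset_insert _ _).trans hF)
        rcases hF (Set.mem_insert X F) with (⟨η, D, hD, hc, rfl⟩ | ⟨η, I, hI, rfl⟩) |
          ⟨f, n, E, hE, hbE, rfl⟩
        · refine ⟨N, fun t h1 h2 h3 => ?_⟩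
          rw [Set.sInter_insert]
          exact ⟨((h1 η).mem_iff hD).1 hc, hN t h1 h2 h3⟩
        · refine ⟨max N (η.length + 1), fun t h1 h2 h3 => ?_⟩
          rw [Set.sInter_insert]
          refine ⟨?_, hN t h1 (fun η hη => h2 η (hη.trans_le (le_max_left _ _))) fun f => ?_⟩
          · rintro ⟨x, -, hx⟩
            exact h2 η (lt_of_lt_of_le (Nat.lt_succ_self _) (le_max_right _ _)) I hI ⟨x, hx⟩
          · obtain ⟨e, he, he'⟩ := h3 f
            exact ⟨e, he, fun i hi => he' i (hi.trans (le_max_left _ _))⟩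
        · refine ⟨max N n, fun t h1 h2 h3 => ?_⟩
          rw [Set.sInter_insert]
          refine ⟨?_, hN t h1 (fun η hη => h2 η (hη.trans_le (le_max_left _ _))) fun f => ?_⟩
          · obtain ⟨e, he, he'⟩ := h3 f
            exact ⟨e, (he.mem_iff hE).1 hbE, fun i hi =>
              he' i ((Finset.mem_range.1 hi).le.trans (le_max_right _ _))⟩
          · obtain ⟨e, he, he'⟩ := h3 f
            exact ⟨e, he, fun i hi => he' i (hi.trans (le_max_left _ _))⟩
    obtain ⟨N, hN⟩ := this
    obtain ⟨t, h1, h2, h3⟩ := hfin N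
    exact ⟨_, hN t h1 h2 h3⟩)
  refine ⟨fun η j => v (η, j), fun η => ?_, fun η => ?_, fun f n E hE hb => ?_⟩
  · exact hM.conj_of_forall hA (hM.range_lt c) fun D hD hc =>
      hv _ (Or.inl (Or.inl ⟨η, D, hD, hc, rfl⟩))
  · rintro I hI ⟨x, hx⟩
    exact hv _ (Or.inl (Or.inr ⟨η, I, hI, rfl⟩)) ⟨x, Set.mem_univ _, hx⟩
  · obtain ⟨x, hx, hx'⟩ := hv _ (Or.inr ⟨f, n, E, hE, hb, rfl⟩)
    exact ⟨x, hx, fun i hi => hx' i (Finset.mem_range.2 hi)⟩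

theorem consistent_of_branch {ξ μ : Type*} {A : Set M} {Φ : Set (ξ ⊕ μ → M)}
    {t : List ℕ → μ → M} {b : ξ → M} {f : ℕ → ℕ}
    (h : ∀ (n : ℕ) (E : Set (ξ → M)), A.Definable L E → b ∈ E →
        ∃ e ∈ E, ∀ i < n, Sum.elim e (t (branch f i)) ∈ Φ)
    {S : Set (Set (ξ → M))} (hS : ∀ E ∈ S, A.Definable L E ∧ b ∈ E) :
    Consistent ((Set.range fun n => {x | Sum.elim x (t (branch f n)) ∈ Φ}) ∪ S) := by
  intro F hF hFfin
  have : ∃ (n : ℕ) (E : Set (ξ → M)), A.Definable L E ∧ b ∈ E ∧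
      ∀ e ∈ E, (∀ i < n, Sum.elim e (t (branch f i)) ∈ Φ) → e ∈ ⋂₀ F := by
    induction F, hFfin using Set.Finite.induction_on with
    | empty => exact ⟨0, Set.univ, Set.definable_univ, Set.mem_univ _, fun _ _ _ => by simp⟩
    | @insert X F _ _ ih =>
      obtain ⟨n, E, hE, hb, hn⟩ := ih ((Set.subset_insert _ _).trans hF)
      rw [Set.sInter_insert]
      rcases hF (Set.mem_insert X F) with ⟨m, rfl⟩ | hX
      · refine ⟨max n (m + 1), E, hE, hb, fun e he h => ⟨?_, ?_⟩⟩
        · exact h m (lt_of_lt_of_le (Nat.lt_succ_self m) (le_max_right _ _))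
        · exact hn e he fun i hi => h i (hi.trans_le (le_max_left _ _))
      · refine ⟨n, E ∩ X, hE.inter (hS X hX).1, ⟨hb, (hS X hX).2⟩, fun e he h => ⟨he.2, ?_⟩⟩
        exact hn e he.1 h
  obtain ⟨n, E, hE, hb, hn⟩ := this
  obtain ⟨e, he, he'⟩ := h n E hE hb
  exact ⟨e, hn e he he'⟩

/-- Right-to-left symmetry: if `b` realizes a simple type and `tp(c / Ab)` does not fork over `A`,
then `tp(b / Ac)` does not divide over `A`. -/
theorem IsMonster.ndset_of_simple (hM : IsMonster T M κ) {α μ : Type} [Finite α] [Finite μ]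
    {A : Set M} (hA : #A < κ) {p : Set (PFormula L M α)} (hpA : IsOver p A) (hp : IsSimpleType p)
    {b : α → M} (hb : Realizes b p) {c : μ → M} (h : NF L A c (Set.range b)) :
    NDset L A (Set.range b) c := by
  intro γ _ b' hb' ρ k hρ hdiv hmem
  choose g hg using hb'
  obtain rfl : b ∘ g = b' := funext hg
  have hel : ∀ (x : α → M) (d : μ → M), Sum.elim x d ∘ Sum.map g id = Sum.elim (x ∘ g) d := by
    intro x d
    funext i
    rcases i with i | i <;> rfl
  -- Branches of this tree are consistent with tp(b/A), which contains `p`; so the tree property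
  -- holds inside `p`.
  obtain ⟨t, ht, htk, htf⟩ := hM.exists_tree hA h (hρ.preimage_comp (Sum.map g id))
    (hdiv.map id rfl (fun _ _ => rfl) (fun x => x ∘ g) fun x d _ hx => by
      rw [← hel]
      exact hx) (by
      change _ ∘ _ ∈ ρ
      rw [hel]
      exact hmem)
  obtain ⟨r, e, φ, he, hφ⟩ := definable_iff_formula_params.1 hρ
  -- Simplicity concerns `L`-formulas without parameters, so the constants of `ρ` are stored in
  -- every node.
  let q := Finite.equivFin (μ ⊕ Fin r)
  let f : (γ ⊕ μ) ⊕ Fin r → α ⊕ Fin (Nat.card (μ ⊕ Fin r)) :=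
    Sum.elim (Sum.map g fun i => q (Sum.inl i)) fun i => Sum.inr (q (Sum.inr i))
  have key : ∀ (x : α → M) (d : μ → M),
      (φ.relabel f).Realize (Sum.elim x (Sum.elim d e ∘ q.symm)) ↔
        Sum.elim x d ∘ Sum.map g id ∈ ρ := by
    intro x c
    rw [Language.Formula.realize_relabel, hφ, hel]
    have : Sum.elim x (Sum.elim c e ∘ q.symm) ∘ f = Sum.elim (Sum.elim (x ∘ g) c) e := by
      funext i
      rcases i with (i | i) | i <;> simp [f]
    rw [this]
  refine hp ⟨_, φ.relabel f, fun η => Sum.elim (t η) e ∘ q.symm, k, ?_, ?_⟩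
  · rintro η I hI ⟨x, hx⟩
    exact htk η I hI ⟨x, fun i hi => (key x _).1 (hx i hi)⟩
  · intro f'
    have := consistent_of_branch (htf f') (S := PFormula.solutions '' p) (by
      rintro _ ⟨θ, hθ, rfl⟩
      exact ⟨PFormula.Over.definable (hpA θ hθ), hb θ hθ⟩)
    convert! this using 3
    funext n
    ext x
    exact key x _

/-- Left-to-right symmetry: if `a` realizes a co-simple type and `tp(a / Ab)` does not fork over
`A`, then `tp(b / Aa)` does not divide over `A`. -/
theorem IsMonster.ndset_of_coSimple (hM : IsMonster T M κ) {α ξ : Type} [Finite α] [Finite ξ]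
    {A : Set M} (hA : #A < κ) {p : Set (PFormula L M α)} (hpA : IsOver p A)
    (hp : IsCoSimpleType p A)
    {a : α → M} (ha : Realizes a p) {b : ξ → M} (h : NF L A a (Set.range b)) :
    NDset L A (Set.range b) a := by
  intro γ _ b' hb' ρ k hρ hdiv hmem
  choose g hg using hb'
  obtain rfl : b ∘ g = b' := funext hg
  obtain ⟨t, ht, htk, htf⟩ := hM.exists_tree hA (h.mono (B := Set.range (b ∘ g))
    (Set.union_subset_union_right _ (Set.range_comp_subset_range _ _))) hρ hdiv hmem
  let q := Finite.equivFin γ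
  let s : γ ⊕ α → Fin (Nat.card γ) ⊕ (Fin 1 × α) := Sum.map q fun i => (0, i)
  obtain ⟨θ, hθ, hsol⟩ := exists_pformula (hρ.preimage_comp s)
  have hel : ∀ (x : Fin (Nat.card γ) → M) (c : α → M),
      θ.Realize (Sum.elim x fun j : Fin 1 × α => c j.2) ↔ Sum.elim (x ∘ q) c ∈ ρ := by
    intro x c
    have h1 : θ.Realize (Sum.elim x fun j : Fin 1 × α => c j.2) ↔
        (Sum.elim x fun j : Fin 1 × α => c j.2) ∈ θ.solutions := Iff.rfl
    rw [h1, hsol]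
    have h2 : (Sum.elim x fun j : Fin 1 × α => c j.2) ∘ s = Sum.elim (x ∘ q) c := by
      funext i
      rcases i with i | i <;> rfl
    rw [Set.mem_preimage, h2]
  -- A node is conjugate to `a` over `A`, hence is a single realization of `p`, which gives r = 1.
  refine hp ⟨_, 1, θ, fun η j => t η j.2, hθ, fun η j θ' hθ' => ?_, k, ?_, ?_⟩
  · exact ((ht η).mem_iff (PFormula.Over.definable (hpA θ' hθ'))).1 (ha θ' hθ')
  · rintro η I hI ⟨x, hx⟩
    exact htk η I hI ⟨x ∘ q, fun i hi => (hel x _).1 (hx i hi)⟩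
  · intro f
    have h1 := consistent_of_branch (htf f) (S := ∅) (by simp)
    rw [Set.union_empty] at h1
    rw [Set.image_empty, Set.union_empty]
    intro F hF hFfin
    obtain ⟨x, hx⟩ := h1 ((fun X => {y : γ → M | y ∘ q.symm ∈ X}) '' F) (by
      rintro _ ⟨X, hX, rfl⟩
      obtain ⟨n, rfl⟩ := hF hX
      refine ⟨n, ?_⟩
      ext y
      refine Iff.trans ?_ (hel _ _).symm
      rw [Function.comp_assoc, Equiv.symm_comp_self, Function.comp_id]
      rfl) (hFfin.image _)
    exact ⟨x ∘ q.symm, fun X hX => hx _ ⟨X, hX, rfl⟩⟩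

end Trees

/-! ### Turning k-inconsistent rows into 2-inconsistent rows. -/

section ArrayCombinatorics

open Filter

variable {X Y : Type*} (R : X → Y → Prop) (a : ℕ → ℕ → Y)

/-- The relations `R x (a s i)`, for `(s, i)` in the list, have a common solution. -/
def CommonSol (l : List (ℕ × ℕ)) : Prop := ∃ x, ∀ p ∈ l, R x (a p.1 p.2)

/-- The existence of a common solution for a generic choice of entries of the array in the rows
given by a word. -/
noncomputable def GenericSol : List ℕ → List (ℕ × ℕ) → Prop
  | [], acc => CommonSol R a acc
  | s :: w, acc => ∀ᶠ i in (hyperfilter ℕ : Filter ℕ), GenericSol w ((s, i) :: acc)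

/-- An ultrafilter decides every statement, so almost every `i` has the truth value of the
quantified statement. -/
theorem eventually_genericSol_iff (s : ℕ) (w : List ℕ) (acc : List (ℕ × ℕ)) :
    ∀ᶠ i in (hyperfilter ℕ : Filter ℕ),
      (GenericSol R a w ((s, i) :: acc) ↔ GenericSol R a (s :: w) acc) := by
  by_cases h : GenericSol R a (s :: w) acc
  · filter_upwards [show ∀ᶠ i in (hyperfilter ℕ : Filter ℕ), GenericSol R a w ((s, i) :: acc) from h]
      with i hi
    exact iff_of_true hi h
  · have h' : ¬ ∀ᶠ i in (hyperfilter ℕ : Filter ℕ), GenericSol R a w ((s, i) :: acc) := h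
    rw [← Ultrafilter.eventually_not] at h'
    filter_upwards [h'] with i hi
    exact iff_of_false hi h

theorem commonSol_congr {l l' : List (ℕ × ℕ)} (h : ∀ p, p ∈ l ↔ p ∈ l') :
    CommonSol R a l ↔ CommonSol R a l' := by
  simp only [CommonSol, h]

/-- Entries of the array can be chosen to be generic for all subwords of a given word. -/
theorem exists_generic_choice (w : List (ℕ × ℕ)) (hw : w.Nodup) (Z : Finset ℕ)
    (𝒜 : Set (List (ℕ × ℕ))) (h𝒜 : 𝒜.Finite) :
    ∃ i : ℕ × ℕ → ℕ, Set.InjOn i {l | l ∈ w} ∧ (∀ l ∈ w, i l ∉ Z) ∧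
      ∀ acc ∈ 𝒜, ∀ w' : List (ℕ × ℕ), w'.Sublist w →
        (GenericSol R a (w'.map Prod.fst) acc ↔
          CommonSol R a (w'.map (fun l => (l.1, i l)) ++ acc)) := by
  classical
  induction w generalizing Z 𝒜 with
  | nil =>
    refine ⟨fun _ => 0, by simp, by simp, fun acc _ w' hw' => ?_⟩
    rw [List.sublist_nil.1 hw']
    rfl
  | cons l w ih =>
    obtain ⟨hl, hw⟩ := List.nodup_cons.1 hw
    have h1 : ∀ᶠ i in (hyperfilter ℕ : Filter ℕ), i ∉ Z :=
      Filter.hyperfilter_le_cofinite Z.finite_toSet.compl_mem_cofinite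
    have h2 : ∀ᶠ i in (hyperfilter ℕ : Filter ℕ), ∀ acc ∈ 𝒜,
        ∀ w' ∈ {w' : List (ℕ × ℕ) | w' ∈ w.sublists},
        (GenericSol R a (w'.map Prod.fst) ((l.1, i) :: acc) ↔
          GenericSol R a (l.1 :: w'.map Prod.fst) acc) := by
      rw [Filter.eventually_all_finite h𝒜]
      intro acc _
      rw [Filter.eventually_all_finite (List.finite_toSet _)]
      intro w' _
      exact eventually_genericSol_iff R a _ _ _
    obtain ⟨i₀, hi₀, hi₀'⟩ := (h1.and h2).exists
    -- A subword may skip or use the head letter, so the tail must be generic both for the old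
    -- accumulators and for those extended by the chosen entry. Adding `i₀` to the forbidden set
    -- keeps the choice injective.
    obtain ⟨i, hinj, hiZ, hi⟩ := ih hw (insert i₀ Z) (𝒜 ∪ (fun acc => (l.1, i₀) :: acc) '' 𝒜)
      (h𝒜.union (h𝒜.image _))
    have hne : ∀ l' ∈ w, l' ≠ l := fun l' hl' h => hl (h ▸ hl')
    have hmap : ∀ w' : List (ℕ × ℕ), w'.Sublist w →
        w'.map (fun l' => (l'.1, Function.update i l i₀ l')) = w'.map (fun l' => (l'.1, i l')) := by
      intro w' hw'
      refine List.map_congr_left fun l' hl' => ?_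
      rw [Function.update_of_ne (hne l' (hw'.subset hl'))]
    refine ⟨Function.update i l i₀, ?_, ?_, ?_⟩
    · have hi0 : ∀ l' ∈ w, i l' ≠ i₀ := fun l' hl' h =>
        hiZ l' hl' (by rw [h]; exact Finset.mem_insert_self _ _)
      intro p hp q hq hpq
      rcases List.mem_cons.1 hp with rfl | hp' <;> rcases List.mem_cons.1 hq with rfl | hq'
      · rfl
      · rw [Function.update_self, Function.update_of_ne (hne q hq')] at hpq
        exact absurd hpq.symm (hi0 q hq')
      · rw [Function.update_self, Function.update_of_ne (hne p hp')] at hpq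
        exact absurd hpq (hi0 p hp')
      · rw [Function.update_of_ne (hne q hq'), Function.update_of_ne (hne p hp')] at hpq
        exact hinj hp' hq' hpq
    · intro p hp
      rcases List.mem_cons.1 hp with rfl | hp'
      · rwa [Function.update_self]
      · rw [Function.update_of_ne (hne p hp')]
        exact fun h => hiZ p hp' (Finset.mem_insert_of_mem h)
    · intro acc hacc w' hw'
      rcases List.sublist_cons_iff.1 hw' with hw₁ | ⟨w₁, rfl, hw₁⟩
      · rw [hmap w' hw₁]
        exact hi acc (Or.inl hacc) w' hw₁
      · rw [List.map_cons, List.map_cons, Function.update_self, hmap w₁ hw₁,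
          ← hi₀' acc hacc w₁ (List.mem_sublists.2 hw₁),
          hi ((l.1, i₀) :: acc) (Or.inr ⟨acc, hacc, rfl⟩) w₁ hw₁]
        refine commonSol_congr R a fun p => ?_
        simp only [List.mem_append, List.mem_cons]
        tauto

theorem sublist_flatMap {S S' : List ℕ} (h : S'.Sublist S) {β : Type*} {f g : ℕ → List β}
    (hfg : ∀ s ∈ S', (f s).Sublist (g s)) : (S'.flatMap f).Sublist (S.flatMap g) := by
  induction h with
  | slnil => simp
  | cons s _ ih =>
    rw [List.flatMap_cons]
    exact (ih hfg).trans (List.sublist_append_right _ _)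
  | cons_cons s _ ih =>
    rw [List.flatMap_cons, List.flatMap_cons]
    exact (hfg s (by simp)).append (ih fun s hs => hfg s (by simp [hs]))

theorem range'_sublist_range {b m Q : ℕ} (h : b + m ≤ Q) :
    (List.range' b m).Sublist (List.range Q) := by
  have : List.range Q = List.range' 0 b ++ (List.range' b m ++ List.range' (b + m) (Q - (b + m))) := by
    have h1 : List.range' 0 b ++ List.range' (0 + b) (m + (Q - (b + m))) =
        List.range' 0 (b + (m + (Q - (b + m)))) := List.range'_append_1
    rw [zero_add] at h1
    rw [List.range_eq_range', List.range'_append_1, h1]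
    congr 1
    omega
  rw [this]
  exact (List.sublist_append_left _ _).trans (List.sublist_append_right _ _)

/-- The word in which every row in `S` is repeated `m` times. -/
def repWord (m : ℕ) (S : List ℕ) : List ℕ := S.flatMap fun s => List.replicate m s

theorem map_fst_flatMap (S : List ℕ) (f : ℕ → List ℕ) {m : ℕ} (hf : ∀ s, (f s).length = m) :
    (S.flatMap fun s => (f s).map (Prod.mk s)).map Prod.fst = repWord m S := by
  rw [repWord, List.map_flatMap]
  congr 1
  funext s
  rw [List.map_map, List.eq_replicate_iff]
  simp [hf]

/-- Passing from arrays with `k`-inconsistent rows to arrays with `2`-inconsistent rows. -/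
theorem exists_two_inconsistent_array {k : ℕ}
    (hrow : ∀ (s : ℕ) (I : Finset ℕ), I.card = k → ¬ ∃ x, ∀ i ∈ I, R x (a s i))
    (hpath : ∀ (f : ℕ → ℕ) (n : ℕ), ∃ x, ∀ s < n, R x (a s (f s))) :
    ∃ (J : Type) (_ : Finite J), ∀ N : ℕ, ∃ b : ℕ → ℕ → J → Y,
      (∀ s < N, ∀ i < N, ∀ j < N, i ≠ j → ¬ ∃ x, ∀ t, R x (b s i t) ∧ R x (b s j t)) ∧
      ∀ f : ℕ → ℕ, (∀ s, f s < N) → ∃ x, ∀ s < N, ∀ t, R x (b s (f s) t) := by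
  classical
  -- `P m`: there are arbitrarily many rows from which m generic entries each have a common
  -- solution. It holds for 0 and 1 and fails for k, so some m ≥ 1 has `P m` without `P (m + 1)`;
  -- `n₀` is a number of rows at which m + 1 fails.
  let P : ℕ → Prop := fun m => ∀ n, ∃ S : List ℕ, S.Nodup ∧ S.length = n ∧
    GenericSol R a (repWord m S) []
  have hnodup : ∀ (S : List ℕ) (Q : ℕ), S.Nodup →
      (S.flatMap fun s => (List.range Q).map (Prod.mk s)).Nodup := by
    intro S Q hS
    exact List.Nodup.product hS List.nodup_range
  have hP0 : P 0 := by
    intro n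
    refine ⟨List.range n, List.nodup_range, List.length_range, ?_⟩
    have : repWord 0 (List.range n) = [] := by simp [repWord]
    rw [this]
    obtain ⟨x, -⟩ := hpath id 0
    exact ⟨x, by simp⟩
  have hP1 : P 1 := by
    intro n
    refine ⟨List.range n, List.nodup_range, List.length_range, ?_⟩
    obtain ⟨i, -, -, hi⟩ := exists_generic_choice R a
      ((List.range n).flatMap fun s => (List.range 1).map (Prod.mk s))
      (hnodup _ _ List.nodup_range) ∅ {[]} (Set.finite_singleton _)
    have := hi [] rfl _ (List.Sublist.refl _)
    rw [map_fst_flatMap (m := 1) (f := fun _ => List.range 1) (hf := by simp)] at this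
    rw [this]
    obtain ⟨x, hx⟩ := hpath (fun s => i (s, 0)) n
    refine ⟨x, fun p hp => ?_⟩
    simp only [List.append_nil, List.mem_map, List.mem_flatMap] at hp
    obtain ⟨_, ⟨s, hs, q, hq, rfl⟩, rfl⟩ := hp
    have : q = 0 := by simpa using hq
    subst this
    exact hx s (List.mem_range.1 hs)
  have hPk : ¬ P k := by
    intro h
    obtain ⟨S, hS, hlen, hgen⟩ := h 1
    obtain ⟨s, rfl⟩ := List.length_eq_one_iff.1 hlen
    obtain ⟨i, hinj, -, hi⟩ := exists_generic_choice R a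
      ([s].flatMap fun s => (List.range k).map (Prod.mk s))
      (hnodup _ _ hS) ∅ {[]} (Set.finite_singleton _)
    have := hi [] rfl _ (List.Sublist.refl _)
    rw [map_fst_flatMap (m := k) (f := fun _ => List.range k) (hf := by simp)] at this
    obtain ⟨x, hx⟩ := this.1 hgen
    refine hrow s ((Finset.range k).image fun q => i (s, q)) ?_ ⟨x, fun j hj => ?_⟩
    · rw [Finset.card_image_of_injOn, Finset.card_range]
      intro q hq q' hq' h
      have := @hinj (s, q) (by simpa using hq) (s, q') (by simpa using hq') h
      simpa using this
    · obtain ⟨q, hq, rfl⟩ := Finset.mem_image.1 hj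
      exact hx (s, i (s, q)) (by simpa using ⟨q, by simpa using hq, rfl⟩)
  obtain ⟨m, hm, hm'⟩ : ∃ m, P m ∧ ¬ P (m + 1) := by
    by_contra! h
    have : ∀ m, P m := fun m => Nat.rec hP0 (fun m ih => h m ih) m
    exact hPk (this k)
  have hm1 : 1 ≤ m := by
    rcases Nat.eq_zero_or_pos m with rfl | h
    · exact absurd hP1 hm'
    · exact h
  obtain ⟨n₀, hn₀⟩ := not_forall.1 hm'
  push Not at hn₀
  refine ⟨Fin n₀ × Fin m, inferInstance, fun N => ?_⟩
  obtain ⟨S, hS, hlen, hgen⟩ := hm (N * n₀)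
  obtain ⟨i, -, -, hi⟩ := exists_generic_choice R a
      (S.flatMap fun s => (List.range (N * m)).map (Prod.mk s))
      (hnodup _ _ hS) ∅ {[]} (Set.finite_singleton _)
  have hi := hi [] rfl
  have hidx : ∀ s < N, ∀ r < n₀, s * n₀ + r < S.length := by
    intro s hs r hr
    rw [hlen]
    calc s * n₀ + r < s * n₀ + n₀ := by omega
      _ = (s + 1) * n₀ := by ring
      _ ≤ N * n₀ := Nat.mul_le_mul_right _ hs
  have hjm : ∀ j < N, j * m + m ≤ N * m := by
    intro j hj
    calc j * m + m = (j + 1) * m := by ring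
      _ ≤ N * m := Nat.mul_le_mul_right _ hj
  -- Row s of the new array is a block of `n₀` consecutive members of `S`; its entry j collects the
  -- j-th batch of m chosen columns in each of them.
  refine ⟨fun s j t => a (S.getD (s * n₀ + t.1) 0) (i (S.getD (s * n₀ + t.1) 0, j * m + t.2)),
    ?_, ?_⟩
  · have main : ∀ s < N, ∀ j j', j < j' → j' < N → ¬ ∃ x, ∀ t : Fin n₀ × Fin m,
        R x (a (S.getD (s * n₀ + t.1) 0) (i (S.getD (s * n₀ + t.1) 0, j * m + t.2))) ∧
        R x (a (S.getD (s * n₀ + t.1) 0) (i (S.getD (s * n₀ + t.1) 0, j' * m + t.2))) := by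
      rintro s hs j j' hjj' hj' ⟨x, hx⟩
      let S' := (S.drop (s * n₀)).take n₀
      have hS' : S'.Sublist S := (List.take_sublist _ _).trans (List.drop_sublist _ _)
      have hlen' : S'.length = n₀ := by
        have : (s + 1) * n₀ ≤ N * n₀ := Nat.mul_le_mul_right _ hs
        have h2 : (s + 1) * n₀ = s * n₀ + n₀ := by ring
        simp only [S', List.length_take, List.length_drop, hlen]
        omega
      -- Batch j together with the first column of batch j' gives m + 1 generic entries in each of
      -- `n₀` rows, which have no common solution. This uses m ≥ 1.
      have hpos : (List.range' (j * m) m ++ [j' * m]).Sublist (List.range (N * m)) := by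
        have h1 : (j + 1) * m ≤ j' * m := Nat.mul_le_mul_right _ hjj'
        have h2 : (j + 1) * m = j * m + m := by ring
        have h3 := hjm j' hj'
        have h4 : List.range (N * m) = List.range (j' * m) ++ List.range' (j' * m) (N * m - j' * m) := by
          have h5 : List.range' 0 (j' * m) ++ List.range' (0 + j' * m) (N * m - j' * m) =
            List.range' 0 (j' * m + (N * m - j' * m)) := List.range'_append_1
          rw [zero_add] at h5
          rw [List.range_eq_range', List.range_eq_range', h5]
          congr 1
          omega
        rw [h4]
        refine (range'_sublist_range (by omega)).append ?_
        rw [List.singleton_sublist, List.mem_range'_1]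
        omega
      have := hi (S'.flatMap fun s => (List.range' (j * m) m ++ [j' * m]).map (Prod.mk s))
        (sublist_flatMap hS' fun s _ => hpos.map _)
      rw [map_fst_flatMap (m := m + 1) (f := fun _ => List.range' (j * m) m ++ [j' * m])
        (hf := by simp)] at this
      refine hn₀ S' (hS.sublist hS') hlen' (this.2 ⟨x, fun p hp => ?_⟩)
      simp only [List.append_nil, List.mem_map, List.mem_flatMap] at hp
      obtain ⟨_, ⟨s', hs', q, hq, rfl⟩, rfl⟩ := hp
      obtain ⟨r, hr, hrs⟩ := List.mem_iff_getElem.1 hs'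
      have hr' : r < n₀ := hlen' ▸ hr
      have hget : S.getD (s * n₀ + r) 0 = s' := by
        rw [List.getD_eq_getElem _ _ (hidx s hs r hr'), ← hrs]
        simp [S']
      rw [List.mem_append, List.mem_range'_1, List.mem_singleton] at hq
      rcases hq with hq | rfl
      · have := (hx (⟨r, hr'⟩, ⟨q - j * m, by omega⟩)).1
        simp only [hget] at this
        rwa [Nat.add_sub_of_le hq.1] at this
      · have := (hx (⟨r, hr'⟩, ⟨0, hm1⟩)).2
        simpa only [hget, Nat.add_zero] using this
    intro s hs j hj j' hj' hne
    rcases lt_or_gt_of_ne hne with h | h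
    · exact main s hs j j' h hj'
    · rintro ⟨x, hx⟩
      exact main s hs j' j h hj ⟨x, fun t => ⟨(hx t).2, (hx t).1⟩⟩
  · intro f hf
    -- A path uses m columns in each row of `S`, and those have a common solution. The block of a
    -- row is recovered by dividing its position in `S` by `n₀`.
    have := hi (S.flatMap fun s => (List.range' (f (S.idxOf s / n₀) * m) m).map (Prod.mk s))
      (sublist_flatMap (List.Sublist.refl _) fun s _ =>
        (range'_sublist_range (hjm _ (hf _))).map _)
    rw [map_fst_flatMap (m := m) (f := fun s => List.range' (f (S.idxOf s / n₀) * m) m)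
        (hf := by simp)] at this
    obtain ⟨x, hx⟩ := this.1 hgen
    refine ⟨x, fun s hs t => ?_⟩
    have hlt := hidx s hs t.1 t.1.2
    refine hx (S.getD (s * n₀ + t.1) 0, i (S.getD (s * n₀ + t.1) 0, f s * m + t.2)) ?_
    simp only [List.append_nil, List.mem_map, List.mem_flatMap]
    refine ⟨_, ⟨S.getD (s * n₀ + t.1) 0, ?_, f s * m + t.2, ?_, rfl⟩, rfl⟩
    · rw [List.getD_eq_getElem _ _ hlt]
      exact List.getElem_mem _
    · rw [List.getD_eq_getElem _ _ hlt, List.Nodup.idxOf_getElem hS, List.mem_range'_1]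
      have : (s * n₀ + t.1) / n₀ = s := by
        rw [mul_comm, Nat.mul_add_div (by have := t.1.2; omega), Nat.div_eq_of_lt t.1.2, add_zero]
      rw [this]
      have := t.2.2
      omega

end ArrayCombinatorics

/-! ### NTP₂ for k-inconsistent arrays with parameters. -/

section NTP2

variable {L : FirstOrder.Language.{u, v}} {T : L.Theory} {M : Type w} [L.Structure M]
  {κ : Cardinal.{w}}

/-- In an `NTP₂` theory there is no array with `k`-inconsistent rows and consistent paths. -/
theorem IsMonster.not_kTP2 (hM : IsMonster T M κ) (hT : IsNTP2 L M) {ξ μ : Type} [Finite ξ]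
    [Finite μ] {A : Set M} (hA : #A < κ) {Φ : Set (ξ ⊕ μ → M)} (hΦ : A.Definable L Φ) {k : ℕ}
    {a : ℕ → ℕ → μ → M} (hrow : ∀ s, KInc k Φ (a s))
    (hpath : ∀ (f : ℕ → ℕ) (n : ℕ), ∃ x : ξ → M, ∀ s < n, Sum.elim x (a s (f s)) ∈ Φ) : False := by
  classical
  obtain ⟨J, _, hJ⟩ := exists_two_inconsistent_array (fun (x : ξ → M) c => Sum.elim x c ∈ Φ) a
    (fun s I hI => hrow s I hI) hpath
  cases nonempty_fintype J
  have hne : Nonempty M ∨ IsEmpty M := (isEmpty_or_nonempty M).symm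
  -- Entries of the new array are `J`-tuples of old entries, with `Φ` required at all of them.
  let Ψ : Set (ξ ⊕ (J × μ) → M) := {v | ∀ t : J, v ∘ Sum.map id (Prod.mk t) ∈ Φ}
  have hΨ : A.Definable L Ψ := definable_forall fun t => hΦ.preimage_comp _
  have hel : ∀ (x : ξ → M) (c : J × μ → M),
      Sum.elim x c ∈ Ψ ↔ ∀ t, Sum.elim x (fun j => c (t, j)) ∈ Φ := by
    intro x c
    refine forall_congr' fun t => ?_
    have : Sum.elim x c ∘ Sum.map id (Prod.mk t) = Sum.elim x (fun j => c (t, j)) := by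
      funext i
      rcases i with i | i <;> rfl
    rw [this]
  let S₁ : Set (Set ((ℕ × ℕ) × J × μ → M)) := {X | ∃ s i j : ℕ, i ≠ j ∧
    X = {v | ∃ x ∈ (Set.univ : Set (ξ → M)), ∀ q ∈ ({(s, i), (s, j)} : Finset (ℕ × ℕ)),
      Sum.elim x (fun p => v (q, p)) ∈ Ψ}ᶜ}
  let S₂ : Set (Set ((ℕ × ℕ) × J × μ → M)) := {X | ∃ (f : ℕ → ℕ) (n : ℕ),
    X = {v | ∃ x ∈ (Set.univ : Set (ξ → M)), ∀ s ∈ Finset.range n,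
      Sum.elim x (fun p => v ((s, f s), p)) ∈ Ψ}}
  obtain ⟨v, hv⟩ := hM.exists_realization_of_countable (ι := (ℕ × ℕ) × J × μ) hA (S := S₁ ∪ S₂) (by
    rintro X (⟨s, i, j, -, rfl⟩ | ⟨f, n, rfl⟩)
    · exact (definable_consistent hΨ Set.definable_univ _ fun q p => (q, p)).compl
    · exact definable_consistent hΨ Set.definable_univ _ fun s p => ((s, f s), p)) (by
    intro F hF hFfin
    have : ∃ N, ∀ b : ℕ → ℕ → J → μ → M,
      (∀ s < N, ∀ i < N, ∀ j < N, i ≠ j → ¬ ∃ x : ξ → M, ∀ t,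
        Sum.elim x (b s i t) ∈ Φ ∧ Sum.elim x (b s j t) ∈ Φ) →
      (∀ f : ℕ → ℕ, (∀ s, f s < N) → ∃ x : ξ → M, ∀ s < N, ∀ t, Sum.elim x (b s (f s) t) ∈ Φ) →
      (fun q => b q.1.1 q.1.2 q.2.1 q.2.2) ∈ ⋂₀ F := by
      induction F, hFfin using Set.Finite.induction_on with
      | empty => exact ⟨0, fun _ _ _ => by simp⟩
      | @insert X F _ _ ih =>
        obtain ⟨N, hN⟩ := ih ((Set.subset_insert _ _).trans hF)
        have mono : ∀ N', N ≤ N' → ∀ b : ℕ → ℕ → J → μ → M,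
            (∀ s < N', ∀ i < N', ∀ j < N', i ≠ j → ¬ ∃ x : ξ → M, ∀ t,
              Sum.elim x (b s i t) ∈ Φ ∧ Sum.elim x (b s j t) ∈ Φ) →
            (∀ f : ℕ → ℕ, (∀ s, f s < N') →
              ∃ x : ξ → M, ∀ s < N', ∀ t, Sum.elim x (b s (f s) t) ∈ Φ) →
            (fun q => b q.1.1 q.1.2 q.2.1 q.2.2) ∈ ⋂₀ F := by
          intro N' hN' b h1 h2
          refine hN b (fun s hs i hi j hj => h1 s (by omega) i (by omega) j (by omega)) ?_
          intro f hf
          obtain ⟨x, hx⟩ := h2 f fun s => (hf s).trans_le hN'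
          exact ⟨x, fun s hs => hx s (by omega)⟩
        rcases hF (Set.mem_insert X F) with ⟨s, i, j, hij, rfl⟩ | ⟨f, n, rfl⟩
        · refine ⟨max N (s + i + j + 1), fun b h1 h2 => ?_⟩
          rw [Set.sInter_insert]
          refine ⟨?_, mono _ (le_max_left _ _) b h1 h2⟩
          rintro ⟨x, -, hx⟩
          refine h1 s (by omega) i (by omega) j (by omega) hij ⟨x, fun t => ⟨?_, ?_⟩⟩
          · exact (hel _ _).1 (hx (s, i) (by simp)) t
          · exact (hel _ _).1 (hx (s, j) (by simp)) t
        · refine ⟨max N (n + (Finset.range n).sup f + 1), fun b h1 h2 => ?_⟩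
          rw [Set.sInter_insert]
          refine ⟨?_, mono _ (le_max_left _ _) b h1 h2⟩
          have hb : ∀ s < n, f s ≤ (Finset.range n).sup f := fun s hs =>
            Finset.le_sup (Finset.mem_range.2 hs)
          -- The finite arrays only control choice functions bounded everywhere, so the path is
          -- replaced by 0 from `n` on.
          obtain ⟨x, hx⟩ := h2 (fun s => if s < n then f s else 0) (by
            intro s
            split_ifs with h
            · have := hb s h
              omega
            · omega)
          refine ⟨x, Set.mem_univ _, fun s hs => (hel _ _).2 fun t => ?_⟩
          have hs' := Finset.mem_range.1 hs
          have := hx s (by omega) t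
          rwa [if_pos hs'] at this
    obtain ⟨N, hN⟩ := this
    obtain ⟨b, hb, hb'⟩ := hJ N
    exact ⟨_, hN b hb hb'⟩)
  obtain ⟨r, e, φ, he, hφ⟩ := definable_iff_formula_params.1 hΨ
  let g := Finite.equivFin ((J × μ) ⊕ Fin r)
  let h := Finite.equivFin ξ
  let f : (ξ ⊕ (J × μ)) ⊕ Fin r → Fin _ ⊕ Fin _ :=
    Sum.elim (Sum.map h fun i => g (Sum.inl i)) fun i => Sum.inr (g (Sum.inr i))
  have key : ∀ (x : Fin _ → M) (c : J × μ → M),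
      (φ.relabel f).Realize (Sum.elim x (Sum.elim c e ∘ g.symm)) ↔ Sum.elim (x ∘ h) c ∈ Ψ := by
    intro x c
    rw [Language.Formula.realize_relabel, hφ]
    have : Sum.elim x (Sum.elim c e ∘ g.symm) ∘ f = Sum.elim (Sum.elim (x ∘ h) c) e := by
      funext i
      rcases i with (i | i) | i <;> simp [f]
    rw [this]
  refine hT ⟨_, _, φ.relabel f, fun s i => Sum.elim (fun p => v ((s, i), p)) e ∘ g.symm, ?_, ?_⟩
  · rintro s I hI ⟨x, hx⟩
    obtain ⟨i, j, hij, rfl⟩ := Finset.card_eq_two.1 hI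
    refine hv _ (Or.inl ⟨s, i, j, hij, rfl⟩) ⟨x ∘ h, Set.mem_univ _, fun q hq => ?_⟩
    rw [Finset.mem_insert, Finset.mem_singleton] at hq
    rcases hq with rfl | rfl
    · exact (key _ _).1 (hx i (by simp))
    · exact (key _ _).1 (hx j (by simp))
  · intro f' F hF hFfin
    obtain ⟨n, hn⟩ : ∃ n : ℕ, F ⊆ (fun s => {b : Fin _ → M | (φ.relabel f).Realize
        (Sum.elim b (Sum.elim (fun p => v ((s, f' s), p)) e ∘ g.symm))}) '' {s | s < n} := by
      induction F, hFfin using Set.Finite.induction_on with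
      | empty => exact ⟨0, Set.empty_subset _⟩
      | @insert X F _ _ ih =>
        obtain ⟨n, hn⟩ := ih ((Set.subset_insert _ _).trans hF)
        obtain ⟨s, rfl⟩ := hF (Set.mem_insert X F)
        refine ⟨max n (s + 1), Set.insert_subset ?_ (hn.trans (Set.image_mono ?_))⟩
        · exact ⟨s, lt_of_lt_of_le (Nat.lt_succ_self s) (le_max_right _ _), rfl⟩
        · exact fun t (ht : t < n) => show t < max n (s + 1) from lt_of_lt_of_le ht (le_max_left _ _)
    obtain ⟨x, -, hx⟩ := hv _ (Or.inr ⟨f', n, rfl⟩)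
    refine ⟨x ∘ h.symm, fun X hX => ?_⟩
    obtain ⟨s, hs, rfl⟩ := hn hX
    refine (key _ _).2 ?_
    rw [Function.comp_assoc, Equiv.symm_comp_self, Function.comp_id]
    exact hx s (Finset.mem_range.2 hs)

end NTP2

/-! ### Average types of ultrafilters and their Morley sequences. -/

section Ultrafilters

variable {L : FirstOrder.Language.{u, v}} {T : L.Theory} {M : Type w} [L.Structure M]
  {κ : Cardinal.{w}} {μ : Type}

/-- The ultrafilter `𝒰` is concentrated on tuples from `A`. -/
def Supp (A : Set M) (𝒰 : Ultrafilter (μ → M)) : Prop := {x : μ → M | ∀ i, x i ∈ A} ∈ 𝒰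

variable (L) in
/-- The tuple `c` realizes the restriction to `B` of the average type of `𝒰`. -/
def Av (𝒰 : Ultrafilter (μ → M)) (B : Set M) (c : μ → M) : Prop :=
  ∀ D : Set (μ → M), B.Definable L D → D ∈ 𝒰 → c ∈ D

theorem Av.mem_iff {𝒰 : Ultrafilter (μ → M)} {B : Set M} {c : μ → M} (h : Av L 𝒰 B c)
    {D : Set (μ → M)} (hD : B.Definable L D) : c ∈ D ↔ D ∈ 𝒰 :=
  ⟨fun hc => by_contra fun hn => h Dᶜ hD.compl (Ultrafilter.compl_mem_iff_notMem.2 hn) hc, h D hD⟩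

theorem Av.mono {𝒰 : Ultrafilter (μ → M)} {B C : Set M} {c : μ → M} (h : Av L 𝒰 C c)
    (hBC : B ⊆ C) : Av L 𝒰 B c := fun D hD => h D (hD.mono hBC)

theorem Av.conj {𝒰 : Ultrafilter (μ → M)} {B : Set M} {c c' : μ → M} (h : Av L 𝒰 B c)
    (hc : Conj L B c c') : Av L 𝒰 B c' := fun D hD hU => (hc.mem_iff hD).1 (h D hD hU)

theorem IsMonster.conj_of_av [Countable μ] (hM : IsMonster T M κ) {𝒰 : Ultrafilter (μ → M)}
    {B : Set M} (hB : #B < κ) {c c' : μ → M} (h : Av L 𝒰 B c) (h' : Av L 𝒰 B c') :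
    Conj L B c c' :=
  hM.conj_of_forall hB (hM.range_lt c) fun D hD hc => h' D hD ((h.mem_iff hD).1 hc)

theorem IsMonster.exists_av [Countable μ] (hM : IsMonster T M κ) (𝒰 : Ultrafilter (μ → M))
    {B : Set M} (hB : #B < κ) : ∃ c, Av L 𝒰 B c := by
  obtain ⟨c, hc⟩ := hM.exists_realization_of_countable hB
    (S := {D : Set (μ → M) | B.Definable L D ∧ D ∈ 𝒰}) (fun D hD => hD.1)
    (fun F hF hFfin => 𝒰.nonempty_of_mem
      ((Filter.sInter_mem hFfin).2 fun D hD => (hF hD).2))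
  exact ⟨c, fun D hD hU => hc D ⟨hD, hU⟩⟩

/-- An automorphism fixing `A` fixes each tuple on which the ultrafilter is concentrated; average
types are therefore invariant over `A`. -/
theorem Av.image {𝒰 : Ultrafilter (μ → M)} {A B : Set M} {c : μ → M} {σ : M ≃[L] M}
    (hσ : Fixes A σ) (hs : Supp A 𝒰) (h : Av L 𝒰 B c) : Av L 𝒰 (σ '' B) (σ ∘ c) := by
  intro D hD hU
  have h1 := definable_image_equiv σ.symm hD
  have h2 : σ.symm '' (σ '' B) = B := by
    rw [Set.image_image]
    simp
  rw [h2] at h1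
  refine h _ h1 (Filter.mem_of_superset (Filter.inter_mem hs hU) ?_)
  rintro v ⟨hv, hvD⟩
  have : σ.symm.symm ∘ v = v := by
    funext i
    exact hσ _ (hv i)
  change σ.symm.symm ∘ v ∈ D
  rwa [this]

/-- A type that is finitely satisfiable in `A` does not fork over any set containing `A`. -/
theorem Av.nf {𝒰 : Ultrafilter (μ → M)} {A A' B C : Set M} {c : μ → M} (h : Av L 𝒰 C c)
    (hs : Supp A 𝒰) (hA : A ⊆ A') (hC : A' ∪ B ⊆ C) : NF L A' c B := by
  rintro X hX hc ⟨J, _, ψ, hψ, hcov⟩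
  obtain ⟨x, hxA, hxX⟩ := 𝒰.nonempty_of_mem
    (Filter.inter_mem hs ((h.mem_iff (hX.mono hC)).1 hc))
  obtain ⟨j, hj⟩ := hcov x hxX
  obtain ⟨k, s, hs, hk⟩ := hψ j
  -- The solution `x` lies in the base, so all conjugates of the dividing formula hold at `x`,
  -- against k-inconsistency.
  refine hk (Finset.range k) (Finset.card_range k) ⟨x, fun i _ => ?_⟩
  have h1 : A'.Definable L {v : Fin (ψ j).arity → M | Sum.elim x v ∈
      {z | (ψ j).formula.Realize z}} :=
    definable_section_left (definable_realize (ψ j).formula ∅) (Set.empty_subset _)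
      fun i => hA (hxA i)
  exact (sameType_iff.1 (hs i) _ h1).2 hj

variable (L) in
/-- Every tuple in the list realizes the average type of the corresponding ultrafilter over `B`
and the preceding tuples. -/
def Mor : Set M → List (Ultrafilter (μ → M) × (μ → M)) → Prop
  | _, [] => True
  | B, q :: l => Av L q.1 B q.2 ∧ Mor (B ∪ Set.range q.2) l

theorem Mor.mono {l : List (Ultrafilter (μ → M) × (μ → M))} {B C : Set M} (h : Mor L C l)
    (hBC : B ⊆ C) : Mor L B l := by
  induction l generalizing B C with
  | nil => trivial
  | cons q l ih => exact ⟨h.1.mono hBC, ih h.2 (Set.union_subset_union_left _ hBC)⟩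

theorem Mor.sublist {l l' : List (Ultrafilter (μ → M) × (μ → M))} {B : Set M} (h : Mor L B l)
    (hl : l'.Sublist l) : Mor L B l' := by
  induction hl generalizing B with
  | slnil => trivial
  | cons q _ ih => exact ih (h.2.mono Set.subset_union_left)
  | cons_cons q _ ih => exact ⟨h.1, ih h.2⟩

theorem IsMonster.exists_mor [Countable μ] (hM : IsMonster T M κ)
    (us : List (Ultrafilter (μ → M))) {B : Set M} (hB : #B < κ) :
    ∃ l, l.map Prod.fst = us ∧ Mor L B l := by
  induction us generalizing B with
  | nil => exact ⟨[], rfl, trivial⟩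
  | cons 𝒰 us ih =>
    obtain ⟨c, hc⟩ := hM.exists_av (L := L) 𝒰 hB
    obtain ⟨l, hl, hl'⟩ := ih (hM.union_lt hB (hM.range_lt c))
    exact ⟨(𝒰, c) :: l, by rw [List.map_cons, hl], hc, hl'⟩

theorem Mor.image {l : List (Ultrafilter (μ → M) × (μ → M))} {A B : Set M} {σ : M ≃[L] M}
    (hσ : Fixes A σ) (hs : ∀ q ∈ l, Supp A q.1) (h : Mor L B l) :
    Mor L (σ '' B) (l.map fun q => (q.1, σ ∘ q.2)) := by
  induction l generalizing B with
  | nil => trivial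
  | cons q l ih =>
    refine ⟨h.1.image hσ (hs q (by simp)), ?_⟩
    have := ih (fun q hq => hs q (by simp [hq])) h.2
    rwa [Set.image_union, ← Set.range_comp] at this

/-- Invariance makes sequences with the same ultrafilters conjugate. The tuples are matched one at a
time; `σ` is kept general because each correction moves the base over which the rest must be
matched. -/
theorem IsMonster.exists_fixes_of_mor [Countable μ] (hM : IsMonster T M κ) {A B : Set M}
    (hAB : A ⊆ B) (hB : #B < κ) {l l' : List (Ultrafilter (μ → M) × (μ → M))}
    (hs : ∀ q ∈ l, Supp A q.1) {σ : M ≃[L] M} (hσ : Fixes A σ) (h : Mor L B l)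
    (h' : Mor L (σ '' B) l') (hll : l.map Prod.fst = l'.map Prod.fst) :
    ∃ τ : M ≃[L] M, Fixes A τ ∧ (l.map fun q => (q.1, τ ∘ q.2)) = l' ∧ ∀ b ∈ B, τ b = σ b := by
  induction l generalizing B l' σ with
  | nil =>
    obtain rfl : l' = [] := by simpa using hll.symm
    exact ⟨σ, hσ, rfl, fun _ _ => rfl⟩
  | cons q l ih =>
    rcases l' with _ | ⟨q', l'⟩
    · simp at hll
    rw [List.map_cons, List.map_cons, List.cons.injEq] at hll
    obtain ⟨hq, hll⟩ := hll
    have hσB : #(σ '' B) < κ := Cardinal.mk_image_le.trans_lt hB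
    have h2 := h'.1
    rw [← hq] at h2
    obtain ⟨ρ, hρ, hρq⟩ := hM.conj_of_av hσB (h.1.image hσ (hs q (by simp))) h2
    have hA : Fixes A ρ := fun a ha => hρ a ⟨a, hAB ha, hσ a ha⟩
    have himg : (ρ.comp σ) '' (B ∪ Set.range q.2) = σ '' B ∪ Set.range q'.2 := by
      rw [Set.image_union, ← Set.range_comp]
      congr 1
      · ext m
        constructor
        · rintro ⟨b, hb, rfl⟩
          exact ⟨b, hb, (hρ _ ⟨b, hb, rfl⟩).symm⟩
        · rintro ⟨b, hb, rfl⟩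
          exact ⟨b, hb, hρ _ ⟨b, hb, rfl⟩⟩
      · rw [← hρq]
        rfl
    obtain ⟨τ, hτ, hτl, hτB⟩ := ih (l' := l') (hAB.trans Set.subset_union_left)
      (hM.union_lt hB (hM.range_lt _)) (fun q hq => hs q (by simp [hq])) (hA.comp hσ) h.2
      (by rw [himg]; exact h'.2) hll
    refine ⟨τ, hτ, ?_, fun b hb => ?_⟩
    · rw [List.map_cons, hτl]
      congr 1
      refine Prod.ext hq ?_
      rw [← hρq]
      funext i
      exact hτB _ (Or.inr ⟨i, rfl⟩)
    · rw [hτB b (Or.inl hb)]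
      exact hρ _ ⟨b, hb, rfl⟩

theorem mor_append_singleton {l : List (Ultrafilter (μ → M) × (μ → M))} {B : Set M}
    {q : Ultrafilter (μ → M) × (μ → M)} (h : Mor L B l)
    (hq : Av L q.1 (B ∪ ⋃ r ∈ {r | r ∈ l}, Set.range r.2) q.2) : Mor L B (l ++ [q]) := by
  induction l generalizing B with
  | nil => exact ⟨hq.mono Set.subset_union_left, trivial⟩
  | cons r l ih =>
    refine ⟨h.1, ih h.2 (hq.mono ?_)⟩
    rw [Set.union_assoc]
    refine Set.union_subset_union_right _ (Set.union_subset ?_ ?_)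
    · exact Set.subset_biUnion_of_mem (u := fun r : Ultrafilter (μ → M) × (μ → M) =>
        Set.range r.2) (by simp)
    · exact Set.biUnion_subset_biUnion_left fun s hs => List.mem_cons_of_mem _ hs

theorem mor_of_seq {𝒰 : Ultrafilter (μ → M)} {A : Set M} {u : ℕ → μ → M} (n : ℕ)
    (h : ∀ i < n, Av L 𝒰 (A ∪ ⋃ l ∈ Set.Iio i, Set.range (u l)) (u i)) :
    Mor L A ((List.range n).map fun i => (𝒰, u i)) := by
  induction n with
  | zero => trivial
  | succ n ih =>
    rw [List.range_succ, List.map_append]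
    refine mor_append_singleton (ih fun i hi => h i (by omega)) ((h n (by omega)).mono ?_)
    refine Set.union_subset_union_right _ (Set.iUnion₂_subset fun r hr => ?_)
    obtain ⟨i, hi, rfl⟩ := List.mem_map.1 hr
    exact Set.subset_biUnion_of_mem (u := fun l => Set.range (u l)) (List.mem_range.1 hi)

theorem IsMonster.exists_morley_seq [Countable μ] (hM : IsMonster T M κ)
    (𝒰 : Ultrafilter (μ → M)) {A : Set M} (hA : #A < κ) :
    ∃ u : ℕ → μ → M, ∀ i, Av L 𝒰 (A ∪ ⋃ l ∈ Set.Iio i, Set.range (u l)) (u i) := by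
  obtain ⟨u, hu⟩ := exists_seq_of_forall_list (Q := fun _ : μ → M => True)
    (P := fun l x => Av L 𝒰 (A ∪ ⋃ y ∈ {y | y ∈ l}, Set.range y) x)
    (fun l _ => by
      obtain ⟨c, hc⟩ := hM.exists_av (L := L) 𝒰 (hM.union_lt hA (hM.countable_lt
        ((List.finite_toSet l).countable.biUnion fun y _ => Set.countable_range y)))
      exact ⟨c, trivial, hc⟩)
  refine ⟨u, fun i => (hu i).2.mono (Set.union_subset_union_right _ ?_)⟩
  refine Set.iUnion₂_subset fun l hl => ?_
  refine Set.subset_biUnion_of_mem (u := fun y : μ → M => Set.range y) ?_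
  exact List.mem_map.2 ⟨l, List.mem_range.2 hl, rfl⟩

variable (L) in
/-- For some `n`, the fibres of `Φ` over Morley sequences of `𝒰` of length `n` over `A` are
inconsistent. -/
def CD {ξ : Type*} (Φ : Set (ξ ⊕ μ → M)) (𝒰 : Ultrafilter (μ → M)) (A : Set M) : Prop :=
  ∃ n, ∀ xs : List (μ → M), xs.length = n → Mor L A (xs.map (Prod.mk 𝒰)) →
    ¬ ∃ x : ξ → M, ∀ c ∈ xs, Sum.elim x c ∈ Φ

/-- Morley sequences of equal length are conjugate over `A`, so one consistent instance makes all of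
them consistent. -/
theorem IsMonster.consistent_of_not_cd [Countable μ] (hM : IsMonster T M κ) {ξ : Type}
    {Φ : Set (ξ ⊕ μ → M)} {𝒰 : Ultrafilter (μ → M)} {A : Set M} (hA : #A < κ)
    (hs : Supp A 𝒰) (hΦ : A.Definable L Φ) (h : ¬ CD L Φ 𝒰 A) {xs : List (μ → M)}
    (hxs : Mor L A (xs.map (Prod.mk 𝒰))) : ∃ x : ξ → M, ∀ c ∈ xs, Sum.elim x c ∈ Φ := by
  unfold CD at h
  push Not at h
  obtain ⟨ys, hlen, hys, y, hy⟩ := h xs.length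
  have himg : (Language.Equiv.refl L M) '' A = A := by
    ext
    simp
  obtain ⟨τ, hτ, hτl, -⟩ := hM.exists_fixes_of_mor subset_rfl hA
    (l := ys.map (Prod.mk 𝒰)) (l' := xs.map (Prod.mk 𝒰)) (by
      intro q hq
      obtain ⟨c, -, rfl⟩ := List.mem_map.1 hq
      exact hs) (Fixes.refl A) hys (by rwa [himg]) (by
      rw [List.map_map, List.map_map]
      change ys.map (fun _ => 𝒰) = xs.map (fun _ => 𝒰)
      rw [List.map_const', List.map_const', hlen])
  refine ⟨τ ∘ y, fun c hc => ?_⟩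
  have h1 : (𝒰, c) ∈ xs.map (Prod.mk 𝒰) := List.mem_map.2 ⟨c, hc, rfl⟩
  rw [← hτl, List.map_map] at h1
  obtain ⟨d, hd, hdc⟩ := List.mem_map.1 h1
  have h2 : τ ∘ d = c := congrArg Prod.snd hdc
  rw [← h2, ← sum_elim_comp_equiv, hτ.mem_iff hΦ]
  exact hy d hd

/-- In an `NTP₂` theory, if there are sufficiently many inconsistent rows of realizations of the
average type of `𝒰`, then Morley sequences of `𝒰` are inconsistent. -/
theorem IsMonster.cd_of_rows (hM : IsMonster T M κ) (hT : IsNTP2 L M) {ξ : Type} [Finite ξ]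
    [Finite μ] {Φ : Set (ξ ⊕ μ → M)} {𝒰 : Ultrafilter (μ → M)} {A : Set M} (hA : #A < κ)
    (hs : Supp A 𝒰) (hΦ : A.Definable L Φ) {k : ℕ}
    (h : ∀ t : Set (μ → M), t.Countable → (∀ c ∈ t, Av L 𝒰 A c) →
      ∃ s : ℕ → μ → M, KInc k Φ s ∧ ∀ j, Av L 𝒰 (A ∪ ⋃ c ∈ t, Set.range c) (s j)) :
    CD L Φ 𝒰 A := by
  by_contra hcd
  -- Each row is chosen over all entries of the preceding rows. Every path is then a Morley
  -- sequence, whichever entries it picks; were Morley sequences consistent, the array would violate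
  -- NTP₂.
  obtain ⟨u, hu⟩ := exists_seq_of_forall_list
    (Q := fun s : ℕ → μ → M => KInc k Φ s ∧ ∀ j, Av L 𝒰 A (s j))
    (P := fun l s => ∀ j, Av L 𝒰 (A ∪ ⋃ c ∈ {c | ∃ r ∈ l, ∃ j, r j = c}, Set.range c) (s j))
    (fun l hl => by
      obtain ⟨s, hs, hs'⟩ := h {c | ∃ r ∈ l, ∃ j, r j = c} (by
        have : {c : μ → M | ∃ r ∈ l, ∃ j, r j = c} = ⋃ r ∈ {r | r ∈ l}, Set.range r := by
          ext
          simp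
        rw [this]
        exact (List.finite_toSet l).countable.biUnion fun r _ => Set.countable_range r) (by
        rintro c ⟨r, hr, j, rfl⟩
        exact (hl r hr).2 j)
      exact ⟨s, ⟨hs, fun j => (hs' j).mono Set.subset_union_left⟩, hs'⟩)
  refine hM.not_kTP2 hT hA hΦ (fun s => (hu s).1.1) fun f n => ?_
  have h1 : Mor L A ((List.range n).map fun i => (𝒰, u i (f i))) := by
    refine mor_of_seq (u := fun i => u i (f i)) n fun i _ => ((hu i).2 (f i)).mono ?_
    refine Set.union_subset_union_right _ (Set.iUnion₂_subset fun l hl => ?_)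
    refine Set.subset_biUnion_of_mem (u := fun y : μ → M => Set.range y) ?_
    exact ⟨u l, List.mem_map.2 ⟨l, List.mem_range.2 hl, rfl⟩, f l, rfl⟩
  obtain ⟨x, hx⟩ := hM.consistent_of_not_cd hA hs hΦ hcd
    (xs := (List.range n).map fun i => u i (f i)) (by rw [List.map_map]; exact h1)
  exact ⟨x, fun s hs => hx _ (List.mem_map.2 ⟨s, List.mem_range.2 hs, rfl⟩)⟩

/-- Finite tuples from a Morley sequence of `𝒰` are approximated by tuples of members of any set
in `𝒰`. -/
theorem exists_mem_of_morley {𝒰 : Ultrafilter (μ → M)} {A : Set M} {S : Set (μ → M)}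
    (hS : S ∈ 𝒰) (hSA : ∀ x ∈ S, ∀ i, x i ∈ A) {u : ℕ → μ → M} {n : ℕ}
    (hu : ∀ i < n, Av L 𝒰 (A ∪ ⋃ l ∈ Set.Iio i, Set.range (u l)) (u i))
    {D : Set (ℕ × μ → M)} (hD : A.Definable L D) {v : ℕ → μ → M} (hv : ∀ i < n, v i = u i)
    (hv' : ∀ i, n ≤ i → v i ∈ S) (hvD : (fun p => v p.1 p.2) ∈ D) :
    ∃ z : ℕ → μ → M, (∀ i, z i ∈ S) ∧ (fun p => z p.1 p.2) ∈ D := by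
  classical
  induction n generalizing v with
  | zero => exact ⟨v, fun i => hv' i (Nat.zero_le i), hvD⟩
  | succ n ih =>
    obtain ⟨x₀, hx₀⟩ := 𝒰.nonempty_of_mem hS
    -- The last Morley term realizes the average type over all the other entries, so a member of `S`
    -- can replace it. Since `f` reads row `n` from the new tuple, the value `x₀` placed there is
    -- never seen; it only keeps the parameters in the required set.
    let f : ℕ × μ → μ ⊕ (ℕ × μ) := fun p => if p.1 = n then Sum.inl p.2 else Sum.inr p
    have hf : ∀ x y : μ → M, Sum.elim x (fun p => Function.update v n y p.1 p.2) ∘ f =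
        fun p => Function.update v n x p.1 p.2 := by
      intro x y
      funext ⟨i, j⟩
      by_cases hi : i = n
      · subst hi
        simp [f]
      · simp [f, hi]
    have h1 : (A ∪ ⋃ l ∈ Set.Iio n, Set.range (u l)).Definable L
        {x : μ → M | Sum.elim x (fun p => Function.update v n x₀ p.1 p.2) ∈
          (fun w : μ ⊕ (ℕ × μ) → M => w ∘ f) ⁻¹' D} := by
      refine definable_section (hD.preimage_comp f) Set.subset_union_left ?_
      rintro ⟨i, j⟩
      rcases lt_trichotomy i n with hi | rfl | hi
      · rw [Function.update_of_ne hi.ne, hv i (by omega)]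
        exact Set.mem_union_right _ (Set.mem_biUnion (x := i) hi ⟨j, rfl⟩)
      · rw [Function.update_self]
        exact Or.inl (hSA _ hx₀ j)
      · rw [Function.update_of_ne hi.ne']
        exact Or.inl (hSA _ (hv' i hi) j)
    have h2 := ((hu n (by omega)).mem_iff h1).1 (by
      change _ ∘ f ∈ D
      rw [hf, ← hv n (by omega), Function.update_eq_self]
      exact hvD)
    obtain ⟨x, hx, hxS⟩ := 𝒰.nonempty_of_mem (Filter.inter_mem h2 hS)
    refine ih (v := Function.update v n x) (fun i hi => hu i (by omega)) ?_ ?_ ?_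
    · intro i hi
      rw [Function.update_of_ne hi.ne]
      exact hv i (by omega)
    · intro i hi
      rcases eq_or_lt_of_le hi with rfl | hi
      · rwa [Function.update_self]
      · rw [Function.update_of_ne hi.ne']
        exact hv' i hi
    · change _ ∘ f ∈ D at hx
      rwa [hf] at hx

end Ultrafilters

/-! ### Simple types are co-simple in NTP₂ theories. -/

section CoSimple

variable {L : FirstOrder.Language.{u, v}} {T : L.Theory} {M : Type w} [L.Structure M]
  {κ : Cardinal.{w}}

/-- In an inconsistent tree with consistent branches there is a branch along which every node is
a typical member of its family of siblings, with respect to finitely many sets. -/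
theorem exists_typical_branch {μ : Type*} (a : List ℕ → μ → M)
    {ℰ : Set (Set ((ℕ × μ) ⊕ μ → M))} (hℰ : ℰ.Finite) :
    ∃ f : ℕ → ℕ, ∀ j, ∀ E ∈ ℰ,
      Sum.elim (fun p : ℕ × μ => a ((branch f j).take (p.1 + 1)) p.2) (a (branch f (j + 1))) ∈ E →
      {i | Sum.elim (fun p : ℕ × μ => a ((branch f j).take (p.1 + 1)) p.2)
        (a (branch f j ++ [i])) ∈ E}.Infinite := by
  obtain ⟨f, hf⟩ := exists_seq_of_forall_list (Q := fun _ : ℕ => True)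
    (P := fun l i => ∀ E ∈ ℰ,
      Sum.elim (fun p : ℕ × μ => a (l.take (p.1 + 1)) p.2) (a (l ++ [i])) ∈ E →
      {i | Sum.elim (fun p : ℕ × μ => a (l.take (p.1 + 1)) p.2) (a (l ++ [i])) ∈ E}.Infinite)
    (fun l _ => by
      have : Finite ℰ := hℰ
      -- Children are coloured by the sets of `ℰ` that contain them. With finitely many colours some
      -- class is infinite, and any child in it is typical.
      let col : ℕ → Set ℰ := fun i =>
        {E | Sum.elim (fun p : ℕ × μ => a (l.take (p.1 + 1)) p.2) (a (l ++ [i])) ∈ E.1}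
      obtain ⟨y, hy⟩ := Finite.exists_infinite_fiber col
      have hy' : (col ⁻¹' {y}).Infinite := Set.infinite_coe_iff.1 hy
      obtain ⟨i, hi⟩ := hy'.nonempty
      refine ⟨i, trivial, fun E hE h => hy'.mono fun i' hi' => ?_⟩
      have h1 : col i = col i' := (show col i = y from hi).trans (show col i' = y from hi').symm
      have h2 : (⟨E, hE⟩ : ℰ) ∈ col i := h
      rw [h1] at h2
      exact h2)
  refine ⟨f, fun j E hE h => ?_⟩
  rw [branch_succ] at h
  exact (hf j).2 E hE h

/-- A tree witnessing the tree property gives rise to a consistent sequence of tuples, every member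
of which starts long inconsistent sequences over its predecessors. -/
theorem IsMonster.exists_dividing_seq (hM : IsMonster T M κ) {ξ μ : Type} [Finite ξ] [Finite μ]
    {A : Set M} (hA : #A < κ) {Φ : Set (ξ ⊕ μ → M)} (hΦ : A.Definable L Φ) {k : ℕ}
    {a : List ℕ → μ → M} (hrow : ∀ η : List ℕ, KInc k Φ fun i => a (η ++ [i]))
    (hpath : ∀ (f : ℕ → ℕ) (n : ℕ), ∃ x : ξ → M, ∀ j < n, Sum.elim x (a (branch f (j + 1))) ∈ Φ)
    {𝒬 : Set (Set (μ → M))} (h𝒬 : ∀ D ∈ 𝒬, A.Definable L D) (ha : ∀ D ∈ 𝒬, ∀ η, a η ∈ D) :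
    ∃ z : ℕ → μ → M, (∀ D ∈ 𝒬, ∀ j, z j ∈ D) ∧
      (∀ n, ∃ x : ξ → M, ∀ j < n, Sum.elim x (z j) ∈ Φ) ∧
      ∀ (j n : ℕ) (E : Set ((ℕ × μ) ⊕ μ → M)), A.Definable L E →
        (∀ v v' : ℕ × μ → M, (∀ l < j, ∀ i, v (l, i) = v' (l, i)) → ∀ x : μ → M,
          Sum.elim v x ∈ E → Sum.elim v' x ∈ E) →
        Sum.elim (fun p : ℕ × μ => z p.1 p.2) (z j) ∈ E →
        ∃ s : Fin (n + 1) → μ → M,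
          (∀ i, Sum.elim (fun p : ℕ × μ => z p.1 p.2) (s i) ∈ E) ∧ KInc k Φ s := by
  -- The term z_j will play the role of the node at level j + 1, since the root has no siblings.
  let S₁ : Set (Set (ℕ × μ → M)) := {X | ∃ D ∈ 𝒬, ∃ j : ℕ, X = {v | (fun i => v (j, i)) ∈ D}}
  let S₂ : Set (Set (ℕ × μ → M)) := {X | ∃ n : ℕ, X = {v | ∃ x ∈ (Set.univ : Set (ξ → M)),
    ∀ j ∈ Finset.range n, Sum.elim x (fun i => v (j, i)) ∈ Φ}}
  let W : ℕ → ℕ → Set ((ℕ × μ) ⊕ μ → M) → Set (ℕ × μ → M) := fun j n E =>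
    {v | v ∘ Sum.elim id (Prod.mk j) ∈ E → ∃ s : Fin (n + 1) × μ → M,
      Sum.elim v s ∈ {w : (ℕ × μ) ⊕ (Fin (n + 1) × μ) → M |
        (∀ i, w ∘ Sum.map id (Prod.mk i) ∈ E) ∧
        KInc k Φ fun (i : Fin (n + 1)) q => w (Sum.inr (i, q))}}
  have hW : ∀ (v : ℕ × μ → M) (j n : ℕ) (E : Set ((ℕ × μ) ⊕ μ → M)), v ∈ W j n E ↔
      (Sum.elim v (fun i => v (j, i)) ∈ E → ∃ s : Fin (n + 1) × μ → M,
        (∀ i, Sum.elim v (fun q => s (i, q)) ∈ E) ∧ KInc k Φ fun i q => s (i, q)) := by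
    intro v j n E
    have h1 : v ∘ Sum.elim id (Prod.mk j) = Sum.elim v (fun i => v (j, i)) := by
      funext i
      rcases i with i | i <;> rfl
    have h2 : ∀ (s : Fin (n + 1) × μ → M) (i : Fin (n + 1)),
        Sum.elim v s ∘ Sum.map id (Prod.mk i) = Sum.elim v (fun q => s (i, q)) := by
      intro s i
      funext q
      rcases q with q | q <;> rfl
    simp only [W, Set.mem_ofPred_eq, h1, h2, Sum.elim_inr]
  let S₃ : Set (Set (ℕ × μ → M)) := {X | ∃ (j n : ℕ) (E : Set ((ℕ × μ) ⊕ μ → M)),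
    A.Definable L E ∧ (∀ v v' : ℕ × μ → M, (∀ l < j, ∀ i, v (l, i) = v' (l, i)) →
      ∀ x : μ → M, Sum.elim v x ∈ E → Sum.elim v' x ∈ E) ∧ X = W j n E}
  obtain ⟨v, hv⟩ := hM.exists_realization_of_countable (ι := ℕ × μ) hA (S := S₁ ∪ S₂ ∪ S₃) (by
    rintro X ((⟨D, hD, j, rfl⟩ | ⟨n, rfl⟩) | ⟨j, n, E, hE, -, rfl⟩)
    · exact (h𝒬 D hD).preimage_comp (Prod.mk j)
    · exact definable_consistent hΦ Set.definable_univ _ _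
    · have h1 : A.Definable L {w : (ℕ × μ) ⊕ (Fin (n + 1) × μ) → M |
          (∀ i : Fin (n + 1), w ∘ Sum.map id (Prod.mk i) ∈ E) ∧
          KInc k Φ fun (i : Fin (n + 1)) q => w (Sum.inr (i, q))} :=
        (definable_forall fun i => hE.preimage_comp _).inter (definable_kInc hΦ k _)
      have h2 := (hE.preimage_comp (Sum.elim id (Prod.mk j) : (ℕ × μ) ⊕ μ → ℕ × μ)).compl.union
        h1.exists_of_finite
      convert! h2 using 1
      ext v
      exact imp_iff_not_or) (by
    intro F hF hFfin
    have : ∃ ℰ : Set (Set ((ℕ × μ) ⊕ μ → M)), ℰ.Finite ∧ ∀ f : ℕ → ℕ, (∀ j, ∀ E ∈ ℰ,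
        Sum.elim (fun p : ℕ × μ => a ((branch f j).take (p.1 + 1)) p.2) (a (branch f (j + 1))) ∈ E →
        {i | Sum.elim (fun p : ℕ × μ => a ((branch f j).take (p.1 + 1)) p.2)
          (a (branch f j ++ [i])) ∈ E}.Infinite) →
        (fun p => a (branch f (p.1 + 1)) p.2) ∈ ⋂₀ F := by
      induction F, hFfin using Set.Finite.induction_on with
      | empty => exact ⟨∅, Set.finite_empty, fun _ _ => by simp⟩
      | @insert X F _ _ ih =>
        obtain ⟨ℰ, hℰ, h⟩ := ih ((Set.subset_insert _ _).trans hF)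
        rcases hF (Set.mem_insert X F) with (⟨D, hD, j, rfl⟩ | ⟨n, rfl⟩) |
          ⟨j, n, E, hE, hsupp, rfl⟩
        · refine ⟨ℰ, hℰ, fun f hf => ?_⟩
          rw [Set.sInter_insert]
          exact ⟨show a (branch f (j + 1)) ∈ D from ha D hD _, h f hf⟩
        · refine ⟨ℰ, hℰ, fun f hf => ?_⟩
          rw [Set.sInter_insert]
          refine ⟨?_, h f hf⟩
          obtain ⟨x, hx⟩ := hpath f n
          exact ⟨x, Set.mem_univ _, fun j hj => hx j (Finset.mem_range.1 hj)⟩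
        · refine ⟨insert E ℰ, hℰ.insert E, fun f hf => ?_⟩
          rw [Set.sInter_insert]
          refine ⟨?_, h f fun j E hE => hf j E (Set.mem_insert_of_mem _ hE)⟩
          -- The truncations match the branch below j only; `E` does not look at later rows.
          have hagree : ∀ l < j, ∀ i, a (branch f (l + 1)) i =
              a ((branch f j).take (l + 1)) i := by
            intro l hl i
            rw [branch, branch, ← List.map_take, List.take_range, min_eq_left (by omega)]
          rw [hW]
          intro hmem
          have hinf := hf j E (Set.mem_insert _ _) (hsupp _ _ hagree _ hmem)
          -- Infinitely many siblings satisfy `E`, and being children of one node they are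
          -- k-inconsistent.
          let g := hinf.natEmbedding
          refine ⟨fun p => a (branch f j ++ [(g p.1).1]) p.2, fun i => ?_, ?_⟩
          · exact hsupp _ _ (fun l hl i => (hagree l hl i).symm) _ (g i).2
          · exact (hrow (branch f j)).comp ((Fin.valEmbedding.trans g).trans
              (Function.Embedding.subtype _))
    obtain ⟨ℰ, hℰ, h⟩ := this
    obtain ⟨f, hf⟩ := exists_typical_branch a hℰ
    exact ⟨_, h f hf⟩)
  refine ⟨fun j i => v (j, i), fun D hD j => hv _ (Or.inl (Or.inl ⟨D, hD, j, rfl⟩)),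
    fun n => ?_, fun j n E hE hsupp hmem => ?_⟩
  · obtain ⟨x, -, hx⟩ := hv _ (Or.inl (Or.inr ⟨n, rfl⟩))
    exact ⟨x, fun j hj => hx j (Finset.mem_range.2 hj)⟩
  · obtain ⟨s, hs, hs'⟩ := (hW v j n E).1 (hv _ (Or.inr ⟨j, n, E, hE, hsupp, rfl⟩)) hmem
    exact ⟨fun i q => s (i, q), hs, hs'⟩

theorem dependsOn_of_definable {β μ : Type*} {A : Set M} {E : Set (β ⊕ μ → M)}
    (hE : A.Definable L E) : ∃ V : Finset β, ∀ v v' : β → M, (∀ i ∈ V, v i = v' i) →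
      ∀ x : μ → M, Sum.elim v x ∈ E → Sum.elim v' x ∈ E := by
  classical
  obtain ⟨V, E', -, h⟩ := exists_finite_support hE
  refine ⟨V.toLeft, fun v v' hvv x hx => ?_⟩
  rw [h] at hx ⊢
  convert! hx using 1
  funext ⟨i, hi⟩
  rcases i with i | i
  · exact (hvv i (Finset.mem_toLeft.2 hi)).symm
  · rfl

/-- In an `NTP₂` theory, a simple type in finitely many variables is co-simple. -/
theorem IsMonster.isCoSimple_of_finite (hM : IsMonster T M κ) (hT : IsNTP2 L M) {α : Type}
    [Finite α] {A : Set M} (hA : #A < κ) {p : Set (PFormula L M α)} (hpA : IsOver p A)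
    (hp : IsSimpleType p) : IsCoSimpleType p A := by
  rintro ⟨n, r, φ, a, hφ, ha, k, hrow, hpath⟩
  obtain ⟨z, hz𝒬, hzc, hzd⟩ := hM.exists_dividing_seq hA hφ.definable (k := k) (a := a) hrow
    (fun f n => by
      obtain ⟨x, hx⟩ := hpath f ((fun j => {b | φ.Realize (Sum.elim b (a (branch f (j + 1))))}) ''
        Set.Iio n) (by
          rintro _ ⟨j, -, rfl⟩
          exact Or.inl ⟨j + 1, rfl⟩) ((Set.finite_Iio n).image _)
      exact ⟨x, fun j hj => hx _ ⟨j, hj, rfl⟩⟩)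
    (𝒬 := {D | ∃ θ ∈ p, ∃ j : Fin r, D = (fun v : Fin r × α → M => v ∘ Prod.mk j) ⁻¹' θ.solutions})
    (by
      rintro _ ⟨θ, hθ, j, rfl⟩
      exact (PFormula.Over.definable (hpA θ hθ)).preimage_comp _)
    (by
      rintro _ ⟨θ, hθ, j, rfl⟩ η
      exact ha η j θ hθ)
  let μ := Fin r × α
  let Φ : Set (Fin n ⊕ μ → M) := φ.solutions
  let A₁ : Set M := A ∪ Set.range fun p : ℕ × μ => z p.1 p.2
  have hA₁ : #A₁ < κ := hM.union_lt hA (hM.range_lt _)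
  have hAA₁ : A ⊆ A₁ := Set.subset_union_left
  have hΦ : A₁.Definable L Φ := hφ.definable.mono hAA₁
  -- A nonprincipal ultrafilter: each of its members contains z_j for infinitely many j.
  let 𝒰 : Ultrafilter (μ → M) := (Filter.hyperfilter ℕ).map z
  have hmem : ∀ D, D ∈ 𝒰 → ∃ᶠ j in Filter.cofinite, z j ∈ D := by
    intro D hD
    have h1 : ∀ᶠ j in (Filter.hyperfilter ℕ : Filter ℕ), z j ∈ D := hD
    exact h1.frequently.filter_mono Filter.hyperfilter_le_cofinite
  have hrange : Set.range z ∈ 𝒰 := by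
    refine Filter.mem_map.2 (Filter.univ_mem' fun j => ?_)
    exact ⟨j, rfl⟩
  have hs : Supp A₁ 𝒰 := by
    refine Filter.mem_of_superset hrange ?_
    rintro _ ⟨j, rfl⟩ i
    exact Or.inr ⟨(j, i), rfl⟩
  -- A formula over `A₁` true of `c` involves finitely many of the z's and holds at some z_j beyond
  -- all of them. There `hzd` supplies arbitrarily long k-inconsistent sequences satisfying it.
  have hbig : ∀ c, Av L 𝒰 A₁ c → Div L Φ c k A₁ := by
    intro c hc
    obtain ⟨s, hs, hk⟩ := hM.exists_kInc_seq hA₁ (𝒟 := {D | A₁.Definable L D ∧ c ∈ D})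
      (fun D hD => hD.1) ⟨Set.definable_univ, Set.mem_univ _⟩
      (fun D hD E hE => ⟨hD.1.inter hE.1, hD.2, hE.2⟩) hΦ (k := k) (by
        rintro D ⟨hD, hcD⟩ m
        obtain ⟨E, hE, hDE⟩ := exists_section_of_definable hD
        obtain ⟨V, hV⟩ := dependsOn_of_definable hE
        have h1 := Filter.frequently_cofinite_iff_infinite.1 (hmem D ((hc.mem_iff hD).1 hcD))
        obtain ⟨j, hjD, hj⟩ := h1.exists_gt (V.sup Prod.fst)
        obtain ⟨s, hs, hk⟩ := hzd j m E hE (fun v v' hvv => hV v v' fun q hq =>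
          hvv q.1 ((Finset.le_sup (f := Prod.fst) hq).trans_lt hj) q.2) ((hDE _).1 hjD)
        exact ⟨s, fun i => (hDE _).2 (hs i), hk⟩)
    exact ⟨s, fun i => hM.conj_of_forall hA₁ (hM.range_lt c) fun D hD hcD => hs i D ⟨hD, hcD⟩, hk⟩
  have hp𝒰 : ∀ c, Av L 𝒰 A₁ c → ∀ j : Fin r, Realizes (fun i => c (j, i)) p := by
    intro c hc j θ hθ
    refine hc {v | v ∘ Prod.mk j ∈ θ.solutions}
      (((PFormula.Over.definable (hpA θ hθ)).preimage_comp _).mono hAA₁) ?_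
    refine Filter.mem_of_superset hrange ?_
    rintro _ ⟨l, rfl⟩
    exact hz𝒬 _ ⟨θ, hθ, j, rfl⟩ l
  -- Realizations of `p` enter the base one at a time. The type of `c` is finitely satisfiable in
  -- `A₁`, so it does not fork over the current base; simplicity of `p` then says that the type of
  -- the new `b` over the base and `c` does not divide, and dividing at `c` survives.
  have hlist : ∀ (c : μ → M) (t : Set M), Av L 𝒰 (A₁ ∪ t) c → ∀ l : List (α → M),
      (∀ b ∈ l, Realizes b p ∧ Set.range b ⊆ t) →
      Div L Φ c k (A₁ ∪ ⋃ b ∈ {b | b ∈ l}, Set.range b) := by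
    intro c t hc l
    induction l with
    | nil => exact fun _ => (hbig c (hc.mono Set.subset_union_left)).mono (by simp)
    | cons b l ih =>
      intro hl
      have h1 := ih fun b hb => hl b (List.mem_cons_of_mem _ hb)
      set A' : Set M := A₁ ∪ ⋃ b ∈ {b | b ∈ l}, Set.range b with hA'
      have hA'lt : #A' < κ := hM.union_lt hA₁ (hM.countable_lt
        ((List.finite_toSet l).countable.biUnion fun y _ => Set.countable_range y))
      have hnf : NF L A' c (Set.range b) := hc.nf hs Set.subset_union_left (by
        refine Set.union_subset (Set.union_subset_union_right _ ?_) ?_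
        · exact Set.iUnion₂_subset fun b hb => (hl b (List.mem_cons_of_mem _ hb)).2
        · exact (hl b List.mem_cons_self).2.trans Set.subset_union_right)
      have hnd := hM.ndset_of_simple hA'lt
        (fun θ hθ i => Or.inl (hAA₁ (hpA θ hθ i))) hp (hl b List.mem_cons_self).1 hnf
      refine (hM.div_union hA'lt (hM.range_lt b) hnd (hΦ.mono Set.subset_union_left) h1).mono ?_
      rw [show A' ∪ Set.range b = A₁ ∪ ((⋃ b ∈ {b | b ∈ l}, Set.range b) ∪ Set.range b) from
        Set.union_assoc _ _ _]
      refine Set.union_subset_union_right _ (Set.iUnion₂_subset fun b' hb' => ?_)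
      rcases List.mem_cons.1 hb' with rfl | hb'
      · exact Set.subset_union_right
      · refine subset_trans ?_ Set.subset_union_left
        exact Set.subset_biUnion_of_mem (u := fun b : α → M => Set.range b) hb'
  have hcd : CD L Φ 𝒰 A₁ := by
    refine hM.cd_of_rows hT hA₁ hs hΦ (k := k) fun t ht htA => ?_
    have htlt : #(⋃ c ∈ t, Set.range c : Set M) < κ :=
      hM.countable_lt (ht.biUnion fun y _ => Set.countable_range y)
    have hlt := hM.union_lt hA₁ htlt
    obtain ⟨c, hc⟩ := hM.exists_av (L := L) 𝒰 hlt
    obtain ⟨s, hs, hk⟩ := hM.exists_kInc_seq hlt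
      (𝒟 := {D | (A₁ ∪ ⋃ c ∈ t, Set.range c).Definable L D ∧ c ∈ D})
      (fun D hD => hD.1) ⟨Set.definable_univ, Set.mem_univ _⟩
      (fun D hD E hE => ⟨hD.1.inter hE.1, hD.2, hE.2⟩) (hΦ.mono Set.subset_union_left) (k := k) (by
        rintro D ⟨hD, hcD⟩ m
        obtain ⟨n, b, E, hb, hE, hDE⟩ := exists_finite_section hD
        have hb' : ∀ i, ∃ d ∈ t, ∃ q : μ, d q = b i := by
          intro i
          obtain ⟨d, hd, q, hq⟩ := Set.mem_iUnion₂.1 (hb i)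
          exact ⟨d, hd, q, hq⟩
        choose d hd q hq using hb'
        obtain ⟨s, hs, hk⟩ := hlist c _ hc
          -- Each parameter is a coordinate of some `d i` in `t`; the block of `d i` containing it
          -- is a realization of `p`, and the whole block is added.
          ((List.finRange n).map fun i e => d i ((q i).1, e)) (by
            intro b' hb'
            obtain ⟨i, -, rfl⟩ := List.mem_map.1 hb'
            refine ⟨hp𝒰 _ (htA _ (hd i)) _, ?_⟩
            rintro _ ⟨e, rfl⟩
            exact Set.mem_biUnion (hd i) ⟨_, rfl⟩)
        refine ⟨fun i => s i, fun i => ((hs i).mem_iff ?_).1 hcD, hk.comp Fin.valEmbedding⟩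
        have h1 : (A₁ ∪ ⋃ b ∈ {b | b ∈ (List.finRange n).map fun i (e : α) => d i ((q i).1, e)},
            Set.range b).Definable L {w : μ → M | Sum.elim b w ∈ E} := by
          refine definable_section_left hE Set.subset_union_left fun i => Or.inr ?_
          refine Set.mem_biUnion (x := fun e => d i ((q i).1, e))
            (List.mem_map.2 ⟨i, List.mem_finRange i, rfl⟩) ⟨(q i).2, ?_⟩
          exact hq i
        convert! h1 using 1
        ext w
        exact hDE w)
    refine ⟨s, hk, fun j D hD hU => hs j D ⟨hD, hc D hD hU⟩⟩
  obtain ⟨m, hm⟩ := hcd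
  obtain ⟨u, hu⟩ := hM.exists_morley_seq 𝒰 hA₁
  refine hm ((List.range m).map u) (by simp)
    (by rw [List.map_map]; exact mor_of_seq m fun i _ => hu i) ?_
  by_contra hcon
  -- Inconsistency of a Morley sequence of length m is a definable condition, so it is inherited by
  -- some m terms of z, although all the Φ(x,z_j) are jointly consistent.
  have hD := (definable_consistent hΦ Set.definable_univ (Finset.range m)
    (fun (i : ℕ) (q : μ) => (i, q))).compl
  obtain ⟨z', hz', hz''⟩ := exists_mem_of_morley hrange (A := A₁) (by
    rintro _ ⟨j, rfl⟩ i
    exact Or.inr ⟨(j, i), rfl⟩) (n := m) (fun i _ => hu i) hD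
    (v := fun i => if i < m then u i else z 0) (fun i hi => if_pos hi)
    (fun i hi => by rw [if_neg (by omega)]; exact ⟨0, rfl⟩) (by
      rintro ⟨x, -, hx⟩
      refine hcon ⟨x, fun c hc => ?_⟩
      obtain ⟨i, hi, rfl⟩ := List.mem_map.1 hc
      have := hx i (Finset.mem_range.2 (List.mem_range.1 hi))
      simpa only [if_pos (List.mem_range.1 hi)] using this)
  choose g hg using hz'
  obtain ⟨x, hx⟩ := hzc ((Finset.range m).sup g + 1)
  refine hz'' ⟨x, Set.mem_univ _, fun i hi => ?_⟩
  have := hx (g i) (Nat.lt_succ_of_le (Finset.le_sup hi))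
  rw [hg] at this
  exact this

end CoSimple

/-! ### Over models: the weak Kim lemma and the broom lemma. -/

section Models

variable {L : FirstOrder.Language.{u, v}} {T : L.Theory} {M : Type w} [L.Structure M]
  {κ : Cardinal.{w}}

/-- The set `S` contains arbitrarily long `k`-inconsistent sequences. -/
def Big {ξ μ : Type*} (k : ℕ) (Φ : Set (ξ ⊕ μ → M)) (S : Set (μ → M)) : Prop :=
  ∀ n, ∃ s : Fin (n + 1) → μ → M, (∀ i, s i ∈ S) ∧ KInc k Φ s

theorem Big.mono {ξ μ : Type*} {k : ℕ} {Φ : Set (ξ ⊕ μ → M)} {S S' : Set (μ → M)}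
    (h : Big k Φ S) (hS : S ⊆ S') : Big k Φ S' := fun n => by
  obtain ⟨s, hs, hk⟩ := h n
  exact ⟨s, fun i => hS (hs i), hk⟩

/-- Pigeonhole on one long sequence. Sets that are not big thus form an ideal, whose dual filter can
be extended to an ultrafilter. -/
theorem Big.of_union {ξ μ : Type*} {k : ℕ} {Φ : Set (ξ ⊕ μ → M)} {S S' : Set (μ → M)}
    (h : Big k Φ (S ∪ S')) : Big k Φ S ∨ Big k Φ S' := by
  classical
  by_contra! hcon
  obtain ⟨h1, h2⟩ := hcon
  obtain ⟨n, hn⟩ := not_forall.1 h1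
  obtain ⟨n', hn'⟩ := not_forall.1 h2
  obtain ⟨s, hs, hk⟩ := h (n + n' + 1)
  have sub : ∀ (m : ℕ) (S₀ : Set (μ → M)) (I : Finset (Fin (n + n' + 1 + 1))), m + 1 ≤ I.card →
      (∀ i ∈ I, s i ∈ S₀) → ∃ s : Fin (m + 1) → μ → M, (∀ i, s i ∈ S₀) ∧ KInc k Φ s := by
    intro m S₀ I hI hS
    obtain ⟨J, hJI, hJ⟩ := Finset.exists_subset_card_eq hI
    let e := J.orderEmbOfFin hJ
    exact ⟨s ∘ e, fun i => hS _ (hJI (J.orderEmbOfFin_mem hJ i)), hk.comp e.toEmbedding⟩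
  have hcard := Finset.card_filter_add_card_filter_not (s := Finset.univ) (fun i => s i ∈ S)
  rw [Finset.card_univ, Fintype.card_fin] at hcard
  rcases Nat.lt_or_ge n (Finset.univ.filter fun i => s i ∈ S).card with hlt | hle
  · exact hn (sub n S _ hlt fun i hi => (Finset.mem_filter.1 hi).2)
  · refine hn' (sub n' S' (Finset.univ.filter fun i => ¬ s i ∈ S) (by omega) fun i hi => ?_)
    exact (hs i).resolve_left (Finset.mem_filter.1 hi).2

/-- Having a k-inconsistent sequence of given length in `D` is a condition over `N`; the dividing
sequence satisfies it, so a sequence from `N` does too. -/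
theorem TarskiVaught.big_of_div {ξ μ : Type} [Finite ξ] [Finite μ] {N : Set M}
    (hN : TarskiVaught L N) {Φ : Set (ξ ⊕ μ → M)} (hΦ : N.Definable L Φ) {k : ℕ} {a : μ → M}
    (h : Div L Φ a k N) {D : Set (μ → M)} (hD : N.Definable L D) (haD : a ∈ D) :
    Big k Φ (D ∩ {z | ∀ i, z i ∈ N}) := by
  intro n
  obtain ⟨s, hs, hk⟩ := h
  have hdef : N.Definable L {w : Fin (n + 1) × μ → M | (∀ i, w ∘ Prod.mk i ∈ D) ∧
      KInc k Φ fun (i : Fin (n + 1)) q => w (i, q)} :=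
    (definable_forall fun i => hD.preimage_comp (Prod.mk i)).inter (definable_kInc hΦ k _)
  obtain ⟨d, ⟨hd, hdk⟩, hdN⟩ := hN _ _ hdef ⟨fun p => s p.1 p.2,
    fun i => ((hs i).mem_iff hD).1 haD, hk.comp Fin.valEmbedding⟩
  exact ⟨fun i q => d (i, q), fun i => ⟨hd i, fun q => hdN (i, q)⟩, hdk⟩

/-- Kim's lemma, weak form: a formula that divides over a model has inconsistent Morley sequences
for some coheir. -/
theorem IsMonster.exists_cd_ultrafilter (hM : IsMonster T M κ) (hT : IsNTP2 L M) {ξ μ : Type}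
    [Finite ξ] [Finite μ] {N : Set M} (hN : #N < κ) (hTV : TarskiVaught L N)
    {Φ : Set (ξ ⊕ μ → M)} (hΦ : N.Definable L Φ) {k : ℕ} {a : μ → M} (h : Div L Φ a k N) :
    ∃ 𝒰 : Ultrafilter (μ → M), Supp N 𝒰 ∧ Av L 𝒰 N a ∧ CD L Φ 𝒰 N := by
  -- The filter dual to non-bigness of the `N`-points in tp(a/N). An ultrafilter extending it
  -- averages to tp(a/N) and has only big members, which provides inconsistent rows over any further
  -- parameters.
  let F : Filter (μ → M) :=
    { sets := {S | ∃ D, N.Definable L D ∧ a ∈ D ∧ ¬ Big k Φ ((D ∩ {z | ∀ i, z i ∈ N}) \ S)}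
      univ_sets := ⟨Set.univ, Set.definable_univ, Set.mem_univ _, fun hb => by
        obtain ⟨s, hs, -⟩ := hb 0
        exact (hs 0).2 (Set.mem_univ _)⟩
      sets_of_superset := by
        rintro S S' ⟨D, hD, ha, hS⟩ hSS
        exact ⟨D, hD, ha, fun hb => hS (hb.mono (Set.sdiff_subset_sdiff_right hSS))⟩
      inter_sets := by
        rintro S S' ⟨D, hD, ha, hS⟩ ⟨D', hD', ha', hS'⟩
        refine ⟨D ∩ D', hD.inter hD', ⟨ha, ha'⟩, fun hb => ?_⟩
        have : Big k Φ (((D ∩ {z | ∀ i, z i ∈ N}) \ S) ∪ ((D' ∩ {z | ∀ i, z i ∈ N}) \ S')) := by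
          refine hb.mono ?_
          rintro z ⟨⟨⟨h1, h2⟩, h3⟩, h4⟩
          by_cases hz : z ∈ S
          · exact Or.inr ⟨⟨h2, h3⟩, fun hz' => h4 ⟨hz, hz'⟩⟩
          · exact Or.inl ⟨⟨h1, h3⟩, hz⟩
        exact this.of_union.elim hS hS' }
  have hF : ∀ S, S ∈ F ↔ ∃ D, N.Definable L D ∧ a ∈ D ∧
      ¬ Big k Φ ((D ∩ {z | ∀ i, z i ∈ N}) \ S) := fun S => Iff.rfl
  have hne : F.NeBot := by
    rw [← Filter.empty_mem_iff_bot.not.trans Iff.rfl |>.trans Filter.neBot_iff.symm]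
    rintro ⟨D, hD, ha, hS⟩
    refine hS ?_
    rw [Set.sdiff_empty]
    exact hTV.big_of_div hΦ h hD ha
  let 𝒰 : Ultrafilter (μ → M) := Ultrafilter.of F
  have hFU : ∀ S ∈ F, S ∈ 𝒰 := fun S hS => Ultrafilter.of_le F hS
  have hnot : ¬ Big k Φ (∅ : Set (μ → M)) := fun hb => by
    obtain ⟨s, hs, -⟩ := hb 0
    exact hs 0
  have hsupp : Supp N 𝒰 := by
    refine hFU _ ⟨Set.univ, Set.definable_univ, Set.mem_univ _, fun hb => hnot (hb.mono ?_)⟩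
    rintro z ⟨⟨-, h1⟩, h2⟩
    exact h2 h1
  have hDU : ∀ D, N.Definable L D → a ∈ D → D ∈ 𝒰 := by
    intro D hD ha
    refine hFU _ ⟨D, hD, ha, fun hb => hnot (hb.mono ?_)⟩
    rintro z ⟨⟨h1, -⟩, h2⟩
    exact h2 h1
  have hbig : ∀ S ∈ 𝒰, Big k Φ S := by
    intro S hS
    by_contra hb
    refine Ultrafilter.compl_mem_iff_notMem.1 (hFU Sᶜ
      ⟨Set.univ, Set.definable_univ, Set.mem_univ _, fun hb' => hb (hb'.mono ?_)⟩) hS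
    rintro z ⟨-, h⟩
    exact not_not.1 h
  refine ⟨𝒰, hsupp, fun D hD hU => by_contra fun ha =>
    Ultrafilter.compl_mem_iff_notMem.1 (hDU Dᶜ hD.compl ha) hU, ?_⟩
  refine hM.cd_of_rows hT hN hsupp hΦ (k := k) fun t ht _ => ?_
  have hlt := hM.union_lt hN (hM.countable_lt (ht.biUnion fun y _ => Set.countable_range y))
  obtain ⟨s, hs, hk⟩ := hM.exists_kInc_seq hlt
    (𝒟 := {D | (N ∪ ⋃ c ∈ t, Set.range c).Definable L D ∧ D ∈ 𝒰})
    (fun D hD => hD.1) ⟨Set.definable_univ, Filter.univ_mem⟩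
    (fun D hD E hE => ⟨hD.1.inter hE.1, Filter.inter_mem hD.2 hE.2⟩)
    (hΦ.mono Set.subset_union_left) (k := k) fun D hD => hbig D hD.2
  exact ⟨s, hk, fun j D hD hU => hs j D ⟨hD, hU⟩⟩

theorem IsMonster.exists_fixes_of_mor_cons (hM : IsMonster T M κ) {μ : Type} [Finite μ] {N : Set M}
    (hN : #N < κ) {𝒰 : Ultrafilter (μ → M)} (hs : Supp N 𝒰)
    {l : List (Ultrafilter (μ → M) × (μ → M))} (hls : ∀ q ∈ l, Supp N q.1) {a b : μ → M}
    (ha : Mor L N ((𝒰, a) :: l)) (hb : Mor L N ((𝒰, b) :: l)) :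
    ∃ τ : M ≃[L] M, Fixes N τ ∧ τ ∘ a = b ∧ ∀ q ∈ l, τ ∘ q.2 = q.2 := by
  have himg : (Language.Equiv.refl L M) '' N = N := by
    ext
    simp
  obtain ⟨τ, hτ, hτl, -⟩ := hM.exists_fixes_of_mor subset_rfl hN
    (l := (𝒰, a) :: l) (l' := (𝒰, b) :: l) (by
      intro q hq
      rcases List.mem_cons.1 hq with rfl | hq
      · exact hs
      · exact hls q hq) (Fixes.refl N) ha (by rwa [himg]) rfl
  rw [List.map_cons, List.cons.injEq, Prod.mk.injEq] at hτl
  refine ⟨τ, hτ, hτl.1.2, fun q hq => ?_⟩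
  have h1 : l.map (fun q => (q.1, τ ∘ q.2)) = l.map id := by rw [hτl.2, List.map_id]
  exact congrArg Prod.snd (List.map_inj_left.1 h1 q hq)

/-- The broom lemma. -/
theorem IsMonster.broom (hM : IsMonster T M κ) {ξ μ ι : Type} [Finite μ] {N : Set M}
    (hN : #N < κ) {Φ : ι → Set (ξ ⊕ μ → M)} (hΦ : ∀ i, N.Definable L (Φ i))
    {𝒰 : ι → Ultrafilter (μ → M)} (hs : ∀ i, Supp N (𝒰 i)) (hcd : ∀ i, CD L (Φ i) (𝒰 i) N)
    (I : Finset ι) {a : μ → M} (ha : ∀ i, Av L (𝒰 i) N a)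
    {l : List (Ultrafilter (μ → M) × (μ → M))} (hls : ∀ q ∈ l, Supp N q.1)
    (hl : Mor L (N ∪ Set.range a) l) {X Y : Set (ξ → M)}
    (hY : ∀ σ : M ≃[L] M, Fixes N σ → (∀ q ∈ l, σ ∘ q.2 = q.2) → ∀ x ∈ Y, σ ∘ x ∈ Y)
    (hX : ∀ x ∈ X, x ∈ Y ∨ ∃ i ∈ I, Sum.elim x a ∈ Φ i) :
    ∃ F : List (M ≃[L] M), (∀ σ ∈ F, Fixes N σ ∧ ∀ q ∈ l, σ ∘ q.2 = q.2) ∧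
      ∀ x, (∀ σ ∈ F, σ ∘ x ∈ X) → x ∈ Y := by
  classical
  induction I using Finset.induction_on generalizing a l X Y with
  | empty =>
    refine ⟨[Language.Equiv.refl L M], ?_, fun x hx => ?_⟩
    · intro σ hσ
      rw [List.mem_singleton.1 hσ]
      exact ⟨Fixes.refl N, fun q _ => rfl⟩
    · rcases hX x (hx _ (List.mem_singleton_self _)) with h | ⟨i, hi, -⟩
      · exact h
      · exact absurd hi (Finset.notMem_empty i)
  | @insert i₀ I _ ih =>
    -- Once only formulas from the smaller `I` remain, at finitely many tuples, the tuples are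
    -- eliminated in turn. For the head `b`, the rest of the sequence joins `l` and its formulas
    -- join `Y`, so the induction hypothesis for `I` applies.
    have remove : ∀ (as : List (μ → M)), (∀ b ∈ as, ∀ i, Av L (𝒰 i) N b) →
        Mor L N (as.map (Prod.mk (𝒰 i₀)) ++ l) → ∀ X' : Set (ξ → M),
        (∀ x ∈ X', x ∈ Y ∨ ∃ b ∈ as, ∃ i ∈ I, Sum.elim x b ∈ Φ i) →
        ∃ F : List (M ≃[L] M), (∀ σ ∈ F, Fixes N σ ∧ ∀ q ∈ l, σ ∘ q.2 = q.2) ∧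
          ∀ x, (∀ σ ∈ F, σ ∘ x ∈ X') → x ∈ Y := by
      intro as
      induction as with
      | nil =>
        intro _ _ X' hX'
        refine ⟨[Language.Equiv.refl L M], ?_, fun x hx => ?_⟩
        · intro σ hσ
          rw [List.mem_singleton.1 hσ]
          exact ⟨Fixes.refl N, fun q _ => rfl⟩
        · rcases hX' x (hx _ (List.mem_singleton_self _)) with h | ⟨b, hb, -⟩
          · exact h
          · exact absurd hb (List.not_mem_nil)
      | cons b t ih' =>
        intro has hmor X' hX'
        obtain ⟨F₁, hF₁, hF₁'⟩ := ih (a := b) (l := t.map (Prod.mk (𝒰 i₀)) ++ l) (X := X')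
          (Y := Y ∪ {x | ∃ b ∈ t, ∃ i ∈ I, Sum.elim x b ∈ Φ i}) (has b List.mem_cons_self)
          (by
            intro q hq
            rcases List.mem_append.1 hq with hq | hq
            · obtain ⟨c, -, rfl⟩ := List.mem_map.1 hq
              exact hs i₀
            · exact hls q hq) hmor.2 (by
            rintro σ hσ hσl x (hx | ⟨c, hc, i, hi, hx⟩)
            · exact Or.inl (hY σ hσ (fun q hq => hσl q (List.mem_append_right _ hq)) x hx)
            · refine Or.inr ⟨c, hc, i, hi, ?_⟩
              have h1 : σ ∘ c = c := hσl (𝒰 i₀, c)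
                (List.mem_append_left _ (List.mem_map.2 ⟨c, hc, rfl⟩))
              rw [← h1, ← sum_elim_comp_equiv, hσ.mem_iff (hΦ i)]
              exact hx) (by
            intro x hx
            rcases hX' x hx with h | ⟨c, hc, i, hi, h⟩
            · exact Or.inl (Or.inl h)
            · rcases List.mem_cons.1 hc with rfl | hc
              · exact Or.inr ⟨i, hi, h⟩
              · exact Or.inl (Or.inr ⟨c, hc, i, hi, h⟩))
        obtain ⟨F₂, hF₂, hF₂'⟩ := ih' (fun c hc => has c (List.mem_cons_of_mem _ hc))
          (hmor.2.mono Set.subset_union_left) {x | ∀ σ ∈ F₁, σ ∘ x ∈ X'} hF₁'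
        refine ⟨F₁.flatMap fun σ => F₂.map fun τ => σ.comp τ, ?_, fun x hx => ?_⟩
        · intro ρ hρ
          obtain ⟨σ, hσ, hρ⟩ := List.mem_flatMap.1 hρ
          obtain ⟨τ, hτ, rfl⟩ := List.mem_map.1 hρ
          refine ⟨(hF₁ σ hσ).1.comp (hF₂ τ hτ).1, fun q hq => ?_⟩
          change σ ∘ (τ ∘ q.2) = q.2
          rw [(hF₂ τ hτ).2 q hq, (hF₁ σ hσ).2 q (List.mem_append_right _ hq)]
        · refine hF₂' x fun τ hτ σ hσ => ?_
          exact hx (σ.comp τ) (List.mem_flatMap.2 ⟨σ, hσ, List.mem_map.2 ⟨τ, hτ, rfl⟩⟩)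
    obtain ⟨n, hn⟩ := hcd i₀
    -- A Morley sequence of `𝒰 i₀` has to be put in front of the given `l`. A fresh sequence is
    -- built for the same ultrafilters, and its tail is then moved onto `l`.
    obtain ⟨as, hlen, has⟩ : ∃ as : List (μ → M), as.length = n ∧
        Mor L N (as.map (Prod.mk (𝒰 i₀)) ++ l) := by
      obtain ⟨m, hm, hm'⟩ := hM.exists_mor (L := L) (List.replicate n (𝒰 i₀) ++ l.map Prod.fst) hN
      obtain ⟨l₁, l₂, rfl, h₁, h₂⟩ := List.map_eq_append_iff.1 hm
      have himg : (Language.Equiv.refl L M) '' N = N := by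
        ext
        simp
      obtain ⟨τ, hτ, hτl, -⟩ := hM.exists_fixes_of_mor subset_rfl hN (l := l₂) (l' := l)
        (fun q hq => by
          have h3 : q.1 ∈ l.map Prod.fst := by
            rw [← h₂]
            exact List.mem_map.2 ⟨q, hq, rfl⟩
          obtain ⟨q', hq', h4⟩ := List.mem_map.1 h3
          rw [← h4]
          exact hls q' hq') (Fixes.refl N)
        (hm'.sublist (List.sublist_append_right _ _))
        (by rw [himg]; exact hl.mono Set.subset_union_left) h₂
      have h5 : ∀ q ∈ l₁, q.1 = 𝒰 i₀ := fun q hq =>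
        List.eq_of_mem_replicate (by rw [← h₁]; exact List.mem_map.2 ⟨q, hq, rfl⟩)
      refine ⟨l₁.map fun q => τ ∘ q.2, ?_, ?_⟩
      · rw [List.length_map, ← List.length_map (f := Prod.fst), h₁, List.length_replicate]
      · have h6 := hm'.image hτ (by
          intro q hq
          rcases List.mem_append.1 hq with hq | hq
          · rw [h5 q hq]
            exact hs i₀
          · have h3 : q.1 ∈ l.map Prod.fst := by
              rw [← h₂]
              exact List.mem_map.2 ⟨q, hq, rfl⟩
            obtain ⟨q', hq', h4⟩ := List.mem_map.1 h3
            rw [← h4]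
            exact hls q' hq')
        have h7 : τ '' N = N := by
          ext m
          constructor
          · rintro ⟨b, hb, rfl⟩
            rwa [hτ b hb]
          · exact fun hm => ⟨m, hm, hτ m hm⟩
        rw [h7, List.map_append, hτl] at h6
        convert! h6 using 2
        rw [List.map_map]
        refine List.map_congr_left fun q hq => ?_
        rw [h5 q hq]
        rfl
    have hmor : ∀ b ∈ as, Mor L N ((𝒰 i₀, b) :: l) := by
      intro b hb
      refine has.sublist ?_
      have h1 : [(𝒰 i₀, b)].Sublist (as.map (Prod.mk (𝒰 i₀))) :=
        List.singleton_sublist.2 (List.mem_map.2 ⟨b, hb, rfl⟩)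
      exact h1.append (List.Sublist.refl l)
    have hτ : ∀ b : {b // b ∈ as}, ∃ τ : M ≃[L] M, Fixes N τ ∧ τ ∘ a = b.1 ∧
        ∀ q ∈ l, τ ∘ q.2 = q.2 := fun b =>
      hM.exists_fixes_of_mor_cons hN (hs i₀) hls ⟨ha i₀, hl⟩ (hmor b.1 b.2)
    choose τ hτN hτa hτl using hτ
    -- Intersect the conjugates of `X` moving `a` to each member of `as`. A point outside `Y` cannot
    -- satisfy `Φ i₀` at every member, so it satisfies some `Φ i` with `i ∈ I` at one of them.
    obtain ⟨F, hF, hF'⟩ := remove as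
      (fun b hb i => (ha i).conj ⟨τ ⟨b, hb⟩, hτN _, hτa _⟩) has
      {x | ∀ b, (τ b).symm ∘ x ∈ X} (by
        intro x hx
        by_contra! hcon
        obtain ⟨hxY, hcon⟩ := hcon
        refine hn as hlen (has.sublist (List.sublist_append_left _ _)) ⟨x, fun b hb => ?_⟩
        have hback : ∀ y : ξ → M, τ ⟨b, hb⟩ ∘ ((τ ⟨b, hb⟩).symm ∘ y) = y := by
          intro y
          funext i
          simp
        rcases hX _ (hx ⟨b, hb⟩) with h | ⟨i, hi, h⟩
        · have := hY _ (hτN ⟨b, hb⟩) (hτl ⟨b, hb⟩) _ h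
          rw [hback] at this
          exact absurd this hxY
        · rw [← (hτN ⟨b, hb⟩).mem_iff (hΦ i), sum_elim_comp_equiv, hback, hτa] at h
          rcases Finset.mem_insert.1 hi with rfl | hi
          · exact h
          · exact absurd h (hcon b hb i hi))
    refine ⟨F.flatMap fun σ => as.attach.map fun b => (τ b).symm.comp σ, ?_, fun x hx => ?_⟩
    · intro ρ hρ
      obtain ⟨σ, hσ, hρ⟩ := List.mem_flatMap.1 hρ
      obtain ⟨b, -, rfl⟩ := List.mem_map.1 hρ
      refine ⟨(hτN b).symm.comp (hF σ hσ).1, fun q hq => ?_⟩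
      change (τ b).symm ∘ (σ ∘ q.2) = q.2
      rw [(hF σ hσ).2 q hq]
      conv_lhs => rw [← hτl b q hq]
      funext i
      simp
    · refine hF' x fun σ hσ b => ?_
      exact hx ((τ b).symm.comp σ) (List.mem_flatMap.2 ⟨σ, hσ, List.mem_map.2
        ⟨b, List.mem_attach _ _, rfl⟩⟩)

end Models

/-! ### Strict coheirs, and forking equals dividing over extension bases. -/

section ForkingAndDividing

variable {L : FirstOrder.Language.{u, v}} {T : L.Theory} {M : Type w} [L.Structure M]
  {κ : Cardinal.{w}}

/-- By the broom lemma, finitely many conjugates over `N` of the union of the `Ψ j` at `a` have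
empty intersection. This is a condition over `N` on finitely many tuples of `D`, so it is met inside
`N`, and `d` must miss the union at one of these tuples. -/
theorem IsMonster.exists_avoiding (hM : IsMonster T M κ) (hT : IsNTP2 L M) {μ ξ J : Type}
    [Finite μ] [Finite ξ] [Finite J] {N : Set M} (hN : #N < κ) (hTV : TarskiVaught L N)
    {a : μ → M} {D : Set (μ → M)} (hD : N.Definable L D) (haD : a ∈ D)
    {Ψ : J → Set (ξ ⊕ μ → M)} (hΨ : ∀ j, N.Definable L (Ψ j) ∧ ∃ k, Div L (Ψ j) a k N)
    (d : ξ → M) : ∃ z ∈ D, (∀ i, z i ∈ N) ∧ ∀ j, Sum.elim d z ∉ Ψ j := by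
  classical
  cases nonempty_fintype J
  by_contra! hcon
  choose 𝒰 hs hav hcd using fun j =>
    hM.exists_cd_ultrafilter hT hN hTV (hΨ j).1 (hΨ j).2.choose_spec
  obtain ⟨F, hF, hF'⟩ := hM.broom hN (fun j => (hΨ j).1) hs hcd Finset.univ hav (l := [])
    (by simp) trivial (X := {x | ∃ j, Sum.elim x a ∈ Ψ j}) (Y := ∅) (by simp)
    (fun x hx => Or.inr (by simpa using hx))
  have hU : N.Definable L {v : ξ ⊕ μ → M | ∃ j, v ∈ Ψ j} := by
    have := Set.definable_iUnion_of_finite fun j => (hΨ j).1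
    convert! this using 1
    ext v
    simp
  have hG : N.Definable L {w : Fin F.length × μ → M | (∀ i, w ∘ Prod.mk i ∈ D) ∧
      ¬ ∃ x ∈ (Set.univ : Set (ξ → M)), ∀ i ∈ (Finset.univ : Finset (Fin F.length)),
        Sum.elim x (fun q => w (i, q)) ∈ {v : ξ ⊕ μ → M | ∃ j, v ∈ Ψ j}} :=
    (definable_forall fun i => hD.preimage_comp (Prod.mk i)).inter
      (definable_consistent hU Set.definable_univ Finset.univ fun i q => (i, q)).compl
  obtain ⟨w, ⟨hwD, hw⟩, hwN⟩ := hTV _ _ hG (by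
    refine ⟨fun p => (F.get p.1).symm (a p.2),
      fun i => ((hF _ (F.get_mem i)).1.symm.mem_iff hD a).2 haD, ?_⟩
    rintro ⟨x, -, hx⟩
    refine hF' x fun σ hσ => ?_
    obtain ⟨i, rfl⟩ := List.get_of_mem hσ
    obtain ⟨j, hj⟩ := hx i (Finset.mem_univ i)
    refine ⟨j, ?_⟩
    rw [← (hF _ (F.get_mem i)).1.mem_iff (hΨ j).1, sum_elim_comp_equiv] at hj
    convert! hj using 2
    funext q
    simp)
  exact hw ⟨d, Set.mem_univ _, fun i _ => hcon _ (hwD i) fun q => hwN (i, q)⟩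

/-- Every type over a model has a strict coheir. -/
theorem IsMonster.exists_strict_ultrafilter (hM : IsMonster T M κ) (hT : IsNTP2 L M) {μ : Type}
    [Finite μ] {N : Set M} (hN : #N < κ) (hTV : TarskiVaught L N) (a : μ → M) :
    ∃ 𝒰 : Ultrafilter (μ → M), Supp N 𝒰 ∧ Av L 𝒰 N a ∧
      ∀ (γ : Type) [Finite γ] (d : γ → M) (Ψ : Set (γ ⊕ μ → M)) (k : ℕ), N.Definable L Ψ →
        Div L Ψ a k N → {z | Sum.elim d z ∉ Ψ} ∈ 𝒰 := by
  -- Generated by tp(a/N), by the tuples of `N`, and by avoidance of dividing formulas at fixed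
  -- tuples `d`. Properness is `IsMonster.exists_avoiding`.
  let F : Filter (μ → M) :=
    { sets := {S | ∃ D, N.Definable L D ∧ a ∈ D ∧ ∃ (ξ : Type) (_ : Finite ξ) (J : Type)
        (_ : Finite J) (d : ξ → M) (Ψ : J → Set (ξ ⊕ μ → M)),
        (∀ j, N.Definable L (Ψ j) ∧ ∃ k, Div L (Ψ j) a k N) ∧
        ∀ z ∈ D, (∀ i, z i ∈ N) → (∀ j, Sum.elim d z ∉ Ψ j) → z ∈ S}
      univ_sets := ⟨Set.univ, Set.definable_univ, Set.mem_univ _, Empty, inferInstance, Empty,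
        inferInstance, Empty.elim, Empty.elim, fun j => j.elim, fun z _ _ _ => Set.mem_univ z⟩
      sets_of_superset := by
        rintro S S' ⟨D, hD, ha, ξ, hξ, J, hJ, d, Ψ, hΨ, hS⟩ hSS
        exact ⟨D, hD, ha, ξ, hξ, J, hJ, d, Ψ, hΨ, fun z h1 h2 h3 => hSS (hS z h1 h2 h3)⟩
      inter_sets := by
        rintro S S' ⟨D, hD, ha, ξ, hξ, J, hJ, d, Ψ, hΨ, hS⟩
          ⟨D', hD', ha', ξ', hξ', J', hJ', d', Ψ', hΨ', hS'⟩
        refine ⟨D ∩ D', hD.inter hD', ⟨ha, ha'⟩, ξ ⊕ ξ', inferInstance, J ⊕ J', inferInstance,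
          Sum.elim d d', Sum.elim (fun j => (fun v => v ∘ Sum.map Sum.inl id) ⁻¹' Ψ j)
            (fun j => (fun v => v ∘ Sum.map Sum.inr id) ⁻¹' Ψ' j), ?_, ?_⟩
        · rintro (j | j)
          · obtain ⟨h1, k, h2⟩ := hΨ j
            refine ⟨h1.preimage_comp _, k, h2.map id rfl (fun _ _ => rfl) (fun x => x ∘ Sum.inl) ?_⟩
            intro x e _ hx
            change _ ∘ _ ∈ Ψ j at hx
            rwa [Sum.elim_comp_map] at hx
          · obtain ⟨h1, k, h2⟩ := hΨ' j
            refine ⟨h1.preimage_comp _, k, h2.map id rfl (fun _ _ => rfl) (fun x => x ∘ Sum.inr) ?_⟩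
            intro x e _ hx
            change _ ∘ _ ∈ Ψ' j at hx
            rwa [Sum.elim_comp_map] at hx
        · intro z hz hzN hzΨ
          refine ⟨hS z hz.1 hzN fun j hj => hzΨ (Sum.inl j) ?_,
            hS' z hz.2 hzN fun j hj => hzΨ (Sum.inr j) ?_⟩
          · change _ ∘ _ ∈ Ψ j
            rwa [Sum.elim_comp_map]
          · change _ ∘ _ ∈ Ψ' j
            rwa [Sum.elim_comp_map] }
  have hne : F.NeBot := by
    rw [← Filter.empty_mem_iff_bot.not.trans Iff.rfl |>.trans Filter.neBot_iff.symm]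
    rintro ⟨D, hD, ha, ξ, hξ, J, hJ, d, Ψ, hΨ, hS⟩
    obtain ⟨z, hzD, hzN, hz⟩ := hM.exists_avoiding hT hN hTV hD ha hΨ d
    exact hS z hzD hzN hz
  have hFU : ∀ S ∈ F, S ∈ Ultrafilter.of F := fun S hS => Ultrafilter.of_le F hS
  have hDU : ∀ D, N.Definable L D → a ∈ D → D ∈ Ultrafilter.of F := fun D hD ha =>
    hFU _ ⟨D, hD, ha, Empty, inferInstance, Empty, inferInstance, Empty.elim, Empty.elim,
      fun j => j.elim, fun z hz _ _ => hz⟩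
  refine ⟨Ultrafilter.of F, ?_, fun D hD hU => by_contra fun ha =>
    Ultrafilter.compl_mem_iff_notMem.1 (hDU Dᶜ hD.compl ha) hU, ?_⟩
  · exact hFU _ ⟨Set.univ, Set.definable_univ, Set.mem_univ _, Empty, inferInstance, Empty,
      inferInstance, Empty.elim, Empty.elim, fun j => j.elim, fun z _ hz _ => hz⟩
  · intro γ _ d Ψ k hΨ hk
    exact hFU _ ⟨Set.univ, Set.definable_univ, Set.mem_univ _, γ, inferInstance, Unit,
      inferInstance, d, fun _ => Ψ, fun _ => ⟨hΨ, k, hk⟩, fun z _ _ hz => hz ()⟩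

/-- Automorphisms moving `a ∘ g` move all of `a`, so additional parameters do no harm. -/
theorem Div.of_comp {ξ μ ν : Type*} {A : Set M} {Φ : Set (ξ ⊕ ν → M)} {a : μ → M} {g : ν → μ}
    {k : ℕ} (h : Div L Φ (a ∘ g) k A) :
    Div L ((fun v : ξ ⊕ μ → M => v ∘ Sum.map id g) ⁻¹' Φ) a k A := by
  obtain ⟨s, hs, hk⟩ := h
  choose σ hσ hσs using hs
  refine ⟨fun i => σ i ∘ a, fun i => ⟨σ i, hσ i, rfl⟩, hk.map id fun x i hx => ?_⟩
  change _ ∘ _ ∈ Φ at hx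
  rw [Sum.elim_comp_map] at hx
  rwa [← hσs]

/-- The formulas witnessing forking can be taken with a common tuple of parameters. -/
theorem IsMonster.exists_params_of_forksSet (hM : IsMonster T M κ) {ξ : Type x} {A : Set M}
    (hA : #A < κ) {X : Set (ξ → M)} (h : ForksSet L A X) :
    ∃ (J : Type) (_ : Finite J) (ν : Type) (_ : Finite ν) (e : ν → M) (Φ : J → Set (ξ ⊕ ν → M)),
      (∀ j, A.Definable L (Φ j) ∧ ∃ k, Div L (Φ j) e k A) ∧
      ∀ x ∈ X, ∃ j, Sum.elim x e ∈ Φ j := by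
  obtain ⟨J, hJ, ψ, hψ, hcov⟩ := h
  refine ⟨J, hJ, Σ j, Fin (ψ j).arity, inferInstance, fun q => (ψ q.1).params q.2,
    fun j => (fun v => v ∘ Sum.map id (Sigma.mk j)) ⁻¹' {v | (ψ j).formula.Realize v},
    fun j => ⟨(definable_realize _ A).preimage_comp _, ?_⟩, fun x hx => ?_⟩
  · obtain ⟨k, s, hs, hk⟩ := hψ j
    refine ⟨k, Div.of_comp (g := Sigma.mk j) ⟨s, fun i => ?_, hk⟩⟩
    exact ((hM.sameType_iff_conj hA).1 (hs i)).symm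
  · obtain ⟨j, hj⟩ := hcov x hx
    refine ⟨j, ?_⟩
    change (ψ j).formula.Realize (_ ∘ _)
    rw [Sum.elim_comp_map]
    exact hj

/-- Forking implies dividing over models of an `NTP₂` theory. -/
theorem IsMonster.div_of_forksSet_model (hM : IsMonster T M κ) (hT : IsNTP2 L M) {ξ δ : Type}
    [Finite ξ] [Finite δ] {N : Set M} (hN : #N < κ) (hTV : TarskiVaught L N)
    {ρ : Set (ξ ⊕ δ → M)} (hρ : N.Definable L ρ) {d : δ → M}
    (h : ForksSet L N {x : ξ → M | Sum.elim x d ∈ ρ}) : ∃ k, Div L ρ d k N := by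
  classical
  obtain ⟨J, _, ν, _, e, Φ, hΦ, hcov⟩ := hM.exists_params_of_forksSet hN h
  cases nonempty_fintype J
  let a : δ ⊕ ν → M := Sum.elim d e
  let Φ' : J → Set (ξ ⊕ (δ ⊕ ν) → M) := fun j =>
    (fun v => v ∘ Sum.map id Sum.inr) ⁻¹' Φ j
  have hΦ' : ∀ j, N.Definable L (Φ' j) := fun j => (hΦ j).1.preimage_comp _
  have hdiv : ∀ j, ∃ k, Div L (Φ' j) a k N := fun j => by
    obtain ⟨k, hk⟩ := (hΦ j).2
    exact ⟨k, Div.of_comp (g := Sum.inr) hk⟩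
  obtain ⟨𝒰, hs, hav, hstrict⟩ := hM.exists_strict_ultrafilter hT hN hTV a
  -- Strictness says that the type of the earlier rows over `N` and `c` does not divide over `N`.
  -- Dividing at `c` thus survives over those rows, and one ultrafilter serves all `j`.
  have hcd : ∀ j, CD L (Φ' j) 𝒰 N := by
    intro j
    obtain ⟨k, hk⟩ := hdiv j
    refine hM.cd_of_rows hT hN hs (hΦ' j) (k := k) fun t ht _ => ?_
    have htlt : #(⋃ c ∈ t, Set.range c : Set M) < κ :=
      hM.countable_lt (ht.biUnion fun y _ => Set.countable_range y)
    obtain ⟨c, hc⟩ := hM.exists_av (L := L) 𝒰 (hM.union_lt hN htlt)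
    have hac : Conj L N a c := hM.conj_of_av hN hav (hc.mono Set.subset_union_left)
    have hnd : NDset L N (⋃ c ∈ t, Set.range c) c := by
      intro γ _ b hb Ψ k' hΨ hk' hmem
      refine hc {z | Sum.elim b z ∉ Ψ} ?_ (hstrict γ b Ψ k' hΨ (hk'.conj hac.symm)) hmem
      exact (definable_section_left hΨ Set.subset_union_left fun i => Or.inr (hb i)).compl
    obtain ⟨s, hs, hk⟩ := hM.div_union hN htlt hnd (hΦ' j) (hk.conj hac)
    exact ⟨s, hk, fun i => hc.conj (hs i)⟩
  choose n hn using hcd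
  obtain ⟨u, hu⟩ := hM.exists_morley_seq 𝒰 hN
  have hconj : ∀ i, Conj L N a (u i) := fun i =>
    hM.conj_of_av hN hav ((hu i).mono Set.subset_union_left)
  -- Pigeonhole constant: among this many instances of `ρ` with a common solution, some disjunct `j`
  -- occurs more than `n j` times along the Morley sequence, which is too often.
  refine ⟨Fintype.card J * (Finset.univ.sup n) + 1, fun i => u i ∘ Sum.inl,
    fun i => (hconj i).comp Sum.inl, ?_⟩
  rintro I hI ⟨x, hx⟩
  have hj : ∀ i ∈ I, ∃ j, Sum.elim x (u i) ∈ Φ' j := by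
    intro i hi
    obtain ⟨τ, hτ, hτa⟩ := (hconj i).symm
    have h1 := (hτ.mem_iff hρ _).2 (hx i hi)
    rw [sum_elim_comp_equiv, ← Function.comp_assoc, hτa] at h1
    obtain ⟨j, hj⟩ := hcov (τ ∘ x) h1
    refine ⟨j, (hτ.mem_iff (hΦ' j) _).1 ?_⟩
    rw [sum_elim_comp_equiv, hτa]
    change _ ∘ _ ∈ Φ j
    rwa [Sum.elim_comp_map]
  have hJ : Nonempty J := by
    obtain ⟨i, hi⟩ : I.Nonempty := Finset.card_pos.1 (by omega)
    exact ⟨(hj i hi).choose⟩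
  choose! col hcol using hj
  obtain ⟨j, -, hj⟩ := Finset.exists_lt_card_fiber_of_mul_lt_card_of_maps_to (s := I)
    (t := Finset.univ) (f := col) (n := Finset.univ.sup n) (fun _ _ => Finset.mem_univ _)
    (by rw [Finset.card_univ, hI]; exact Nat.lt_succ_self _)
  obtain ⟨I', hI', hcard⟩ := Finset.exists_subset_card_eq
    ((Finset.le_sup (f := n) (Finset.mem_univ j)).trans hj.le)
  have hmem : ∀ i, i ∈ (List.range (I'.sup id + 1)).filter (fun i => decide (i ∈ I')) ↔ i ∈ I' := by
    intro i
    rw [List.mem_filter, List.mem_range, decide_eq_true_eq]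
    exact ⟨fun h => h.2, fun h => ⟨Nat.lt_succ_of_le (Finset.le_sup (f := id) h), h⟩⟩
  refine hn j (((List.range (I'.sup id + 1)).filter (fun i => decide (i ∈ I'))).map u) ?_ ?_
    ⟨x, fun c hc => ?_⟩
  · rw [List.length_map, ← List.toFinset_card_of_nodup (List.nodup_range.filter _), ← hcard]
    congr 1
    ext i
    rw [List.mem_toFinset, hmem]
  · rw [List.map_map]
    exact (mor_of_seq (I'.sup id + 1) fun i _ => hu i).sublist (List.filter_sublist.map _)
  · obtain ⟨i, hi, rfl⟩ := List.mem_map.1 hc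
    have := Finset.mem_filter.1 (hI' ((hmem i).1 hi))
    rw [← this.2]
    exact hcol i this.1

theorem TarskiVaught.image {N : Set M} (h : TarskiVaught L N) (σ : M ≃[L] M) :
    TarskiVaught L (σ '' N) := by
  rintro μ _ D hD ⟨c, hc⟩
  have h1 := definable_image_equiv σ.symm hD
  have h2 : σ.symm '' (σ '' N) = N := by
    rw [Set.image_image]
    simp
  rw [h2] at h1
  have hσ : ∀ v : μ → M, σ.symm.symm ∘ v = σ ∘ v := fun v => rfl
  obtain ⟨d, hd, hdN⟩ := h μ _ h1 ⟨σ.symm ∘ c, by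
    change σ.symm.symm ∘ (σ.symm ∘ c) ∈ D
    rw [hσ]
    convert! hc using 1
    funext i
    simp⟩
  exact ⟨σ ∘ d, hd, fun i => ⟨d i, hdN i, rfl⟩⟩

theorem ForksSet.comap {β γ : Type*} {A : Set M} {X : Set (γ → M)} (h : ForksSet L A X)
    (g : γ → β) : ForksSet L A ((fun v : β → M => v ∘ g) ⁻¹' X) := by
  obtain ⟨J, hJ, ψ, hψ, hcov⟩ := h
  have key : ∀ j (v : β → M) (c : Fin (ψ j).arity → M),
      ((ψ j).formula.relabel (Sum.map g id)).Realize (Sum.elim v c) ↔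
        (ψ j).formula.Realize (Sum.elim (v ∘ g) c) := by
    intro j v c
    rw [Language.Formula.realize_relabel]
    have : Sum.elim v c ∘ Sum.map g id = Sum.elim (v ∘ g) c := by
      funext i
      rcases i with i | i <;> rfl
    rw [this]
  refine ⟨J, hJ, fun j => ⟨(ψ j).arity, (ψ j).formula.relabel (Sum.map g id), (ψ j).params⟩,
    fun j => ?_, fun v hv => ?_⟩
  · obtain ⟨k, s, hs, hk⟩ := hψ j
    refine ⟨k, s, hs, ?_⟩
    rintro I hI ⟨v, hv⟩
    exact hk I hI ⟨v ∘ g, fun i hi => (key j v _).1 (hv i hi)⟩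
  · obtain ⟨j, hj⟩ := hcov _ hv
    exact ⟨j, (key j v _).2 hj⟩

/-- Forking of a definable set is witnessed in finitely many variables. -/
theorem ForksSet.exists_finite [Nonempty M] {β : Type*} {A C : Set M} {X : Set (β → M)}
    (hX : C.Definable L X) (h : ForksSet L A X) :
    ∃ (m : ℕ) (g : Fin m → β), C.Definable L ((fun v : β → M => v ∘ g) '' X) ∧
      ForksSet L A ((fun v : β → M => v ∘ g) '' X) := by
  classical
  obtain ⟨J, _, ψ, hψ, hcov⟩ := h
  cases nonempty_fintype J
  choose V E hE hV using fun j => exists_finite_support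
    (definable_realize (ψ j).formula (∅ : Set M))
  let W : Finset β := Finset.univ.biUnion fun j => (V j).toLeft
  let g : Fin W.card → β := fun i => W.equivFin.symm i
  have hg : Function.Injective g := Subtype.val_injective.comp W.equivFin.symm.injective
  have hsurj : ∀ b ∈ W, ∃ i, g i = b := fun b hb => ⟨W.equivFin ⟨b, hb⟩, by simp [g]⟩
  have hf : ∀ j, ∃ f : V j → Fin W.card ⊕ Fin (ψ j).arity, ∀ i, Sum.map g id (f i) = i.1 := by
    intro j
    refine ⟨fun i => Classical.choose (p := fun t => Sum.map g id t = i.1) ?_, fun i =>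
      Classical.choose_spec (p := fun t => Sum.map g id t = i.1) _⟩
    obtain ⟨i | i, hi⟩ := i
    · obtain ⟨t, ht⟩ := hsurj i (Finset.mem_biUnion.2 ⟨j, Finset.mem_univ j,
        Finset.mem_toLeft.2 hi⟩)
      exact ⟨Sum.inl t, by simp [ht]⟩
    · exact ⟨Sum.inr i, rfl⟩
  choose f hf using hf
  choose φ hφ using fun j => Set.empty_definable_iff.1 ((hE j).preimage_comp (f j))
  have key : ∀ j (v : β → M) (c : Fin (ψ j).arity → M),
      (φ j).Realize (Sum.elim (v ∘ g) c) ↔ (ψ j).formula.Realize (Sum.elim v c) := by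
    intro j v c
    have h1 : (φ j).Realize (Sum.elim (v ∘ g) c) ↔ Sum.elim (v ∘ g) c ∘ f j ∈ E j := by
      have : Sum.elim (v ∘ g) c ∈ (fun w => w ∘ f j) ⁻¹' E j ↔
        Sum.elim (v ∘ g) c ∈ {w | (φ j).Realize w} := by rw [hφ j]
      exact this.symm
    have h2 : (ψ j).formula.Realize (Sum.elim v c) ↔ _ := hV j (Sum.elim v c)
    rw [h1, h2]
    have : Sum.elim (v ∘ g) c ∘ f j = fun i : V j => Sum.elim v c i := by
      funext i
      rw [← hf j i, Function.comp]
      rcases f j i with t | t <;> rfl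
    rw [this]
  refine ⟨W.card, g, definable_image_comp hX g, J, inferInstance,
    fun j => ⟨(ψ j).arity, φ j, (ψ j).params⟩, fun j => ?_, ?_⟩
  · obtain ⟨k, s, hs, hk⟩ := hψ j
    refine ⟨k, s, hs, ?_⟩
    rintro I hI ⟨x, hx⟩
    refine hk I hI ⟨Function.extend g x fun _ => Classical.arbitrary M, fun i hi => ?_⟩
    have : (Function.extend g x fun _ => Classical.arbitrary M) ∘ g = x :=
      Function.extend_comp hg _ _
    rw [Set.mem_ofPred_eq, ← key, this]
    exact hx i hi
  · rintro _ ⟨v, hv, rfl⟩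
    obtain ⟨j, hj⟩ := hcov v hv
    exact ⟨j, (key j v _).2 hj⟩

/-- Variables may be infinite in number and live in any universe, while the tree and dividing
arguments use finite tuples. Forking of a definable set is already visible in finitely many
coordinates. -/
theorem nf_iff_forall_comp [Nonempty M] {β : Type*} {A B : Set M} {a : β → M} :
    NF L A a B ↔ ∀ (m : ℕ) (g : Fin m → β), NF L A (a ∘ g) B := by
  constructor
  · intro h m g X hX ha hf
    exact h _ (hX.preimage_comp g) ha (hf.comap g)
  · intro h X hX ha hf
    obtain ⟨m, g, hd, hf'⟩ := hf.exists_finite hX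
    exact h m g _ hd ⟨a, ha, rfl⟩ hf'

theorem nf_iff_forall_range {β : Type*} {A B : Set M} {a : β → M} :
    NF L A a B ↔ ∀ (n : ℕ) (b : Fin n → M), (∀ i, b i ∈ B) → NF L A a (Set.range b) := by
  constructor
  · intro h n b hb
    refine h.mono (Set.union_subset_union_right _ ?_)
    rintro _ ⟨i, rfl⟩
    exact hb i
  · intro h X hX ha
    obtain ⟨n, b, E, hb, hE, hXE⟩ := exists_finite_section hX
    refine h n b hb X ?_ ha
    have := definable_section_left hE (B := A ∪ Set.range b) Set.subset_union_left
      fun i => Or.inr ⟨i, rfl⟩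
    convert! this using 1
    ext v
    exact hXE v

/-- The definition concerns finitely many variables; the passage to infinite tuples is needed in
order to move an enumerated model. -/
theorem IsExtensionBase.nf_empty [Nonempty M] {A : Set M} (hE : IsExtensionBase L A)
    {β : Type*} (a : β → M) : NF L A a ∅ := by
  rw [nf_iff_forall_comp]
  intro m g X hX ha hf
  rw [Set.union_empty] at hX
  obtain ⟨θ, hθ, rfl⟩ := exists_pformula hX
  obtain ⟨q, -, hq, hqf⟩ := hE m {θ | θ.Over A ∧ θ.Realize (a ∘ g)} ⟨fun θ hθ => hθ.1, by
    intro F hF _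
    refine ⟨a ∘ g, fun X hX => ?_⟩
    obtain ⟨θ, hθ, rfl⟩ := hF hX
    exact hθ.2, by
    intro θ hθ
    by_cases h : θ.Realize (a ∘ g)
    · exact Or.inl ⟨hθ, h⟩
    · exact Or.inr ⟨hθ, h⟩⟩
  exact hqf θ (hq ⟨hθ, ha⟩) (forks_iff.2 hf)

/-- Forking implies dividing over extension bases of an `NTP₂` theory. -/
theorem IsMonster.div_of_forksSet [Nonempty M] (hM : IsMonster T M κ) (hT : IsNTP2 L M)
    {ξ δ : Type} [Finite ξ] [Finite δ] {A : Set M} (hA : #A < κ) (hE : IsExtensionBase L A)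
    {ρ : Set (ξ ⊕ δ → M)} (hρ : A.Definable L ρ) {d : δ → M}
    (h : ForksSet L A {x : ξ → M | Sum.elim x d ∈ ρ}) : ∃ k, Div L ρ d k A := by
  obtain ⟨J, _, ν, _, e, Φ, hΦ, hcov⟩ := hM.exists_params_of_forksSet hA h
  obtain ⟨N, hAN, hN, hTV⟩ := hM.exists_tarskiVaught hA
  have hempty : #(∅ : Set M) < κ := hM.countable_lt Set.countable_empty
  -- The copy N' of the model is placed so that tp(N'/Ae) does not fork over `A`. The covering
  -- formulas then still divide over N', the case of models gives dividing of `ρ` over N', and this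
  -- descends to `A`.
  obtain ⟨c, ⟨σ, hσ, hσc⟩, hc⟩ := hM.exists_conj_NF_of_small (μ := N)
    (by simpa using hN) hA hempty (hM.range_lt e) (hE.nf_empty fun i : N => (i : M))
  have hnd : NDset L A (Set.range c) e := by
    have := NF.ndset (C := ∅) (by rwa [Set.empty_union])
    rwa [Set.union_empty] at this
  have hrange : Set.range c = σ '' N := by
    rw [← hσc, Set.range_comp, Subtype.range_coe]
  rw [hrange] at hnd
  have hN' : #(σ '' N) < κ := Cardinal.mk_image_le.trans_lt hN
  have hAN' : A ⊆ σ '' N := fun m hm => ⟨m, hAN hm, hσ m (Or.inl hm)⟩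
  have hθ : ∀ j, ∃ θ : PFormula L M ξ, θ.Divides (σ '' N) ∧
      θ.solutions = {x | Sum.elim x e ∈ Φ j} := by
    intro j
    obtain ⟨k, hk⟩ := (hΦ j).2
    refine Div.exists_pformula (k := k) subset_rfl ((hΦ j).1.mono hAN') ?_
    have := hM.div_union hA hN' hnd (hΦ j).1 hk
    rwa [Set.union_eq_self_of_subset_left hAN'] at this
  choose θ hθ hsol using hθ
  obtain ⟨k, hk⟩ := hM.div_of_forksSet_model hT hN' (hTV.image σ) (hρ.mono hAN') (d := d)
    ⟨J, inferInstance, θ, hθ, fun x hx => by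
      obtain ⟨j, hj⟩ := hcov x hx
      refine ⟨j, ?_⟩
      have : x ∈ (θ j).solutions := by rwa [hsol]
      exact this⟩
  exact ⟨k, hk.mono hAN'⟩

theorem IsMonster.nf_of_ndset [Nonempty M] (hM : IsMonster T M κ) (hT : IsNTP2 L M)
    {ξ δ : Type} [Finite ξ] [Finite δ] {A : Set M} (hA : #A < κ) (hE : IsExtensionBase L A)
    {a : δ → M} {b : ξ → M} (h : NDset L A (Set.range b) a) : NF L A b (Set.range a) := by
  intro X hX hb hf
  obtain ⟨E, hEd, hXE⟩ := exists_section_of_definable hX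
  have hel : ∀ w : ξ → M, Sum.elim w a ∈ (fun v => v ∘ Sum.swap) ⁻¹' E ↔ w ∈ X := by
    intro w
    rw [hXE]
    have : Sum.elim w a ∘ Sum.swap = Sum.elim a w := by
      funext i
      rcases i with i | i <;> rfl
    rw [Set.mem_preimage, this]
  obtain ⟨k, hk⟩ := hM.div_of_forksSet hT hA hE (ρ := (fun v => v ∘ Sum.swap) ⁻¹' E)
    (hEd.preimage_comp _) (d := a) (hf.mono fun x hx => (hel x).1 hx)
  exact h ξ b (fun i => ⟨i, rfl⟩) _ k (hEd.preimage_comp _) hk ((hel b).2 hb)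

end ForkingAndDividing

/-! ### Reduction to finitely many variables, symmetry and transitivity. -/

section SimpleTypes

variable {L : FirstOrder.Language.{u, v}} {T : L.Theory} {M : Type w} [L.Structure M]
  {κ : Cardinal.{w}}

/-- The projection to the variables `g` of the partial type `p` over `A`. -/
def projType {α β : Type*} (A : Set M) (p : Set (PFormula L M α)) (g : β → α) :
    Set (PFormula L M β) :=
  {θ | θ.Over A ∧ ∃ F ⊆ p, F.Finite ∧ ∀ a : α → M, (∀ ψ ∈ F, ψ.Realize a) → θ.Realize (a ∘ g)}

theorem isOver_projType {α β : Type*} (A : Set M) (p : Set (PFormula L M α)) (g : β → α) :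
    IsOver (projType A p g) A := fun _ h => h.1

theorem Realizes.projType {α β : Type*} {A : Set M} {p : Set (PFormula L M α)} {a : α → M}
    (h : Realizes a p) (g : β → α) : Realizes (a ∘ g) (projType A p g) := by
  rintro θ ⟨-, F, hF, -, hθ⟩
  exact hθ a fun ψ hψ => h ψ (hF hψ)

/-- A tree for the projection becomes a tree for `p` through dummy variables. To lift a solution of
a branch, note that the projection of a finite part of `p` is itself a formula of the projected
type. -/
theorem IsSimpleType.projType [Nonempty M] {α β : Type*} [Finite β] {A : Set M}
    {p : Set (PFormula L M α)} (hpA : IsOver p A) (hp : IsSimpleType p) (g : β → α) :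
    IsSimpleType (projType A p g) := by
  rintro ⟨m, φ, a, k, hrow, hpath⟩
  have key : ∀ (b : α → M) (c : Fin m → M),
      (φ.relabel (Sum.map g id)).Realize (Sum.elim b c) ↔ φ.Realize (Sum.elim (b ∘ g) c) := by
    intro b c
    rw [Language.Formula.realize_relabel, Sum.elim_comp_map, Function.comp_id]
  refine hp ⟨m, φ.relabel (Sum.map g id), a, k, ?_, ?_⟩
  · rintro η I hI ⟨b, hb⟩
    exact hrow η I hI ⟨b ∘ g, fun i hi => (key _ _).1 (hb i hi)⟩
  · intro f F hF hFfin
    have : ∃ (n : ℕ) (G : Set (PFormula L M α)), G ⊆ p ∧ G.Finite ∧ ∀ b : α → M,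
        (∀ i < n, φ.Realize (Sum.elim (b ∘ g) (a (branch f i)))) → (∀ ψ ∈ G, ψ.Realize b) →
        b ∈ ⋂₀ F := by
      induction F, hFfin using Set.Finite.induction_on with
      | empty => exact ⟨0, ∅, Set.empty_subset _, Set.finite_empty, fun _ _ _ => by simp⟩
      | @insert X F _ _ ih =>
        obtain ⟨n, G, hG, hGfin, h⟩ := ih ((Set.subset_insert _ _).trans hF)
        rcases hF (Set.mem_insert X F) with ⟨i, rfl⟩ | ⟨ψ, hψ, rfl⟩
        · refine ⟨max n (i + 1), G, hG, hGfin, fun b hb hb' => ?_⟩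
          rw [Set.sInter_insert]
          exact ⟨(key _ _).2 (hb i (lt_of_lt_of_le (Nat.lt_succ_self i) (le_max_right _ _))),
            h b (fun j hj => hb j (hj.trans_le (le_max_left _ _))) hb'⟩
        · refine ⟨n, insert ψ G, Set.insert_subset hψ hG, hGfin.insert ψ, fun b hb hb' => ?_⟩
          rw [Set.sInter_insert]
          exact ⟨hb' ψ (Set.mem_insert _ _), h b hb fun θ hθ => hb' θ (Set.mem_insert_of_mem _ hθ)⟩
    obtain ⟨n, G, hG, hGfin, h⟩ := this
    have hdef : A.Definable L (⋂₀ (PFormula.solutions '' G)) :=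
      definable_sInter_of_finite (hGfin.image _) (by
        rintro _ ⟨ψ, hψ, rfl⟩
        exact PFormula.Over.definable (hpA ψ (hG hψ)))
    obtain ⟨θ, hθ, hsol⟩ := exists_pformula (definable_image_comp hdef g)
    have hθp : θ ∈ ModelTheory.projType A p g := by
      refine ⟨hθ, G, hG, hGfin, fun b hb => ?_⟩
      have : b ∘ g ∈ θ.solutions := by
        rw [hsol]
        refine ⟨b, ?_, rfl⟩
        rintro _ ⟨ψ, hψ, rfl⟩
        exact hb ψ hψ
      exact this
    obtain ⟨y, hy⟩ := hpath f (insert θ.solutions ((fun i => {b : β → M | φ.Realize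
        (Sum.elim b (a (branch f i)))}) '' Set.Iio n)) (by
      refine Set.insert_subset (Or.inr ⟨θ, hθp, rfl⟩) ?_
      rintro _ ⟨i, -, rfl⟩
      exact Or.inl ⟨i, rfl⟩) (((Set.finite_Iio n).image _).insert _)
    have hy' := hy _ (Set.mem_insert _ _)
    rw [hsol] at hy'
    obtain ⟨b, hb, rfl⟩ := hy'
    exact ⟨b, h b (fun i hi => hy _ (Set.mem_insert_of_mem _ ⟨i, hi, rfl⟩)) fun ψ hψ =>
      hb _ ⟨ψ, hψ, rfl⟩⟩

/-- A type is co-simple if all its projections to finitely many variables are. -/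
theorem isCoSimple_of_projType {α : Type*} {A : Set M} {p : Set (PFormula L M α)}
    (h : ∀ (m : ℕ) (g : Fin m → α), IsCoSimpleType (projType A p g) A) : IsCoSimpleType p A := by
  classical
  rintro ⟨n, r, φ, a, hφ, ha, k, hrow, hpath⟩
  obtain ⟨V, E, hE, hV⟩ := exists_finite_support hφ.definable
  let W : Finset α := V.toRight.image Prod.snd
  let g : Fin W.card → α := fun i => W.equivFin.symm i
  have hsurj : ∀ b ∈ W, ∃ i, g i = b := fun b hb => ⟨W.equivFin ⟨b, hb⟩, by simp [g]⟩
  have hf : ∀ t : V, ∃ s : Fin n ⊕ (Fin r × Fin W.card), Sum.map id (Prod.map id g) s = t.1 := by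
    rintro ⟨i | ⟨j, i⟩, hi⟩
    · exact ⟨Sum.inl i, rfl⟩
    · obtain ⟨t, ht⟩ := hsurj i (Finset.mem_image.2 ⟨(j, i), Finset.mem_toRight.2 hi, rfl⟩)
      exact ⟨Sum.inr (j, t), by simp [ht]⟩
  choose f hf using hf
  obtain ⟨θ, hθ, hsol⟩ := exists_pformula (hE.preimage_comp f)
  have key : ∀ (b : Fin n → M) (c : Fin r × α → M),
      θ.Realize (Sum.elim b (c ∘ Prod.map id g)) ↔ φ.Realize (Sum.elim b c) := by
    intro b c
    have h1 : θ.Realize (Sum.elim b (c ∘ Prod.map id g)) ↔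
        Sum.elim b (c ∘ Prod.map id g) ∈ θ.solutions := Iff.rfl
    have h2 : φ.Realize (Sum.elim b c) ↔ _ := hV (Sum.elim b c)
    rw [h1, h2, hsol, Set.mem_preimage]
    have : Sum.elim b (c ∘ Prod.map id g) ∘ f = fun i : V => Sum.elim b c i := by
      funext i
      rw [← hf i, Function.comp]
      rcases f i with t | t <;> rfl
    rw [this]
  refine h W.card g ⟨n, r, θ, fun η => a η ∘ Prod.map id g, hθ,
    fun η j => (ha η j).projType g, k, ?_, ?_⟩
  · simpa only [key] using hrow
  · simpa only [key, Set.image_empty] using hpath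

theorem IsMonster.isCoSimple [Nonempty M] (hM : IsMonster T M κ) (hT : IsNTP2 L M) {α : Type x}
    {A : Set M} (hA : #A < κ) {p : Set (PFormula L M α)} (hpA : IsOver p A)
    (hp : IsSimpleType p) : IsCoSimpleType p A :=
  isCoSimple_of_projType fun _ g =>
    hM.isCoSimple_of_finite hT hA (isOver_projType A p g) (hp.projType hpA g)

/-- Tuples of the same sort in an empty structure coincide, so a row repeats one formula, which is
consistent along a branch. -/
theorem isCoSimple_of_isEmpty [IsEmpty M] {α : Type*} (A : Set M) (p : Set (PFormula L M α)) :
    IsCoSimpleType p A := by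
  rintro ⟨n, r, φ, a, -, -, k, hrow, hpath⟩
  obtain ⟨b, hb⟩ := hpath (fun _ => 0) {{b | φ.Realize (Sum.elim b (a []))}} (by
    rintro _ rfl
    exact Or.inl ⟨0, rfl⟩) (Set.finite_singleton _)
  refine hrow [] (Finset.range k) (Finset.card_range k) ⟨b, fun i _ => ?_⟩
  change φ.Realize (Sum.elim b (a ([] ++ [i])))
  rw [Subsingleton.elim (a ([] ++ [i])) (a [])]
  exact hb _ rfl

theorem nonForking_of_isEmpty [IsEmpty M] {α : Type*} (a : α → M) (A B : Set M) :
    NonForking L a A B := by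
  rintro θ - ha ⟨n, ψ, hψ, hcov⟩
  obtain ⟨j, hj⟩ := hcov a ha
  obtain ⟨k, c, -, hk⟩ := hψ j
  refine hk (Finset.range k) (Finset.card_range k) ⟨a, fun i _ => ?_⟩
  change (ψ j).formula.Realize (Sum.elim a (c i))
  rw [Subsingleton.elim (c i) (ψ j).params]
  exact hj

/-- After restriction to finite subtuples, co-simplicity handles one direction and simplicity the
other; the extension base upgrades nondividing to nonforking. -/
theorem IsMonster.nf_symm [Nonempty M] (hM : IsMonster T M κ) (hT : IsNTP2 L M) {α : Type x}
    {A : Set M} (hA : #A < κ) (hE : IsExtensionBase L A) {p : Set (PFormula L M α)}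
    (hpA : IsOver p A) (hp : IsSimpleType p) {a : α → M} (ha : Realizes a p) {β : Type y}
    (b : β → M) : NF L A a (Set.range b) ↔ NF L A b (Set.range a) := by
  constructor
  · intro h
    rw [nf_iff_forall_comp]
    intro n g
    rw [nf_iff_forall_range]
    intro m a' ha'
    choose f hf using ha'
    obtain rfl : a ∘ f = a' := funext hf
    refine hM.nf_of_ndset hT hA hE (hM.ndset_of_coSimple hA (isOver_projType A p f)
      (hM.isCoSimple_of_finite hT hA (isOver_projType A p f) (hp.projType hpA f))
      (ha.projType f) ?_)
    exact (nf_iff_forall_comp.1 h m f).mono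
      (Set.union_subset_union_right _ (Set.range_comp_subset_range _ _))
  · intro h
    rw [nf_iff_forall_comp]
    intro n f
    rw [nf_iff_forall_range]
    intro m b' hb'
    choose g hg using hb'
    obtain rfl : b ∘ g = b' := funext hg
    refine hM.nf_of_ndset hT hA hE (hM.ndset_of_simple hA (isOver_projType A p f)
      (hp.projType hpA f) (ha.projType f) ?_)
    exact (nf_iff_forall_comp.1 h m g).mono
      (Set.union_subset_union_right _ (Set.range_comp_subset_range _ _))

/-- The argument is carried out on the other side: nonforking of `a` is turned into nondividing over
`a`, composed there, and turned back by symmetry. -/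
theorem IsMonster.nf_trans [Nonempty M] (hM : IsMonster T M κ) (hT : IsNTP2 L M) {α : Type x}
    {A : Set M} (hA : #A < κ) (hE : IsExtensionBase L A) {p : Set (PFormula L M α)}
    (hpA : IsOver p A) (hp : IsSimpleType p) {a : α → M} (ha : Realizes a p) {B C : Set M}
    (hAB : A ⊆ B) (hB : #B < κ) (hab : NF L A a B) (hbc : NF L B a C) : NF L A a C := by
  rw [nf_iff_forall_comp] at hab hbc ⊢
  intro m f
  have hq := hp.projType hpA f
  have hqA := isOver_projType A p f
  have hqB : IsOver (projType A p f) B := fun θ hθ i => hAB (hqA θ hθ i)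
  have haf := ha.projType (A := A) f
  rw [nf_iff_forall_range]
  intro n c hc
  have h1 : NDset L A B (a ∘ f) := by
    intro γ _ b hb
    have h2 := hM.ndset_of_coSimple hA hqA (hM.isCoSimple_of_finite hT hA hqA hq) haf (b := b)
      ((hab m f).mono (Set.union_subset_union_right _ (by
        rintro _ ⟨i, rfl⟩
        exact hb i)))
    exact h2 γ b fun i => ⟨i, rfl⟩
  have h3 : NDset L B (Set.range c) (a ∘ f) :=
    hM.ndset_of_coSimple hB hqB (hM.isCoSimple_of_finite hT hB hqB hq) haf
      (nf_iff_forall_range.1 (hbc m f) n c hc)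
  -- A formula dividing over `A` still divides over `B` by `h1`, and `h3` then excludes it.
  have h4 : NDset L A (Set.range c) (a ∘ f) := by
    intro γ _ b hb ρ k hρ hk
    have h5 := hM.div_union hA hB h1 hρ hk
    rw [Set.union_eq_self_of_subset_left hAB] at h5
    exact h3 γ b hb ρ k (hρ.mono hAB) h5
  exact hM.nf_of_ndset hT hA hE (hM.ndset_of_simple hA hqA hq haf
    (hM.nf_of_ndset hT hA hE h4))

end SimpleTypes

end ModelTheory

theorem mainTheorem6 {L : FirstOrder.Language.{u, v}} {T : L.Theory}
    {M : Type w} [L.Structure M] {κ : Cardinal.{w}}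
    (hM : ModelTheory.IsMonster T M κ) (hT : ModelTheory.IsNTP2 L M)
    {α : Type x} (A : Set M) (hA : Cardinal.mk A < κ)
    (p : Set (ModelTheory.PFormula L M α)) (hpA : ModelTheory.IsOver p A)
    (hp : ModelTheory.IsSimpleType p) :
    ModelTheory.IsCoSimpleType p A ∧
    (ModelTheory.IsExtensionBase L A →
      (∀ (a : α → M) {β : Type y} (b : β → M), ModelTheory.Realizes a p →
        (ModelTheory.NonForking L a A (Set.range b) ↔
          ModelTheory.NonForking L b A (Set.range a))) ∧
      (∀ (a : α → M) (B C : Set M), ModelTheory.Realizes a p → A ⊆ B → Cardinal.mk B < κ →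
        ModelTheory.NonForking L a A B → ModelTheory.NonForking L a B C →
          ModelTheory.NonForking L a A C)) := by
  rcases isEmpty_or_nonempty M with _ | _
  · exact ⟨ModelTheory.isCoSimple_of_isEmpty A p, fun _ =>
      ⟨fun a β b _ => iff_of_true (ModelTheory.nonForking_of_isEmpty _ _ _)
        (ModelTheory.nonForking_of_isEmpty _ _ _),
      fun a B C _ _ _ _ _ => ModelTheory.nonForking_of_isEmpty _ _ _⟩⟩
  · refine ⟨hM.isCoSimple hT hA hpA hp, fun hE => ⟨fun a β b ha => ?_,
      fun a B C ha hAB hB hab hbc => ?_⟩⟩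
    · rw [ModelTheory.nonForking_iff, ModelTheory.nonForking_iff]
      exact hM.nf_symm hT hA hE hpA hp ha b
    · rw [ModelTheory.nonForking_iff] at hab hbc ⊢
      exact hM.nf_trans hT hA hE hpA hp ha hAB hB hab hbc
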